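/- Let $p$ be a prime and let $(K,\mathcal O,k)$ be a $p$-modular system: $\mathcal O$ is a complete discrete valuation ring with residue field $k$ of characteristic $p$ and field of fractions $K$ of characteristic zero. All $\mathcal O$-algebras below are finitely generated free as $\mathcal O$-modules. For a ring $S$ let $\mathcal R(S)$ be the Grothendieck group, with respect to split exact sequences, of finitely generated left $S$-modules. For $\mathcal O$-algebras $A,B$ let $\mathcal R(A,B)=\mathcal R(A\otimes_{\mathcal O}B^{\mathrm{op}})$, let $\mathcal P(A,B)$ be its subgroup generated by the classes of $(A,B)$-bimodules that are finitely generated projective as left $A$-modules and as right $B$-modules, and let $-\cdot_B-$ be the biadditive map induced by $\otimes_B$ (likewise over a field in place of $\mathcal O$, and for left modules in the second variable). An $\mathcal O$-algebra $A$ is symmetric if $A\cong A^\vee=\mathrm{Hom}_{\mathcal O}(A,\mathcal O)$ as $(A,A)$-bimodules; for symmetric $A,B$ the rule $[X]\mapsto[\mathrm{Hom}_{\mathcal O}(X,\mathcal O)]$ induces a homomorphism $M\mapsto M^\vee$, $\mathcal P(B,A)\to\mathcal P(A,B)$. Let $A$ and $B$ be symmetric $\mathcal O$-algebras, and let $K'$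 be an extension field of $K$ such that $K'A=K'\otimes_{\mathcal O}A$ and $K'B=K'\otimes_{\mathcal O}B$ are split semisimple, i.e. semisimple and such that every simple module has only scalar endomorphisms. Let $M\in\mathcal P(B,A)$ be such that $M$ and $M^\vee$ induce a virtual Morita equivalence, that is, $M\cdot_A M^\vee=[B]$ in $\mathcal R(B,B)$ and $M^\vee\cdot_B M=[A]$ in $\mathcal R(A,A)$. Write $K'M$ for the image of $M$ in $\mathcal R(K'B,K'A)$ under extension of scalars. Let $\mathrm{Irr}(K'A)\subset\mathcal R(K'A)$ be the set of classes of simple $K'A$-modules, and for $\chi=[S]\in\mathrm{Irr}(K'A)$ let $e_\chi$ be the unique primitive idempotent of the center $Z(K'A)$ with $e_\chi S\neq 0$; similarly for $B$. For a field automorphism $\sigma$ of $K'$ over $K$ and $\chi=[S]$, let ${}^\sigma\chi$ be the class of the module equal to $S$ as an abelian group on which $\lambda\otimes a$ acts as $\sigma^{-1}(\lambda)\otimes a$. Then there are a bijection $I:\mathrm{Irr}(K'A)\to\mathrm{Irr}(K'B)$ and signs $\epsilon_\chi\in\{\pm1\}$ such that $$\epsilon_\chi\, I(\chi)=K'M\cdot_{K'A}\chi\quad\text{in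 }\mathcal R(K'B),\qquad\text{for all }\chi\in\mathrm{Irr}(K'A).$$ Moreover: (a) There is a unique $K'$-algebra isomorphism $Z(K'A)\cong Z(K'B)$ sending $e_\chi$ to $e_{I(\chi)}$ for all $\chi\in\mathrm{Irr}(K'A)$, and it restricts to an $\mathcal O$-algebra isomorphism $Z(A)\cong Z(B)$. (b) $I({}^\sigma\chi)={}^\sigma I(\chi)$ for all $\sigma\in\mathrm{Aut}(K'/K)$ and all $\chi\in\mathrm{Irr}(K'A)$. -/

import Mathlib

open scoped TensorProduct
open MulOpposite

universe u

noncomputable section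

/-! ### Finitely generated modules and the Grothendieck group for split exact sequences -/

/-- A finitely generated left module over the ring `S`. -/
structure FGMod (S : Type u) [Ring S] where
  carrier : Type u
  [addCommGroup : AddCommGroup carrier]
  [module : Module S carrier]
  [finite : Module.Finite S carrier]

namespace FGMod

instance (S : Type u) [Ring S] : CoeSort (FGMod S) (Type u) := ⟨FGMod.carrier⟩

attribute [instance] FGMod.addCommGroup FGMod.module FGMod.finite

variable {S : Type u} [Ring S]

/-- Two finitely generated modules are identified when they are isomorphic. -/
instance isoSetoid (S : Type u) [Ring S] : Setoid (FGMod S) where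
  r X Y := Nonempty (X ≃ₗ[S] Y)
  iseqv :=
    ⟨fun X => ⟨LinearEquiv.refl S X⟩, fun ⟨e⟩ => ⟨e.symm⟩, fun ⟨e⟩ ⟨f⟩ => ⟨e.trans f⟩⟩

/-- The zero module. -/
def zero (S : Type u) [Ring S] : FGMod S := ⟨PUnit.{u + 1}⟩

/-- The direct sum of two modules. -/
def sum (X Y : FGMod S) : FGMod S := ⟨X × Y⟩

end FGMod

/-- Isomorphism classes of finitely generated `S`-modules. -/
def IsoClass (S : Type u) [Ring S] : Type (u + 1) := Quotient (FGMod.isoSetoid S)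

/-- The isomorphism class of a module. -/
def IsoClass.mk {S : Type u} [Ring S] (X : FGMod S) : IsoClass S := Quotient.mk _ X

instance (S : Type u) [Ring S] : Zero (IsoClass S) := ⟨IsoClass.mk (FGMod.zero S)⟩

instance (S : Type u) [Ring S] : Add (IsoClass S) :=
  ⟨Quotient.map₂ FGMod.sum fun _ _ ⟨e⟩ _ _ ⟨f⟩ => ⟨LinearEquiv.prodCongr e f⟩⟩

/-- The isomorphism classes form a commutative monoid under direct sum. -/
instance (S : Type u) [Ring S] : AddCommMonoid (IsoClass S) where
  add_assoc := by
    rintro ⟨X⟩ ⟨Y⟩ ⟨Z⟩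
    exact Quotient.sound ⟨LinearEquiv.prodAssoc S X Y Z⟩
  zero_add := by
    rintro ⟨X⟩
    exact Quotient.sound ⟨LinearEquiv.uniqueProd (M₂ := PUnit.{u + 1})⟩
  add_zero := by
    rintro ⟨X⟩
    exact Quotient.sound ⟨LinearEquiv.prodUnique (M₂ := PUnit.{u + 1})⟩
  add_comm := by
    rintro ⟨X⟩ ⟨Y⟩
    exact Quotient.sound ⟨LinearEquiv.prodComm S X Y⟩
  nsmul := nsmulRec

/-- The Grothendieck group of finitely generated `S`-modules with respect to split exact
sequences: the group completion of the monoid of isomorphism classes under direct sum. -/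
abbrev SplitK0 (S : Type u) [Ring S] : Type (u + 1) :=
  Algebra.GrothendieckAddGroup (IsoClass S)

/-- The class `[X]` of a finitely generated module. -/
def cls {S : Type u} [Ring S] (X : FGMod S) : SplitK0 S :=
  Algebra.GrothendieckAddGroup.of (IsoClass.mk X)

section K0

variable {S T U : Type u} [Ring S] [Ring T] [Ring U]

theorem cls_congr {X Y : FGMod S} (e : X ≃ₗ[S] Y) : cls X = cls Y :=
  congrArg Algebra.GrothendieckAddGroup.of
    (show IsoClass.mk X = IsoClass.mk Y from Quotient.sound ⟨e⟩)

theorem cls_sum (X Y : FGMod S) : cls (X.sum Y) = cls X + cls Y :=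
  map_add Algebra.GrothendieckAddGroup.of (IsoClass.mk X) (IsoClass.mk Y)

/-- The homomorphism out of the Grothendieck group induced by a function on modules that is
invariant under isomorphisms and additive on direct sums. -/
def SplitK0.lift {G : Type*} [AddCommGroup G] (F : FGMod S → G)
    (hiso : ∀ X Y : FGMod S, Nonempty (X ≃ₗ[S] Y) → F X = F Y)
    (hadd : ∀ X Y, F (X.sum Y) = F X + F Y) : SplitK0 S →+ G :=
  Algebra.GrothendieckAddGroup.lift
    { toFun := Quotient.lift F hiso
      map_zero' := by
        have h := hadd (FGMod.zero S) (FGMod.zero S)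
        rw [hiso ((FGMod.zero S).sum (FGMod.zero S)) (FGMod.zero S)
          ⟨LinearEquiv.prodUnique (M₂ := PUnit.{u + 1})⟩] at h
        exact left_eq_add.mp h
      map_add' := by
        rintro ⟨X⟩ ⟨Y⟩
        exact hadd X Y }

theorem SplitK0.lift_cls {G : Type*} [AddCommGroup G] (F : FGMod S → G)
    (hiso : ∀ X Y : FGMod S, Nonempty (X ≃ₗ[S] Y) → F X = F Y)
    (hadd : ∀ X Y, F (X.sum Y) = F X + F Y) (X : FGMod S) :
    SplitK0.lift F hiso hadd (cls X) = F X := by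
  have := Algebra.GrothendieckAddGroup.lift.symm_apply_apply
    { toFun := Quotient.lift F hiso
      map_zero' := by
        have h := hadd (FGMod.zero S) (FGMod.zero S)
        rw [hiso ((FGMod.zero S).sum (FGMod.zero S)) (FGMod.zero S)
          ⟨LinearEquiv.prodUnique (M₂ := PUnit.{u + 1})⟩] at h
        exact left_eq_add.mp h
      map_add' := by
        rintro ⟨X⟩ ⟨Y⟩
        exact hadd X Y : IsoClass S →+ G }
  exact DFunLike.congr_fun this (IsoClass.mk X)

/-- An additive functor between categories of finitely generated modules. -/
structure FGFunctor (S T : Type u) [Ring S] [Ring T] where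
  obj : FGMod S → FGMod T
  map : ∀ {X Y : FGMod S}, (X →ₗ[S] Y) → (obj X →ₗ[T] obj Y)
  map_id : ∀ X : FGMod S, map (LinearMap.id : X →ₗ[S] X) = LinearMap.id
  map_comp : ∀ {X Y Z : FGMod S} (g : Y →ₗ[S] Z) (f : X →ₗ[S] Y),
    map (g ∘ₗ f) = map g ∘ₗ map f
  map_add : ∀ {X Y : FGMod S} (f g : X →ₗ[S] Y), map (f + g) = map f + map g

namespace FGFunctor

variable (F : FGFunctor S T)

theorem map_zero {X Y : FGMod S} : F.map (0 : X →ₗ[S] Y) = 0 := by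
  have h := F.map_add (0 : X →ₗ[S] Y) 0
  rw [add_zero] at h
  exact left_eq_add.mp h

theorem cls_obj_congr (X Y : FGMod S) (h : Nonempty (X ≃ₗ[S] Y)) :
    cls (F.obj X) = cls (F.obj Y) := by
  obtain ⟨e⟩ := h
  refine cls_congr (LinearEquiv.ofLinearMap (F.map e.toLinearMap) (F.map e.symm.toLinearMap) ?_ ?_)
  · rw [← F.map_comp, ← F.map_id]; congr 1; ext; simp
  · rw [← F.map_comp, ← F.map_id]; congr 1; ext; simp

theorem cls_obj_sum (X Y : FGMod S) :
    cls (F.obj (X.sum Y)) = cls (F.obj X) + cls (F.obj Y) := by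
  rw [← cls_sum]
  let p₁ : X.sum Y →ₗ[S] X := LinearMap.fst S X Y
  let p₂ : X.sum Y →ₗ[S] Y := LinearMap.snd S X Y
  let i₁ : X →ₗ[S] X.sum Y := LinearMap.inl S X Y
  let i₂ : Y →ₗ[S] X.sum Y := LinearMap.inr S X Y
  have h₁₁ : p₁ ∘ₗ i₁ = LinearMap.id := LinearMap.fst_comp_inl ..
  have h₁₂ : p₁ ∘ₗ i₂ = 0 := LinearMap.fst_comp_inr ..
  have h₂₁ : p₂ ∘ₗ i₁ = 0 := LinearMap.snd_comp_inl ..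
  have h₂₂ : p₂ ∘ₗ i₂ = LinearMap.id := LinearMap.snd_comp_inr ..
  have hs : i₁ ∘ₗ p₁ + i₂ ∘ₗ p₂ = LinearMap.id := by
    refine LinearMap.ext fun z => ?_
    exact Prod.ext (add_zero z.1) (zero_add z.2)
  let f : F.obj (X.sum Y) →ₗ[T] F.obj X × F.obj Y := (F.map p₁).prod (F.map p₂)
  let g : F.obj X × F.obj Y →ₗ[T] F.obj (X.sum Y) := (F.map i₁).coprod (F.map i₂)
  refine cls_congr (Y := (F.obj X).sum (F.obj Y)) (LinearEquiv.ofLinearMap f g ?_ ?_)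
  · have e₁₁ := fun x => LinearMap.congr_fun ((F.map_comp p₁ i₁).symm.trans
      ((congrArg F.map h₁₁).trans (F.map_id X))) x
    have e₁₂ := fun x => LinearMap.congr_fun ((F.map_comp p₁ i₂).symm.trans
      ((congrArg F.map h₁₂).trans F.map_zero)) x
    have e₂₁ := fun x => LinearMap.congr_fun ((F.map_comp p₂ i₁).symm.trans
      ((congrArg F.map h₂₁).trans F.map_zero)) x
    have e₂₂ := fun x => LinearMap.congr_fun ((F.map_comp p₂ i₂).symm.trans
      ((congrArg F.map h₂₂).trans (F.map_id Y))) x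
    simp only [LinearMap.comp_apply, LinearMap.id_apply, LinearMap.zero_apply] at e₁₁ e₁₂ e₂₁ e₂₂
    refine LinearMap.ext fun z => Prod.ext ?_ ?_
    · change F.map p₁ (F.map i₁ z.1 + F.map i₂ z.2) = z.1
      rw [_root_.map_add, e₁₁, e₁₂, add_zero]
    · change F.map p₂ (F.map i₁ z.1 + F.map i₂ z.2) = z.2
      rw [_root_.map_add, e₂₁, e₂₂, zero_add]
  · refine LinearMap.ext fun z => ?_
    change F.map i₁ (F.map p₁ z) + F.map i₂ (F.map p₂ z) = z
    have h := LinearMap.congr_fun ((F.map_add (i₁ ∘ₗ p₁) (i₂ ∘ₗ p₂)).symm.trans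
      ((congrArg F.map hs).trans (F.map_id _))) z
    rwa [F.map_comp, F.map_comp] at h

/-- The homomorphism `[X] ↦ [F X]`. -/
def K0map : SplitK0 S →+ SplitK0 T :=
  SplitK0.lift (fun X => cls (F.obj X)) F.cls_obj_congr F.cls_obj_sum

theorem K0map_cls (X : FGMod S) : F.K0map (cls X) = cls (F.obj X) := SplitK0.lift_cls ..

end FGFunctor

/-- A contravariant additive functor between categories of finitely generated modules. -/
structure FGCofunctor (S T : Type u) [Ring S] [Ring T] where
  obj : FGMod S → FGMod T
  map : ∀ {X Y : FGMod S}, (X →ₗ[S] Y) → (obj Y →ₗ[T] obj X)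
  map_id : ∀ X : FGMod S, map (LinearMap.id : X →ₗ[S] X) = LinearMap.id
  map_comp : ∀ {X Y Z : FGMod S} (g : Y →ₗ[S] Z) (f : X →ₗ[S] Y),
    map (g ∘ₗ f) = map f ∘ₗ map g
  map_add : ∀ {X Y : FGMod S} (f g : X →ₗ[S] Y), map (f + g) = map f + map g

namespace FGCofunctor

variable (F : FGCofunctor S T)

theorem map_zero {X Y : FGMod S} : F.map (0 : X →ₗ[S] Y) = 0 := by
  have h := F.map_add (0 : X →ₗ[S] Y) 0
  rw [add_zero] at h
  exact left_eq_add.mp h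

theorem cls_obj_congr (X Y : FGMod S) (h : Nonempty (X ≃ₗ[S] Y)) :
    cls (F.obj X) = cls (F.obj Y) := by
  obtain ⟨e⟩ := h
  refine cls_congr (LinearEquiv.ofLinearMap (F.map e.symm.toLinearMap) (F.map e.toLinearMap) ?_ ?_)
  · rw [← F.map_comp, ← F.map_id]; congr 1; ext; simp
  · rw [← F.map_comp, ← F.map_id]; congr 1; ext; simp

theorem cls_obj_sum (X Y : FGMod S) :
    cls (F.obj (X.sum Y)) = cls (F.obj X) + cls (F.obj Y) := by
  rw [← cls_sum]
  let p₁ : X.sum Y →ₗ[S] X := LinearMap.fst S X Y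
  let p₂ : X.sum Y →ₗ[S] Y := LinearMap.snd S X Y
  let i₁ : X →ₗ[S] X.sum Y := LinearMap.inl S X Y
  let i₂ : Y →ₗ[S] X.sum Y := LinearMap.inr S X Y
  have h₁₁ : p₁ ∘ₗ i₁ = LinearMap.id := LinearMap.fst_comp_inl ..
  have h₁₂ : p₁ ∘ₗ i₂ = 0 := LinearMap.fst_comp_inr ..
  have h₂₁ : p₂ ∘ₗ i₁ = 0 := LinearMap.snd_comp_inl ..
  have h₂₂ : p₂ ∘ₗ i₂ = LinearMap.id := LinearMap.snd_comp_inr ..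
  have hs : i₁ ∘ₗ p₁ + i₂ ∘ₗ p₂ = LinearMap.id := by
    refine LinearMap.ext fun z => ?_
    exact Prod.ext (add_zero z.1) (zero_add z.2)
  let f : F.obj (X.sum Y) →ₗ[T] F.obj X × F.obj Y := (F.map i₁).prod (F.map i₂)
  let g : F.obj X × F.obj Y →ₗ[T] F.obj (X.sum Y) := (F.map p₁).coprod (F.map p₂)
  refine cls_congr (Y := (F.obj X).sum (F.obj Y)) (LinearEquiv.ofLinearMap f g ?_ ?_)
  · have e₁₁ := fun x => LinearMap.congr_fun ((F.map_comp p₁ i₁).symm.trans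
      ((congrArg F.map h₁₁).trans (F.map_id X))) x
    have e₁₂ := fun x => LinearMap.congr_fun ((F.map_comp p₁ i₂).symm.trans
      ((congrArg F.map h₁₂).trans F.map_zero)) x
    have e₂₁ := fun x => LinearMap.congr_fun ((F.map_comp p₂ i₁).symm.trans
      ((congrArg F.map h₂₁).trans F.map_zero)) x
    have e₂₂ := fun x => LinearMap.congr_fun ((F.map_comp p₂ i₂).symm.trans
      ((congrArg F.map h₂₂).trans (F.map_id Y))) x
    simp only [LinearMap.comp_apply, LinearMap.id_apply, LinearMap.zero_apply] at e₁₁ e₁₂ e₂₁ e₂₂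
    refine LinearMap.ext fun z => Prod.ext ?_ ?_
    · change F.map i₁ (F.map p₁ z.1 + F.map p₂ z.2) = z.1
      rw [_root_.map_add, e₁₁, e₂₁, add_zero]
    · change F.map i₂ (F.map p₁ z.1 + F.map p₂ z.2) = z.2
      rw [_root_.map_add, e₂₂, e₁₂, zero_add]
  · refine LinearMap.ext fun z => ?_
    change F.map p₁ (F.map i₁ z) + F.map p₂ (F.map i₂ z) = z
    have h := LinearMap.congr_fun ((F.map_add (i₁ ∘ₗ p₁) (i₂ ∘ₗ p₂)).symm.trans
      ((congrArg F.map hs).trans (F.map_id _))) z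
    rwa [F.map_comp, F.map_comp] at h

/-- The homomorphism `[X] ↦ [F X]`. -/
def K0map : SplitK0 S →+ SplitK0 T :=
  SplitK0.lift (fun X => cls (F.obj X)) F.cls_obj_congr F.cls_obj_sum

theorem K0map_cls (X : FGMod S) : F.K0map (cls X) = cls (F.obj X) := SplitK0.lift_cls ..

end FGCofunctor

/-- A biadditive functor of two variables between categories of finitely generated modules. -/
structure FGBifunctor (S T U : Type u) [Ring S] [Ring T] [Ring U] where
  obj : FGMod S → FGMod T → FGMod U
  map : ∀ {X X' : FGMod S} {Y Y' : FGMod T}, (X →ₗ[S] X') → (Y →ₗ[T] Y') →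
    (obj X Y →ₗ[U] obj X' Y')
  map_id : ∀ (X : FGMod S) (Y : FGMod T),
    map (LinearMap.id : X →ₗ[S] X) (LinearMap.id : Y →ₗ[T] Y) = LinearMap.id
  map_comp : ∀ {X X' X'' : FGMod S} {Y Y' Y'' : FGMod T} (f' : X' →ₗ[S] X'') (f : X →ₗ[S] X')
    (g' : Y' →ₗ[T] Y'') (g : Y →ₗ[T] Y'), map (f' ∘ₗ f) (g' ∘ₗ g) = map f' g' ∘ₗ map f g
  map_add_left : ∀ {X X' : FGMod S} {Y Y' : FGMod T} (f f' : X →ₗ[S] X') (g : Y →ₗ[T] Y'),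
    map (f + f') g = map f g + map f' g
  map_add_right : ∀ {X X' : FGMod S} {Y Y' : FGMod T} (f : X →ₗ[S] X') (g g' : Y →ₗ[T] Y'),
    map f (g + g') = map f g + map f g'

namespace FGBifunctor

variable (F : FGBifunctor S T U)

/-- The functor obtained by fixing the first variable. -/
def fixLeft (X : FGMod S) : FGFunctor T U where
  obj := F.obj X
  map g := F.map LinearMap.id g
  map_id := F.map_id X
  map_comp g f := by rw [← F.map_comp, LinearMap.comp_id]
  map_add f g := F.map_add_right _ f g

/-- The functor obtained by fixing the second variable. -/
def fixRight (Y : FGMod T) : FGFunctor S U where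
  obj X := F.obj X Y
  map f := F.map f LinearMap.id
  map_id X := F.map_id X Y
  map_comp g f := by rw [← F.map_comp, LinearMap.comp_id]
  map_add f g := F.map_add_left f g _

theorem K0_ext {G : Type*} [AddCommGroup G] {f g : SplitK0 S →+ G}
    (h : ∀ X, f (cls X) = g (cls X)) : f = g := by
  apply Algebra.GrothendieckAddGroup.lift.symm.injective
  refine AddMonoidHom.ext ?_
  rintro ⟨X⟩
  exact h X

/-- The biadditive map `([X], [Y]) ↦ [F X Y]`. -/
def K0map₂ : SplitK0 S →+ SplitK0 T →+ SplitK0 U :=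
  SplitK0.lift (fun X => (F.fixLeft X).K0map)
    (fun X X' h => K0_ext fun Y => by
      rw [FGFunctor.K0map_cls, FGFunctor.K0map_cls]
      exact (F.fixRight Y).cls_obj_congr X X' h)
    (fun X X' => K0_ext fun Y => by
      rw [AddMonoidHom.add_apply]
      simp only [FGFunctor.K0map_cls]
      exact (F.fixRight Y).cls_obj_sum X X')

theorem K0map₂_cls (X : FGMod S) (Y : FGMod T) :
    F.K0map₂ (cls X) (cls Y) = cls (F.obj X Y) := by
  rw [K0map₂, SplitK0.lift_cls, FGFunctor.K0map_cls]
  rfl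

end FGBifunctor

end K0

/-! ### Bimodules

An `(A, B)`-bimodule (with the same action of `R` on both sides) is a module over
`A ⊗[R] Bᵐᵒᵖ`. -/

section Bimodules

variable {R : Type u} [CommRing R]

/-- A module over an `R`-algebra is an `R`-module. -/
instance (priority := low) FGMod.baseModule {S : Type u} [Ring S] [Algebra R S] (X : FGMod S) :
    Module R X :=
  Module.compHom X (algebraMap R S)

instance FGMod.isScalarTower {S : Type u} [Ring S] [Algebra R S] (X : FGMod S) :
    IsScalarTower R S X where
  smul_assoc r s x := by
    rw [Algebra.smul_def, mul_smul]
    rfl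

theorem FGMod.finite_base {S : Type u} [Ring S] [Algebra R S] [Module.Finite R S] (X : FGMod S) :
    Module.Finite R X :=
  Module.Finite.trans S X

/-- The action of an `R`-algebra `S` on an `S`-module, as a homomorphism to `R`-linear
endomorphisms. -/
def FGMod.rep (R : Type u) [CommRing R] {S : Type u} [Ring S] [Algebra R S] (X : FGMod S) :
    S →ₐ[R] Module.End R X :=
  Algebra.lsmul R R X

/-- The `S`-module given by a representation of `S` on a finitely generated `R`-module. -/
def FGMod.ofRep {S V : Type u} [Ring S] [Algebra R S] [AddCommGroup V] [Module R V]
    [Module.Finite R V] (ρ : S →ₐ[R] Module.End R V) : FGMod S where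
  carrier := V
  module := Module.compHom V ρ.toRingHom
  finite := by
    let _ : Module S V := Module.compHom V ρ.toRingHom
    have _ : IsScalarTower R S V :=
      ⟨fun r s v => by
        change ρ (r • s) v = r • ρ s v
        rw [map_smul, LinearMap.smul_apply]⟩
    exact Module.Finite.of_restrictScalars_finite R S V

/-- An intertwining `R`-linear map is a homomorphism between the associated modules. -/
def FGMod.homOfRep {S V W : Type u} [Ring S] [Algebra R S] [AddCommGroup V] [Module R V]
    [Module.Finite R V] [AddCommGroup W] [Module R W] [Module.Finite R W]
    {ρ : S →ₐ[R] Module.End R V} {σ : S →ₐ[R] Module.End R W} (f : V →ₗ[R] W)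
    (h : ∀ s v, f (ρ s v) = σ s (f v)) :
    FGMod.ofRep ρ →ₗ[S] FGMod.ofRep σ where
  toFun := f
  map_add' := f.map_add
  map_smul' s v := h s v

variable {A B C : Type u} [Ring A] [Ring B] [Ring C] [Algebra R A] [Algebra R B] [Algebra R C]

/-- The left action on a bimodule: `leftAct X a x = a x`. -/
def leftAct (X : FGMod (A ⊗[R] Bᵐᵒᵖ)) : A →ₐ[R] Module.End R X :=
  (X.rep R).comp Algebra.TensorProduct.includeLeft

/-- The right action on a bimodule: `rightAct X (op b) x = x b`. -/
def rightAct (X : FGMod (A ⊗[R] Bᵐᵒᵖ)) : Bᵐᵒᵖ →ₐ[R] Module.End R X :=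
  (X.rep R).comp Algebra.TensorProduct.includeRight

theorem commute_leftAct_rightAct (X : FGMod (A ⊗[R] Bᵐᵒᵖ)) (a : A) (b : Bᵐᵒᵖ) :
    Commute (leftAct X a) (rightAct X b) := by
  have h : Commute ((a ⊗ₜ[R] (1 : Bᵐᵒᵖ)) : A ⊗[R] Bᵐᵒᵖ) ((1 : A) ⊗ₜ[R] b) := by
    simp [Commute, SemiconjBy]
  exact h.map (X.rep R)

/-- An `R`-module with commuting actions of `A` and `Bᵐᵒᵖ`, as a bimodule. -/
def bimodOfActs {V : Type u} [AddCommGroup V] [Module R V] [Module.Finite R V]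
    (l : A →ₐ[R] Module.End R V) (r : Bᵐᵒᵖ →ₐ[R] Module.End R V)
    (h : ∀ a b, Commute (l a) (r b)) : FGMod (A ⊗[R] Bᵐᵒᵖ) :=
  FGMod.ofRep (Algebra.TensorProduct.lift l r h)

/-- A map commuting with both actions is a bimodule homomorphism. -/
def bimodHom {V W : Type u} [AddCommGroup V] [Module R V] [Module.Finite R V]
    [AddCommGroup W] [Module R W] [Module.Finite R W]
    {l : A →ₐ[R] Module.End R V} {r : Bᵐᵒᵖ →ₐ[R] Module.End R V}
    {h : ∀ a b, Commute (l a) (r b)}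
    {l' : A →ₐ[R] Module.End R W} {r' : Bᵐᵒᵖ →ₐ[R] Module.End R W}
    {h' : ∀ a b, Commute (l' a) (r' b)} (f : V →ₗ[R] W)
    (hl : ∀ a v, f (l a v) = l' a (f v)) (hr : ∀ b v, f (r b v) = r' b (f v)) :
    bimodOfActs l r h →ₗ[A ⊗[R] Bᵐᵒᵖ] bimodOfActs l' r' h' :=
  FGMod.homOfRep f (fun s v => by
    induction s using TensorProduct.induction_on with
    | zero => simp
    | tmul a b => simp [Algebra.TensorProduct.lift_tmul, hl, hr]
    | add s t hs ht => simp [hs, ht])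

/-- The regular bimodule `A`, with `A` acting by left and by right multiplication. -/
def regularBimod (R A : Type u) [CommRing R] [Ring A] [Algebra R A] [Module.Finite R A] :
    FGMod (A ⊗[R] Aᵐᵒᵖ) :=
  FGMod.ofRep (AlgHom.mulLeftRight R A)

theorem map_leftAct {X X' : FGMod (A ⊗[R] Bᵐᵒᵖ)} (f : X →ₗ[A ⊗[R] Bᵐᵒᵖ] X') (a : A) (x : X) :
    f (leftAct X a x) = leftAct X' a (f x) :=
  f.map_smul (a ⊗ₜ[R] 1) x

theorem map_rightAct {X X' : FGMod (A ⊗[R] Bᵐᵒᵖ)} (f : X →ₗ[A ⊗[R] Bᵐᵒᵖ] X') (b : Bᵐᵒᵖ)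
    (x : X) : f (rightAct X b x) = rightAct X' b (f x) :=
  f.map_smul (1 ⊗ₜ[R] b) x

/-- A module homomorphism as an `R`-linear map. -/
def FGMod.baseHom (R : Type u) [CommRing R] {S : Type u} [Ring S] [Algebra R S] {X Y : FGMod S}
    (f : X →ₗ[S] Y) : X →ₗ[R] Y where
  toFun := f
  map_add' := f.map_add
  map_smul' r x := f.map_smul (algebraMap R S r) x

theorem map_rep {V V' : FGMod B} (g : V →ₗ[B] V') (b : B) (v : V) :
    FGMod.baseHom R g (V.rep R b v) = V'.rep R b (FGMod.baseHom R g v) :=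
  g.map_smul b v

/-! ### Tensor products over a noncommutative algebra -/

section BalTensor

variable {X X' X'' Y Y' Y'' : Type u} [AddCommGroup X] [Module R X] [AddCommGroup X'] [Module R X']
  [AddCommGroup X''] [Module R X''] [AddCommGroup Y] [Module R Y] [AddCommGroup Y'] [Module R Y']
  [AddCommGroup Y''] [Module R Y'']

/-- The relations `x b ⊗ y = x ⊗ b y`. -/
def balancedRel (ρ : Bᵐᵒᵖ →ₐ[R] Module.End R X) (τ : B →ₐ[R] Module.End R Y) :
    Submodule R (X ⊗[R] Y) :=
  Submodule.span R {t | ∃ x b y, t = ρ (op b) x ⊗ₜ[R] y - x ⊗ₜ[R] τ b y}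

/-- The tensor product over `B` of the right `B`-module `X` and the left `B`-module `Y`: the
quotient of `X ⊗[R] Y` by the relations `x b ⊗ y = x ⊗ b y`. -/
abbrev BalTensor (ρ : Bᵐᵒᵖ →ₐ[R] Module.End R X) (τ : B →ₐ[R] Module.End R Y) : Type u :=
  (X ⊗[R] Y) ⧸ balancedRel ρ τ

variable {ρ : Bᵐᵒᵖ →ₐ[R] Module.End R X} {τ : B →ₐ[R] Module.End R Y}
  {ρ' : Bᵐᵒᵖ →ₐ[R] Module.End R X'} {τ' : B →ₐ[R] Module.End R Y'}
  {ρ'' : Bᵐᵒᵖ →ₐ[R] Module.End R X''} {τ'' : B →ₐ[R] Module.End R Y''}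

/-- The map `f ⊗ g` between tensor products over `B`. -/
def BalTensor.map (f : X →ₗ[R] X') (g : Y →ₗ[R] Y')
    (hf : ∀ b x, f (ρ b x) = ρ' b (f x)) (hg : ∀ b y, g (τ b y) = τ' b (g y)) :
    BalTensor ρ τ →ₗ[R] BalTensor ρ' τ' :=
  Submodule.mapQ _ _ (TensorProduct.map f g) (by
    refine Submodule.span_le.mpr ?_
    rintro _ ⟨x, b, y, rfl⟩
    refine Submodule.subset_span ⟨f x, b, g y, ?_⟩
    simp [hf, hg])

theorem BalTensor.hom_ext {Z : Type*} [AddCommGroup Z] [Module R Z]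
    {f g : BalTensor ρ τ →ₗ[R] Z}
    (h : ∀ x y, f (Submodule.Quotient.mk (x ⊗ₜ[R] y)) = g (Submodule.Quotient.mk (x ⊗ₜ[R] y))) :
    f = g := by
  apply Submodule.linearMap_qext
  apply TensorProduct.ext'
  exact h

theorem BalTensor.map_mk (f : X →ₗ[R] X') (g : Y →ₗ[R] Y')
    (hf : ∀ b x, f (ρ b x) = ρ' b (f x)) (hg : ∀ b y, g (τ b y) = τ' b (g y)) (x : X) (y : Y) :
    BalTensor.map f g hf hg (Submodule.Quotient.mk (x ⊗ₜ[R] y)) =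
      Submodule.Quotient.mk (f x ⊗ₜ[R] g y) := rfl

variable (ρ τ) in
/-- An algebra acting on `X` by endomorphisms of right `B`-modules acts on `X ⊗_B Y`. -/
def BalTensor.actLeft (l : A →ₐ[R] Module.End R X) (h : ∀ a b, Commute (l a) (ρ b)) :
    A →ₐ[R] Module.End R (BalTensor ρ τ) where
  toFun a := BalTensor.map (l a) LinearMap.id
    (fun b x => LinearMap.congr_fun (h a b).eq x) (fun _ _ => rfl)
  map_one' := BalTensor.hom_ext fun x y => by simp [BalTensor.map_mk]
  map_mul' a b := BalTensor.hom_ext fun x y => by simp [BalTensor.map_mk]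
  map_zero' := BalTensor.hom_ext fun x y => by simp [BalTensor.map_mk]
  map_add' a b := BalTensor.hom_ext fun x y => by
    simp [BalTensor.map_mk, TensorProduct.add_tmul]
  commutes' r := BalTensor.hom_ext fun x y => by
    simp only [AlgHom.commutes, BalTensor.map_mk]
    exact congrArg Submodule.Quotient.mk (TensorProduct.smul_tmul' r x y).symm

variable (ρ τ) in
/-- An algebra acting on `Y` by endomorphisms of left `B`-modules acts on `X ⊗_B Y`. -/
def BalTensor.actRight (r : C →ₐ[R] Module.End R Y) (h : ∀ c b, Commute (r c) (τ b)) :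
    C →ₐ[R] Module.End R (BalTensor ρ τ) where
  toFun c := BalTensor.map LinearMap.id (r c) (fun _ _ => rfl)
    (fun b y => LinearMap.congr_fun (h c b).eq y)
  map_one' := BalTensor.hom_ext fun x y => by simp [BalTensor.map_mk]
  map_mul' a b := BalTensor.hom_ext fun x y => by simp [BalTensor.map_mk]
  map_zero' := BalTensor.hom_ext fun x y => by simp [BalTensor.map_mk]
  map_add' a b := BalTensor.hom_ext fun x y => by
    simp [BalTensor.map_mk, TensorProduct.tmul_add]
  commutes' r := BalTensor.hom_ext fun x y => by
    simp [BalTensor.map_mk]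

theorem BalTensor.map_actLeft {l : A →ₐ[R] Module.End R X} {h : ∀ a b, Commute (l a) (ρ b)}
    {l' : A →ₐ[R] Module.End R X'} {h' : ∀ a b, Commute (l' a) (ρ' b)}
    (f : X →ₗ[R] X') (g : Y →ₗ[R] Y')
    (hf : ∀ b x, f (ρ b x) = ρ' b (f x)) (hg : ∀ b y, g (τ b y) = τ' b (g y))
    (hl : ∀ a x, f (l a x) = l' a (f x)) (a : A) (t : BalTensor ρ τ) :
    BalTensor.map f g hf hg (BalTensor.actLeft ρ τ l h a t) =
      BalTensor.actLeft ρ' τ' l' h' a (BalTensor.map f g hf hg t) := by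
  have H : BalTensor.map f g hf hg ∘ₗ BalTensor.actLeft ρ τ l h a =
      BalTensor.actLeft ρ' τ' l' h' a ∘ₗ BalTensor.map f g hf hg :=
    BalTensor.hom_ext fun x y =>
      congrArg (fun z => Submodule.Quotient.mk (z ⊗ₜ[R] g y)) (hl a x)
  exact LinearMap.congr_fun H t

theorem BalTensor.map_actRight {r : C →ₐ[R] Module.End R Y} {h : ∀ c b, Commute (r c) (τ b)}
    {r' : C →ₐ[R] Module.End R Y'} {h' : ∀ c b, Commute (r' c) (τ' b)}
    (f : X →ₗ[R] X') (g : Y →ₗ[R] Y')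
    (hf : ∀ b x, f (ρ b x) = ρ' b (f x)) (hg : ∀ b y, g (τ b y) = τ' b (g y))
    (hr : ∀ c y, g (r c y) = r' c (g y)) (c : C) (t : BalTensor ρ τ) :
    BalTensor.map f g hf hg (BalTensor.actRight ρ τ r h c t) =
      BalTensor.actRight ρ' τ' r' h' c (BalTensor.map f g hf hg t) := by
  have H : BalTensor.map f g hf hg ∘ₗ BalTensor.actRight ρ τ r h c =
      BalTensor.actRight ρ' τ' r' h' c ∘ₗ BalTensor.map f g hf hg :=
    BalTensor.hom_ext fun x y =>
      congrArg (fun z => Submodule.Quotient.mk (f x ⊗ₜ[R] z)) (hr c y)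
  exact LinearMap.congr_fun H t

end BalTensor

section TensorFunctors

variable [Module.Finite R A] [Module.Finite R B] [Module.Finite R C]

/-- The `(A, C)`-bimodule `X ⊗_B Y` for an `(A, B)`-bimodule `X` and a `(B, C)`-bimodule `Y`. -/
def tensorBimod (X : FGMod (A ⊗[R] Bᵐᵒᵖ)) (Y : FGMod (B ⊗[R] Cᵐᵒᵖ)) : FGMod (A ⊗[R] Cᵐᵒᵖ) :=
  haveI := FGMod.finite_base (R := R) X
  haveI := FGMod.finite_base (R := R) Y
  bimodOfActs (V := BalTensor (rightAct X) (leftAct Y))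
    (BalTensor.actLeft _ _ (leftAct X) (commute_leftAct_rightAct X))
    (BalTensor.actRight _ _ (rightAct Y) (fun c b => (commute_leftAct_rightAct Y b c).symm))
    (fun _ _ => BalTensor.hom_ext fun _ _ => rfl)

/-- The left `A`-module `X ⊗_B V` for an `(A, B)`-bimodule `X` and a left `B`-module `V`. -/
def tensorMod (X : FGMod (A ⊗[R] Bᵐᵒᵖ)) (V : FGMod B) : FGMod A :=
  haveI := FGMod.finite_base (R := R) X
  haveI := FGMod.finite_base (R := R) V
  FGMod.ofRep (V := BalTensor (rightAct X) (V.rep R))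
    (BalTensor.actLeft _ _ (leftAct X) (commute_leftAct_rightAct X))

variable (R A B C) in
/-- The tensor product of bimodules as a functor. -/
def tensorBimodFunctor : FGBifunctor (A ⊗[R] Bᵐᵒᵖ) (B ⊗[R] Cᵐᵒᵖ) (A ⊗[R] Cᵐᵒᵖ) where
  obj := tensorBimod
  map {X X' Y Y'} f g :=
    haveI := FGMod.finite_base (R := R) X
    haveI := FGMod.finite_base (R := R) Y
    haveI := FGMod.finite_base (R := R) X'
    haveI := FGMod.finite_base (R := R) Y'
    bimodHom (BalTensor.map (FGMod.baseHom R f) (FGMod.baseHom R g)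
        (map_rightAct f) (map_leftAct g))
      (BalTensor.map_actLeft _ _ _ _ (map_leftAct f))
      (BalTensor.map_actRight _ _ _ _ (map_rightAct g))
  map_id X Y := LinearMap.ext <| LinearMap.congr_fun (R := R)
    (f := BalTensor.map (ρ := rightAct X) (τ := leftAct Y) (ρ' := rightAct X) (τ' := leftAct Y)
      (FGMod.baseHom R LinearMap.id) (FGMod.baseHom R LinearMap.id) (fun _ _ => rfl)
      (fun _ _ => rfl)) (g := LinearMap.id) <| BalTensor.hom_ext fun _ _ => rfl
  map_comp f' f g' g := LinearMap.ext <| LinearMap.congr_fun (R := R)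
    (f := BalTensor.map (FGMod.baseHom R (f' ∘ₗ f)) (FGMod.baseHom R (g' ∘ₗ g))
      (map_rightAct (f' ∘ₗ f)) (map_leftAct (g' ∘ₗ g)))
    (g := BalTensor.map (FGMod.baseHom R f') (FGMod.baseHom R g') (map_rightAct f')
        (map_leftAct g') ∘ₗ
      BalTensor.map (FGMod.baseHom R f) (FGMod.baseHom R g) (map_rightAct f) (map_leftAct g)) <|
    BalTensor.hom_ext fun _ _ => rfl
  map_add_left f f' g := LinearMap.ext <| LinearMap.congr_fun (R := R)
    (f := BalTensor.map (FGMod.baseHom R (f + f')) (FGMod.baseHom R g)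
      (map_rightAct (f + f')) (map_leftAct g))
    (g := BalTensor.map (FGMod.baseHom R f) (FGMod.baseHom R g) (map_rightAct f)
        (map_leftAct g) +
      BalTensor.map (FGMod.baseHom R f') (FGMod.baseHom R g) (map_rightAct f')
        (map_leftAct g)) <|
    BalTensor.hom_ext fun x y =>
      congrArg Submodule.Quotient.mk (TensorProduct.add_tmul (f x) (f' x) (g y))
  map_add_right f g g' := LinearMap.ext <| LinearMap.congr_fun (R := R)
    (f := BalTensor.map (FGMod.baseHom R f) (FGMod.baseHom R (g + g'))
      (map_rightAct f) (map_leftAct (g + g')))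
    (g := BalTensor.map (FGMod.baseHom R f) (FGMod.baseHom R g) (map_rightAct f)
        (map_leftAct g) +
      BalTensor.map (FGMod.baseHom R f) (FGMod.baseHom R g') (map_rightAct f)
        (map_leftAct g')) <|
    BalTensor.hom_ext fun x y =>
      congrArg Submodule.Quotient.mk (TensorProduct.tmul_add (f x) (g y) (g' y))

variable (R A B) in
/-- The tensor product of a bimodule and a left module as a functor. -/
def tensorModFunctor : FGBifunctor (A ⊗[R] Bᵐᵒᵖ) B A where
  obj := tensorMod
  map {X X' Y Y'} f g :=
    haveI := FGMod.finite_base (R := R) X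
    haveI := FGMod.finite_base (R := R) Y
    haveI := FGMod.finite_base (R := R) X'
    haveI := FGMod.finite_base (R := R) Y'
    FGMod.homOfRep (BalTensor.map (FGMod.baseHom R f) (FGMod.baseHom R g)
        (map_rightAct f) (map_rep g))
      (BalTensor.map_actLeft _ _ _ _ (map_leftAct f))
  map_id X Y := LinearMap.ext <| LinearMap.congr_fun (R := R)
    (f := BalTensor.map (ρ := rightAct X) (τ := Y.rep R) (ρ' := rightAct X) (τ' := Y.rep R)
      (FGMod.baseHom R LinearMap.id) (FGMod.baseHom R LinearMap.id) (fun _ _ => rfl)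
      (fun _ _ => rfl)) (g := LinearMap.id) <| BalTensor.hom_ext fun _ _ => rfl
  map_comp f' f g' g := LinearMap.ext <| LinearMap.congr_fun (R := R)
    (f := BalTensor.map (FGMod.baseHom R (f' ∘ₗ f)) (FGMod.baseHom R (g' ∘ₗ g))
      (map_rightAct (f' ∘ₗ f)) (map_rep (g' ∘ₗ g)))
    (g := BalTensor.map (FGMod.baseHom R f') (FGMod.baseHom R g') (map_rightAct f')
        (map_rep g') ∘ₗ
      BalTensor.map (FGMod.baseHom R f) (FGMod.baseHom R g) (map_rightAct f) (map_rep g)) <|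
    BalTensor.hom_ext fun _ _ => rfl
  map_add_left f f' g := LinearMap.ext <| LinearMap.congr_fun (R := R)
    (f := BalTensor.map (FGMod.baseHom R (f + f')) (FGMod.baseHom R g)
      (map_rightAct (f + f')) (map_rep g))
    (g := BalTensor.map (FGMod.baseHom R f) (FGMod.baseHom R g) (map_rightAct f) (map_rep g) +
      BalTensor.map (FGMod.baseHom R f') (FGMod.baseHom R g) (map_rightAct f') (map_rep g)) <|
    BalTensor.hom_ext fun x y =>
      congrArg Submodule.Quotient.mk (TensorProduct.add_tmul (f x) (f' x) (g y))
  map_add_right f g g' := LinearMap.ext <| LinearMap.congr_fun (R := R)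
    (f := BalTensor.map (FGMod.baseHom R f) (FGMod.baseHom R (g + g'))
      (map_rightAct f) (map_rep (g + g')))
    (g := BalTensor.map (FGMod.baseHom R f) (FGMod.baseHom R g) (map_rightAct f) (map_rep g) +
      BalTensor.map (FGMod.baseHom R f) (FGMod.baseHom R g') (map_rightAct f) (map_rep g')) <|
    BalTensor.hom_ext fun x y =>
      congrArg Submodule.Quotient.mk (TensorProduct.tmul_add (f x) (g y) (g' y))

end TensorFunctors


/-! ### Duals and bimodules that are projective on both sides -/

section Dual

/-- The left action `(b φ) x = φ (x b)` of `B` on the dual of an `(A, B)`-bimodule. -/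
def dualLeftAct (X : FGMod (A ⊗[R] Bᵐᵒᵖ)) : B →ₐ[R] Module.End R (Module.Dual R X) where
  toFun b := (rightAct X (op b)).dualMap
  map_one' := by ext; simp
  map_mul' a b := by ext; simp
  map_zero' := by ext; simp
  map_add' a b := by ext; simp
  commutes' r := by
    ext φ x
    change φ (rightAct X (algebraMap R Bᵐᵒᵖ r) x) = r • φ x
    rw [AlgHom.commutes, Module.algebraMap_end_apply, map_smul]

/-- The right action `(φ a) x = φ (a x)` of `A` on the dual of an `(A, B)`-bimodule. -/
def dualRightAct (X : FGMod (A ⊗[R] Bᵐᵒᵖ)) : Aᵐᵒᵖ →ₐ[R] Module.End R (Module.Dual R X) where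
  toFun a := (leftAct X (unop a)).dualMap
  map_one' := by ext; simp
  map_mul' a b := by ext; simp
  map_zero' := by ext; simp
  map_add' a b := by ext; simp
  commutes' r := by
    ext φ x
    change φ (leftAct X (algebraMap R A r) x) = r • φ x
    rw [AlgHom.commutes, Module.algebraMap_end_apply, map_smul]

theorem commute_dualActs (X : FGMod (A ⊗[R] Bᵐᵒᵖ)) (b : B) (a : Aᵐᵒᵖ) :
    Commute (dualLeftAct X b) (dualRightAct X a) := by
  ext φ x
  exact congrArg φ (LinearMap.congr_fun (commute_leftAct_rightAct X (unop a) (op b)).eq x)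

variable [IsNoetherianRing R] [Module.Finite R A] [Module.Finite R B]

/-- The dual `Hom_R(X, R)` of an `(A, B)`-bimodule, as a `(B, A)`-bimodule. -/
def dualBimod (X : FGMod (A ⊗[R] Bᵐᵒᵖ)) : FGMod (B ⊗[R] Aᵐᵒᵖ) :=
  haveI := FGMod.finite_base (R := R) X
  bimodOfActs (dualLeftAct X) (dualRightAct X) (commute_dualActs X)

variable (R A B) in
/-- Duality of bimodules as a contravariant functor. -/
def dualFunctor : FGCofunctor (A ⊗[R] Bᵐᵒᵖ) (B ⊗[R] Aᵐᵒᵖ) where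
  obj := dualBimod
  map {X Y} f :=
    haveI := FGMod.finite_base (R := R) X
    haveI := FGMod.finite_base (R := R) Y
    bimodHom (FGMod.baseHom R f).dualMap
      (fun b φ => LinearMap.ext fun x => congrArg φ (map_rightAct f (op b) x).symm)
      (fun a φ => LinearMap.ext fun x => congrArg φ (map_leftAct f (unop a) x).symm)
  map_id _ := rfl
  map_comp _ _ := rfl
  map_add f g := LinearMap.ext fun φ => LinearMap.ext fun x =>
    LinearMap.map_add (show Module.Dual R _ from φ) (f x) (g x)

end Dual

/-- The left `A`-module underlying an `(A, B)`-bimodule. -/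
abbrev leftModule (X : FGMod (A ⊗[R] Bᵐᵒᵖ)) : Module A X :=
  Module.compHom X (Algebra.TensorProduct.includeLeft : A →ₐ[R] A ⊗[R] Bᵐᵒᵖ).toRingHom

/-- The right `B`-module underlying an `(A, B)`-bimodule. -/
abbrev rightModule (X : FGMod (A ⊗[R] Bᵐᵒᵖ)) : Module Bᵐᵒᵖ X :=
  Module.compHom X (Algebra.TensorProduct.includeRight : Bᵐᵒᵖ →ₐ[R] A ⊗[R] Bᵐᵒᵖ).toRingHom

/-- The bimodule is finitely generated projective as a left `A`-module and as a right
`B`-module. -/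
structure IsBiprojective (X : FGMod (A ⊗[R] Bᵐᵒᵖ)) : Prop where
  finite_left : letI := leftModule X; Module.Finite A X
  projective_left : letI := leftModule X; Module.Projective A X
  finite_right : letI := rightModule X; Module.Finite Bᵐᵒᵖ X
  projective_right : letI := rightModule X; Module.Projective Bᵐᵒᵖ X

variable (R A B) in
/-- The subgroup generated by the classes of bimodules that are finitely generated projective
on both sides. -/
def biprojectiveSubgroup : AddSubgroup (SplitK0 (A ⊗[R] Bᵐᵒᵖ)) :=
  AddSubgroup.closure {m | ∃ X : FGMod (A ⊗[R] Bᵐᵒᵖ), IsBiprojective X ∧ cls X = m}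

variable (R A) in
/-- The algebra `A` is symmetric: it is isomorphic to its dual as an `(A, A)`-bimodule, where
`(a φ b) y = φ (b y a)`. -/
def IsSelfDualAlgebra : Prop :=
  ∃ e : A ≃ₗ[R] Module.Dual R A, ∀ a x b y : A, e (a * x * b) y = e x (b * y * a)

theorem projective_dual_aux {S T X : Type u} [Ring S] [Ring T] [Algebra R S] [Algebra R T]
    [AddCommGroup X] [Module R X] [Module S X] [IsScalarTower R S X] [Module.Finite S X]
    [Module.Projective S X] [Module T (Module.Dual R X)] (θ : T → S)
    (ε : T ≃ₗ[R] Module.Dual R S) (hε : ∀ t v y, ε (t * v) y = ε v (θ t * y))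
    (h : ∀ (t : T) (φ : Module.Dual R X) (x : X), (t • φ) x = φ (θ t • x)) :
    Module.Projective T (Module.Dual R X) := by
  obtain ⟨n, p, hp⟩ := Module.Finite.exists_fin' S X
  obtain ⟨i, hi⟩ := Module.projective_lifting_property p LinearMap.id hp
  have hi' : ∀ x, p (i x) = x := fun x => LinearMap.congr_fun hi x
  let g : Module.Dual R X → Fin n → Module.Dual R S := fun φ j =>
    φ ∘ₗ (p.restrictScalars R) ∘ₗ (LinearMap.single R (fun _ : Fin n => S) j)
  have hg : ∀ φ j y, g φ j y = φ (p (Pi.single j y)) := fun _ _ _ => rfl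
  let s : (Fin n → T) →ₗ[T] Module.Dual R X :=
    { toFun := fun v => ∑ j, (ε (v j)) ∘ₗ (LinearMap.proj j) ∘ₗ (i.restrictScalars R)
      map_add' := fun v w => by
        ext x
        simp [Finset.sum_add_distrib]
      map_smul' := fun t v => by
        ext x
        simp [h, hε] }
  have hs : ∀ v x, s v x = ∑ j, ε (v j) (i x j) := fun v x => by simp [s]
  let q : Module.Dual R X →ₗ[T] (Fin n → T) :=
    { toFun := fun φ j => ε.symm (g φ j)
      map_add' := fun φ ψ => by
        funext j
        rw [Pi.add_apply, ← map_add]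
        congr 1
      map_smul' := fun t φ => by
        funext j
        apply ε.injective
        ext y
        simp only [RingHom.id_apply, Pi.smul_apply, smul_eq_mul]
        rw [hε]
        simp only [LinearEquiv.apply_symm_apply, hg, h]
        rw [← map_smul, ← Pi.single_smul, smul_eq_mul] }
  refine Module.Projective.of_split q s (LinearMap.ext fun φ => LinearMap.ext fun x => ?_)
  rw [LinearMap.comp_apply, hs, LinearMap.id_apply]
  change ∑ j, ε (ε.symm (g φ j)) (i x j) = φ x
  simp only [LinearEquiv.apply_symm_apply, hg]
  rw [← map_sum, ← map_sum, Finset.univ_sum_single, hi']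

section Dual

variable [Module.Finite R A] [Module.Finite R B]

theorem finite_leftModule (X : FGMod (A ⊗[R] Bᵐᵒᵖ)) :
    letI := leftModule X; Module.Finite A X := by
  have _ := FGMod.finite_base (R := R) X
  let _ := leftModule X
  have _ : IsScalarTower R A X := ⟨fun r a x => by
    change ((r • a) ⊗ₜ[R] (1 : Bᵐᵒᵖ)) • x = r • ((a ⊗ₜ[R] (1 : Bᵐᵒᵖ)) • x)
    rw [← TensorProduct.smul_tmul', smul_assoc]⟩
  exact Module.Finite.of_restrictScalars_finite R A X

theorem finite_rightModule (X : FGMod (A ⊗[R] Bᵐᵒᵖ)) :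
    letI := rightModule X; Module.Finite Bᵐᵒᵖ X := by
  have _ := FGMod.finite_base (R := R) X
  let _ := rightModule X
  have _ : IsScalarTower R Bᵐᵒᵖ X := ⟨fun r b x => by
    change ((1 : A) ⊗ₜ[R] (r • b)) • x = r • (((1 : A) ⊗ₜ[R] b) • x)
    rw [TensorProduct.tmul_smul, smul_assoc]⟩
  exact Module.Finite.of_restrictScalars_finite R Bᵐᵒᵖ X

variable [IsNoetherianRing R]

theorem isBiprojective_dual (hA : IsSelfDualAlgebra R A) (hB : IsSelfDualAlgebra R B)
    {X : FGMod (A ⊗[R] Bᵐᵒᵖ)} (hX : IsBiprojective X) : IsBiprojective (dualBimod X) := by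
  obtain ⟨e, he⟩ := hA
  obtain ⟨e', he'⟩ := hB
  refine ⟨finite_leftModule _, ?_, finite_rightModule _, ?_⟩
  · let _ : Module Bᵐᵒᵖ X := rightModule X
    have _ := hX.finite_right
    have _ := hX.projective_right
    have _ : IsScalarTower R Bᵐᵒᵖ X := ⟨fun r b x => by
      change ((1 : A) ⊗ₜ[R] (r • b)) • x = r • (((1 : A) ⊗ₜ[R] b) • x)
      rw [TensorProduct.tmul_smul, smul_assoc]⟩
    let _ : Module B (Module.Dual R X) := leftModule (dualBimod X)
    refine projective_dual_aux (X := X) (S := Bᵐᵒᵖ) (T := B) op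
      (e'.trans (MulOpposite.opLinearEquiv R).dualMap.symm) (fun t v y => ?_) (fun t φ x => ?_)
    · change e' (t * v) (unop y) = e' v (unop (op t * y))
      simpa using he' t v 1 (unop y)
    · change (Algebra.TensorProduct.lift (dualLeftAct X) (dualRightAct X)
        (commute_dualActs X)
        (t ⊗ₜ[R] (1 : Aᵐᵒᵖ)) φ) x = φ (rightAct X (op t) x)
      rw [Algebra.TensorProduct.lift_tmul, map_one, mul_one]
      rfl
  · let _ : Module A X := leftModule X
    have _ := hX.finite_left
    have _ := hX.projective_left
    have _ : IsScalarTower R A X := ⟨fun r a x => by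
      change ((r • a) ⊗ₜ[R] (1 : Bᵐᵒᵖ)) • x = r • ((a ⊗ₜ[R] (1 : Bᵐᵒᵖ)) • x)
      rw [← TensorProduct.smul_tmul', smul_assoc]⟩
    let _ : Module Aᵐᵒᵖ (Module.Dual R X) := rightModule (dualBimod X)
    refine projective_dual_aux (X := X) (S := A) (T := Aᵐᵒᵖ) unop
      ((MulOpposite.opLinearEquiv R).symm.trans e) (fun t v y => ?_) (fun t φ x => ?_)
    · change e (unop v * unop t) y = e (unop v) (unop t * y)
      simpa using he 1 (unop v) (unop t) y
    · change (Algebra.TensorProduct.lift (dualLeftAct X) (dualRightAct X)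
        (commute_dualActs X)
        ((1 : B) ⊗ₜ[R] t) φ) x = φ (leftAct X (unop t) x)
      rw [Algebra.TensorProduct.lift_tmul, map_one, one_mul]
      rfl

/-- For symmetric algebras, duality `[X] ↦ [Hom_R(X, R)]` on the groups generated by the
bimodules that are finitely generated projective on both sides. -/
def virtualDual (hA : IsSelfDualAlgebra R A) (hB : IsSelfDualAlgebra R B) :
    biprojectiveSubgroup R A B →+ biprojectiveSubgroup R B A :=
  ((dualFunctor R A B).K0map.comp (biprojectiveSubgroup R A B).subtype).codRestrict
    (biprojectiveSubgroup R B A) (by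
      rintro ⟨m, hm⟩
      change (dualFunctor R A B).K0map m ∈ _
      induction hm using AddSubgroup.closure_induction with
      | mem x hx =>
        obtain ⟨X, hX, rfl⟩ := hx
        rw [FGCofunctor.K0map_cls]
        exact AddSubgroup.subset_closure ⟨_, isBiprojective_dual hA hB hX, rfl⟩
      | zero => rw [map_zero]; exact zero_mem _
      | add x y _ _ hx hy => rw [map_add]; exact add_mem hx hy
      | neg x _ hx => rw [map_neg]; exact neg_mem hx)

end Dual

/-! ### Virtual Morita equivalences -/

/-- The product `M ·_B N` of virtual bimodules, induced by the tensor product over `B`. -/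
def virtualTensor [Module.Finite R A] [Module.Finite R B] [Module.Finite R C]
    (M : SplitK0 (A ⊗[R] Bᵐᵒᵖ)) (N : SplitK0 (B ⊗[R] Cᵐᵒᵖ)) : SplitK0 (A ⊗[R] Cᵐᵒᵖ) :=
  (tensorBimodFunctor R A B C).K0map₂ M N

/-- The product `M ·_B χ` of a virtual `(A, B)`-bimodule and a virtual `B`-module, induced by the
tensor product over `B`. -/
def virtualAct [Module.Finite R A] [Module.Finite R B]
    (M : SplitK0 (A ⊗[R] Bᵐᵒᵖ)) (χ : SplitK0 B) : SplitK0 A :=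
  (tensorModFunctor R A B).K0map₂ M χ

/-- The virtual bimodules `M` and `N` induce a virtual Morita equivalence between `A` and `B`. -/
structure IsVirtualMorita [Module.Finite R A] [Module.Finite R B]
    (M : biprojectiveSubgroup R A B) (N : biprojectiveSubgroup R B A) : Prop where
  left : virtualTensor (M : SplitK0 (A ⊗[R] Bᵐᵒᵖ)) (N : SplitK0 (B ⊗[R] Aᵐᵒᵖ)) =
    cls (regularBimod R A)
  right : virtualTensor (N : SplitK0 (B ⊗[R] Aᵐᵒᵖ)) (M : SplitK0 (A ⊗[R] Bᵐᵒᵖ)) =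
    cls (regularBimod R B)

/-! ### Extension of scalars -/

section BaseChange

variable (F : Type u) [CommRing F] [Algebra R F]

/-- The left action of `F ⊗[R] A` on `F ⊗[R] X`. -/
def baseChangeLeftAct (X : FGMod (A ⊗[R] Bᵐᵒᵖ)) :
    F ⊗[R] A →ₐ[F] Module.End F (F ⊗[R] X) :=
  AlgHom.liftEquiv R F A _ ((Module.End.baseChangeHom R F X).comp (leftAct X))

/-- The right action of `F ⊗[R] B` on `F ⊗[R] X`. -/
def baseChangeRightAct (X : FGMod (A ⊗[R] Bᵐᵒᵖ)) :
    (F ⊗[R] B)ᵐᵒᵖ →ₐ[F] Module.End F (F ⊗[R] X) :=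
  AlgHom.opComm (AlgHom.liftEquiv R F B (Module.End F (F ⊗[R] X))ᵐᵒᵖ
    (AlgHom.opComm.symm ((Module.End.baseChangeHom R F X).comp (rightAct X))))

theorem baseChangeLeftAct_tmul (X : FGMod (A ⊗[R] Bᵐᵒᵖ)) (c d : F) (a : A) (x : X) :
    baseChangeLeftAct F X (c ⊗ₜ[R] a) (d ⊗ₜ[R] x) = (c * d) ⊗ₜ[R] leftAct X a x := by
  change (c • (leftAct X a).baseChange F) (d ⊗ₜ[R] x) = _
  simp [TensorProduct.smul_tmul']

theorem baseChangeRightAct_tmul (X : FGMod (A ⊗[R] Bᵐᵒᵖ)) (c d : F) (b : B) (x : X) :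
    baseChangeRightAct F X (op (c ⊗ₜ[R] b)) (d ⊗ₜ[R] x) =
      (c * d) ⊗ₜ[R] rightAct X (op b) x := by
  change (c • (rightAct X (op b)).baseChange F) (d ⊗ₜ[R] x) = _
  simp [TensorProduct.smul_tmul']

theorem commute_baseChangeActs (X : FGMod (A ⊗[R] Bᵐᵒᵖ)) (a : F ⊗[R] A)
    (b : (F ⊗[R] B)ᵐᵒᵖ) : Commute (baseChangeLeftAct F X a) (baseChangeRightAct F X b) := by
  induction b using MulOpposite.rec' with | _ b
  induction a using TensorProduct.induction_on with
  | zero => rw [map_zero]; exact Commute.zero_left _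
  | add s t hs ht => rw [map_add]; exact hs.add_left ht
  | tmul c a =>
    induction b using TensorProduct.induction_on with
    | zero => rw [op_zero, map_zero]; exact Commute.zero_right _
    | add s t hs ht => rw [op_add, map_add]; exact hs.add_right ht
    | tmul d b =>
      refine TensorProduct.AlgebraTensorModule.ext (fun z x => ?_)
      change baseChangeLeftAct F X (c ⊗ₜ a) (baseChangeRightAct F X (op (d ⊗ₜ b)) (z ⊗ₜ x)) =
        baseChangeRightAct F X (op (d ⊗ₜ b)) (baseChangeLeftAct F X (c ⊗ₜ a) (z ⊗ₜ x))
      rw [baseChangeRightAct_tmul, baseChangeLeftAct_tmul, baseChangeLeftAct_tmul,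
        baseChangeRightAct_tmul, mul_left_comm]
      exact congrArg _ (LinearMap.congr_fun (commute_leftAct_rightAct X a (op b)).eq x)

variable [Module.Finite R A] [Module.Finite R B]

/-- The `(F ⊗ A, F ⊗ B)`-bimodule `F ⊗[R] X` for an `(A, B)`-bimodule `X`. -/
def baseChangeBimod (X : FGMod (A ⊗[R] Bᵐᵒᵖ)) :
    FGMod ((F ⊗[R] A) ⊗[F] (F ⊗[R] B)ᵐᵒᵖ) :=
  haveI := FGMod.finite_base (R := R) X
  bimodOfActs (baseChangeLeftAct F X) (baseChangeRightAct F X) (commute_baseChangeActs F X)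

variable (R A B) in
/-- Extension of scalars for bimodules as a functor. -/
def baseChangeFunctor : FGFunctor (A ⊗[R] Bᵐᵒᵖ) ((F ⊗[R] A) ⊗[F] (F ⊗[R] B)ᵐᵒᵖ) where
  obj := baseChangeBimod F
  map {X Y} f :=
    haveI := FGMod.finite_base (R := R) X
    haveI := FGMod.finite_base (R := R) Y
    bimodHom ((FGMod.baseHom R f).baseChange F)
      (fun a v => by
        induction a using TensorProduct.induction_on with
        | zero => simp
        | add s t hs ht => simp [hs, ht]
        | tmul c a =>
          induction v using TensorProduct.induction_on with
          | zero => simp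
          | add s t hs ht => simp only [map_add, hs, ht]
          | tmul d x =>
            rw [baseChangeLeftAct_tmul, LinearMap.baseChange_tmul, LinearMap.baseChange_tmul,
              baseChangeLeftAct_tmul]
            exact congrArg _ (map_leftAct f a x))
      (fun b v => by
        induction b using MulOpposite.rec' with | _ b
        induction b using TensorProduct.induction_on with
        | zero => simp
        | add s t hs ht => simp [hs, ht]
        | tmul c b =>
          induction v using TensorProduct.induction_on with
          | zero => simp
          | add s t hs ht => simp only [map_add, hs, ht]
          | tmul d x =>
            rw [baseChangeRightAct_tmul, LinearMap.baseChange_tmul, LinearMap.baseChange_tmul,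
              baseChangeRightAct_tmul]
            exact congrArg _ (map_rightAct f (op b) x))
  map_id X := LinearMap.ext fun v => LinearMap.congr_fun
    (LinearMap.baseChange_id (R := R) (A := F) (M := X)) v
  map_comp {X Y Z} g f := LinearMap.ext fun v => LinearMap.congr_fun
    (LinearMap.baseChange_comp (A := F) (FGMod.baseHom R f) (FGMod.baseHom R g)) v
  map_add {X Y} f g := LinearMap.ext fun v => LinearMap.congr_fun
    (LinearMap.baseChange_add (A := F) (FGMod.baseHom R f) (FGMod.baseHom R g)) v

/-- Extension of scalars `[X] ↦ [F ⊗[R] X]` on virtual bimodules. -/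
def virtualBaseChange (M : SplitK0 (A ⊗[R] Bᵐᵒᵖ)) :
    SplitK0 ((F ⊗[R] A) ⊗[F] (F ⊗[R] B)ᵐᵒᵖ) :=
  (baseChangeFunctor R A B F).K0map M

end BaseChange

end Bimodules

/-! ### Simple modules, central idempotents and Galois twists -/

/-- The set of classes of simple `S`-modules. -/
def Irr (S : Type u) [Ring S] : Set (SplitK0 S) :=
  {χ | ∃ X : FGMod S, IsSimpleModule S X ∧ cls X = χ}

/-- The `F`-algebra `S` is split: the endomorphisms of every simple `S`-module are the scalars. -/
def IsSplitAlgebra (F S : Type u) [Field F] [Ring S] [Algebra F S] : Prop :=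
  ∀ (T : Type u) [AddCommGroup T] [Module S T], IsSimpleModule S T →
    ∀ f : T →ₗ[S] T, ∃ c : F, ∀ t, f t = algebraMap F S c • t

/-- `e` is a primitive idempotent of the center of `S`. -/
structure IsPrimitiveCentralIdempotent {S : Type u} [Ring S] (e : S) : Prop where
  mem_center : e ∈ Subring.center S
  idem : e * e = e
  ne_zero : e ≠ 0
  primitive : ∀ f ∈ Subring.center S, ∀ g ∈ Subring.center S, f * f = f → g * g = g →
    f * g = 0 → e = f + g → f = 0 ∨ g = 0

section CentralIdempotent

variable {S : Type u} [Ring S]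

theorem central_idem_smul {X : Type*} [AddCommGroup X] [Module S X] [IsSimpleModule S X]
    {e : S} (he : e ∈ Subring.center S) (hi : e * e = e) (hx : ∃ x : X, e • x ≠ 0) (y : X) :
    e • y = y := by
  obtain ⟨x, hx⟩ := hx
  have hmem : y ∈ Submodule.span S {e • x} := by
    rw [IsSimpleModule.span_singleton_eq_top S hx]; trivial
  obtain ⟨s, rfl⟩ := Submodule.mem_span_singleton.mp hmem
  rw [← mul_smul, (Subring.mem_center_iff.mp he s).symm, mul_smul, ← mul_smul e e, hi]

/-- A simple module over an artinian ring is not annihilated by exactly one primitive idempotent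
of the center. -/
theorem existsUnique_centralIdempotent [IsArtinianRing S] (X : Type*) [AddCommGroup X]
    [Module S X] [IsSimpleModule S X] :
    ∃! e : S, IsPrimitiveCentralIdempotent e ∧ ∃ x : X, e • x ≠ 0 := by
  have _ := IsSimpleModule.nontrivial S X
  obtain ⟨x₀, hx₀⟩ := exists_ne (0 : X)
  let P : Set (Submodule S S) := {I | ∃ e ∈ Subring.center S, e * e = e ∧
    (∃ x : X, e • x ≠ 0) ∧ I = Submodule.span S {e}}
  have hP : P.Nonempty :=
    ⟨_, 1, one_mem _, one_mul 1, ⟨x₀, by rwa [one_smul]⟩, rfl⟩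
  obtain ⟨I, ⟨e, hc, hi, hx, rfl⟩, hmin⟩ := WellFounded.has_min
    (wellFounded_lt (α := Submodule S S)) P hP
  have key : ∀ f ∈ Subring.center S, f * f = f → f * e = f → (∃ x : X, f • x ≠ 0) → f = e := by
    intro f hf hff hfe hfx
    have hle : Submodule.span S {f} ≤ Submodule.span S {e} := by
      rw [Submodule.span_singleton_le_iff_mem]
      exact Submodule.mem_span_singleton.mpr ⟨f, hfe⟩
    have hnot := hmin _ ⟨f, hf, hff, hfx, rfl⟩
    have heq : Submodule.span S {f} = Submodule.span S {e} :=
      (lt_or_eq_of_le hle).resolve_left hnot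
    have hmem : e ∈ Submodule.span S {f} := by
      rw [heq]; exact Submodule.mem_span_singleton_self e
    obtain ⟨s, hs⟩ := Submodule.mem_span_singleton.mp hmem
    have h1 : e * f = e := by
      rw [← hs, smul_eq_mul, mul_assoc, hff]
    rw [← hfe, ← Subring.mem_center_iff.mp hf e, h1]
  have hprim : IsPrimitiveCentralIdempotent e := by
    refine ⟨hc, hi, ?_, ?_⟩
    · rintro rfl
      obtain ⟨x, hx⟩ := hx
      exact hx (zero_smul S x)
    · intro f hf g hg hff hgg hfg hsum
      have hgf : g * f = 0 := by rw [Subring.mem_center_iff.mp hf g, hfg]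
      obtain ⟨x, hx⟩ := hx
      by_cases hfx : f • x = 0
      · left
        have hgx : g • x ≠ 0 := by
          intro h
          apply hx
          rw [hsum, add_smul, hfx, h, add_zero]
        have := key g hg hgg (by rw [hsum, mul_add, hgf, hgg, zero_add]) ⟨x, hgx⟩
        rw [this] at hsum
        exact left_eq_add.mp (hsum.trans (add_comm _ _))
      · right
        have := key f hf hff (by rw [hsum, mul_add, hfg, hff, add_zero]) ⟨x, hfx⟩
        rw [this] at hsum
        exact left_eq_add.mp hsum
  have habs : ∀ e₁ e₂ : S, IsPrimitiveCentralIdempotent e₁ → (∃ x : X, e₁ • x ≠ 0) →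
      IsPrimitiveCentralIdempotent e₂ → (∃ x : X, e₂ • x ≠ 0) → e₁ = e₁ * e₂ := by
    intro e₁ e₂ h₁ hx₁ h₂ hx₂
    have hc₂ : e₁ * e₂ = e₂ * e₁ := Subring.mem_center_iff.mp h₂.mem_center e₁
    have hii : e₁ * e₂ * (e₁ * e₂) = e₁ * e₂ := by
      rw [mul_assoc, ← mul_assoc e₂, ← hc₂, mul_assoc, h₂.idem, ← mul_assoc, h₁.idem]
    have h1 : e₁ * (e₁ * e₂) = e₁ * e₂ := by rw [← mul_assoc, h₁.idem]
    have h2 : e₁ * e₂ * e₁ = e₁ * e₂ := by rw [mul_assoc, ← hc₂, h1]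
    have hm : e₁ * e₂ ∈ Subring.center S := mul_mem h₁.mem_center h₂.mem_center
    rcases h₁.primitive (e₁ * e₂) hm (e₁ - e₁ * e₂) (sub_mem h₁.mem_center hm) hii
      (by rw [sub_mul, mul_sub, mul_sub, h₁.idem, h1, h2, hii, sub_self, sub_zero])
      (by rw [mul_sub, h2, hii, sub_self]) (by abel) with h | h
    · exfalso
      apply hx₀
      rw [← central_idem_smul h₁.mem_center h₁.idem hx₁ x₀,
        ← central_idem_smul h₂.mem_center h₂.idem hx₂ x₀, ← mul_smul, h, zero_smul]
    · exact sub_eq_zero.mp h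
  refine ⟨e, ⟨hprim, hx⟩, fun e' ⟨he', hx'⟩ => ?_⟩
  rw [habs e' e he' hx' hprim hx, ← Subring.mem_center_iff.mp he'.mem_center,
    ← habs e e' hprim hx he' hx']

variable (F : Type u) [Field F] [Algebra F S]

/-- For `χ = [X]` with `X` simple, the primitive idempotent `e_χ` of the center of `S` which does
not annihilate `X`. -/
def centralIdempotent [IsSemisimpleRing S] (χ : Irr S) : Subalgebra.center F S :=
  haveI : IsSimpleModule S χ.2.choose := χ.2.choose_spec.1
  ⟨(existsUnique_centralIdempotent (S := S) χ.2.choose).choose,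
    (existsUnique_centralIdempotent (S := S) χ.2.choose).choose_spec.1.1.mem_center⟩

end CentralIdempotent

/-- Restriction along a ring isomorphism `θ`: the same abelian group, on which `s` acts as
`θ s`. -/
def restrictFunctor {S T : Type u} [Ring S] [Ring T] (θ : S ≃+* T) : FGFunctor T S where
  obj X :=
    { carrier := X
      module := Module.compHom X (θ : S →+* T)
      finite := by
        obtain ⟨s, hs⟩ := Module.Finite.fg_top (R := T) (M := X)
        let _ : Module S X := Module.compHom X (θ : S →+* T)
        refine ⟨⟨s, ?_⟩⟩
        rw [eq_top_iff]
        intro x _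
        have hx : x ∈ Submodule.span T (s : Set X) := by rw [hs]; trivial
        induction hx using Submodule.span_induction with
        | mem x h => exact Submodule.subset_span h
        | zero => exact zero_mem _
        | add x y _ _ hx hy => exact add_mem (hx trivial) (hy trivial)
        | smul t x _ hx =>
          have h := Submodule.smul_mem _ (θ.symm t) (hx trivial)
          have h' : θ.symm t • x = t • x := by
            change θ (θ.symm t) • x = t • x
            rw [RingEquiv.apply_symm_apply]
          rwa [h'] at h }
  map f :=
    { toFun := f
      map_add' := f.map_add
      map_smul' := fun s x => f.map_smul (θ s) x }
  map_id _ := rfl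
  map_comp _ _ := rfl
  map_add _ _ := rfl

theorem restrict_mem_Irr {S T : Type u} [Ring S] [Ring T] (θ : S ≃+* T) {χ : SplitK0 T}
    (hχ : χ ∈ Irr T) : (restrictFunctor θ).K0map χ ∈ Irr S := by
  obtain ⟨X, hX, rfl⟩ := hχ
  refine ⟨(restrictFunctor θ).obj X, ?_, (FGFunctor.K0map_cls _ X).symm⟩
  let l : (restrictFunctor θ).obj X →ₛₗ[(θ : S →+* T)] X :=
    { toFun := fun x => x
      map_add' := fun _ _ => rfl
      map_smul' := fun _ _ => rfl }
  have : RingHomSurjective (θ : S →+* T) := ⟨θ.surjective⟩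
  exact (LinearMap.isSimpleModule_iff_of_bijective l Function.bijective_id).mpr hX

section Twist

variable (O : Type u) {K F : Type u} [CommRing O] [Field K] [Algebra O K] [Field F] [Algebra O F]
  [Algebra K F] [IsScalarTower O K F] (A : Type u) [Ring A] [Algebra O A]

/-- The ring automorphism `c ⊗ a ↦ σ⁻¹ c ⊗ a` of `F ⊗[O] A`. -/
def twistEquiv (σ : F ≃ₐ[K] F) : F ⊗[O] A ≃+* F ⊗[O] A :=
  (Algebra.TensorProduct.congr (σ.symm.restrictScalars O)
    (AlgEquiv.refl : A ≃ₐ[O] A)).toRingEquiv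

/-- The twist `χ ↦ ^σχ` on classes of simple modules: `^σU` is `U` as an abelian group, and
`c ⊗ a` acts on it as `σ⁻¹ c ⊗ a`. -/
def galoisTwist (σ : F ≃ₐ[K] F) (χ : Irr (F ⊗[O] A)) : Irr (F ⊗[O] A) :=
  ⟨(restrictFunctor (twistEquiv O A σ)).K0map χ, restrict_mem_Irr _ χ.2⟩

/-- The homomorphism `Z(A) → Z(F ⊗ A)`, `z ↦ 1 ⊗ z`. -/
def centerMap (O F A : Type u) [CommRing O] [Field F] [Algebra O F] [Ring A] [Algebra O A] :
    Subalgebra.center O A →ₐ[O] Subalgebra.center F (F ⊗[O] A) where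
  toFun z := ⟨1 ⊗ₜ[O] (z : A), by
    rw [Subalgebra.mem_center_iff]
    intro t
    induction t using TensorProduct.induction_on with
    | zero => simp
    | add s t hs ht => rw [add_mul, mul_add, hs, ht]
    | tmul c a =>
      rw [Algebra.TensorProduct.tmul_mul_tmul, Algebra.TensorProduct.tmul_mul_tmul, mul_one,
        one_mul, Subalgebra.mem_center_iff.mp z.2 a]⟩
  map_one' := rfl
  map_mul' x y := Subtype.ext (by simp)
  map_zero' := Subtype.ext (by simp)
  map_add' x y := Subtype.ext (by simp [TensorProduct.tmul_add])
  commutes' r := Subtype.ext (by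
    change (1 : F) ⊗ₜ[O] algebraMap O A r = algebraMap O (F ⊗[O] A) r
    rw [Algebra.TensorProduct.algebraMap_apply, Algebra.algebraMap_eq_smul_one,
      Algebra.algebraMap_eq_smul_one, TensorProduct.tmul_smul, TensorProduct.smul_tmul'])

end Twist

end

noncomputable section

/-! ### Matrix units -/

/-! Over the split semisimple algebras `K'A` and `K'B`, choose matrix units, and let `e i` be the
first diagonal unit of the block `i`. In characteristic zero a virtual module is determined by the
traces of the `e i` (`MatUnits.K0_ext`), which are its multiplicities. A virtual bimodule gives in
the same way an integer matrix, the traces of `e j ⊗ op (e i)`. The trace formula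
`MatUnits.trace_balanced` turns tensor products over the algebra into matrix products. The regular
bimodule gives the identity matrix. Duality gives the transpose, because biprojective bimodules are
free over `O` and transposition preserves traces. Hence the matrix `m` of `M` satisfies `m mᵀ = 1`
and `mᵀ m = 1`. An integer matrix whose rows and columns have norm one is a signed permutation
matrix (`exists_equiv_of_orthogonal`), and this is the bijection `I` with its signs.

For (a), the block idempotents form a basis of the center, so the isomorphism `φ` over `K'` exists
and is unique. The point is that it preserves the integral centers. A symmetrizing form `s` of `A`
decomposes as `∑ s (e i) χ_i`. Let `X` be a biprojective bimodule with character `θ`, `y ∈ B` and `z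
∈ Z(A)`. Applying `s` to the Hattori-Stallings trace of the endomorphism `x ↦ y x z` shows that `∑ s
(e i) θ (y ⊗ z e i)` lies in `O` (`exists_sum_chr_eq_algebraMap`). For `M` this sum is the value of
the form of `B` on `w y`, where `w` is `φ z` multiplied by a central element independent of `z`;
since `B` is self-dual under its form, `w` lies in `Z(B)` (`exists_center_transfer`). The extra
factor is cancelled by the image of `1` under the analogous transfer for the dual of `M`
(`exists_permCenter_eq_centerMap`). The inverse of `φ` is treated by the same argument with the
roles exchanged.

For (b), the character of `M` takes values in `O` on the integral elements, so it is compatible with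
field automorphisms over `K`, and its values at idempotents are integers. Therefore the action of
`M` commutes with Galois twists (`virtualAct_twist`), and simple classes that agree up to sign are
equal. -/

/-- A full system of matrix units of a split semisimple algebra `S` over `F`. -/
structure MatUnits (F S : Type u) [Field F] [Ring S] [Algebra F S] where
  n : ℕ
  d : Fin n → ℕ
  [d_ne : ∀ i, NeZero (d i)]
  E : ∀ i, Fin (d i) → Fin (d i) → S
  mul_same : ∀ i a b c, E i a b * E i b c = E i a c
  mul_of_ne : ∀ i a b b' c, b ≠ b' → E i a b * E i b' c = 0
  mul_of_block_ne : ∀ i j a b c d, i ≠ j → E i a b * E j c d = 0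
  sum_diag : ∑ i, ∑ a, E i a a = 1
  span_eq_top : Submodule.span F {t | ∃ i a b, t = E i a b} = ⊤
  ne_zero : ∀ i, E i 0 0 ≠ 0

attribute [instance] MatUnits.d_ne

/-- A split semisimple algebra has a full system of matrix units. -/
theorem IsSplitAlgebra.nonempty_matUnits {F S : Type u} [Field F] [Ring S] [Algebra F S]
    [IsSemisimpleRing S] (h : IsSplitAlgebra F S) : Nonempty (MatUnits F S) := by
  obtain ⟨n, I, d, hI, hd, ⟨e⟩⟩ :=
    IsSemisimpleRing.exists_algEquiv_pi_matrix_end_mulOpposite F S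
  -- Splitness makes each Wedderburn division ring equal to `F`, so that the matrix units span over
  -- `F`.
  have hscal : ∀ i (x : (Module.End S (I i))ᵐᵒᵖ), ∃ c : F, x = c • 1 := by
    intro i x
    obtain ⟨c, hc⟩ := h (I i) (hI i) (unop x)
    refine ⟨c, unop_injective (LinearMap.ext fun t => ?_)⟩
    rw [hc t, algebraMap_smul]
    rfl
  have hnt : ∀ i, Nontrivial (Module.End S (I i))ᵐᵒᵖ := by
    intro i
    have := hI i
    have := IsSimpleModule.nontrivial S (I i)
    infer_instance
  classical
  refine ⟨{ n := n, d := d, E := fun i a b => e.symm (Pi.single i (Matrix.single a b 1)),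
            mul_same := ?_, mul_of_ne := ?_, mul_of_block_ne := ?_, sum_diag := ?_,
            span_eq_top := ?_, ne_zero := ?_ }⟩
  · intro i a b c
    rw [← map_mul, ← Pi.single_mul, Matrix.single_mul_single_same, one_mul]
  · intro i a b b' c hb
    rw [← map_mul, ← Pi.single_mul, Matrix.single_mul_single_of_ne _ _ _ _ hb, Pi.single_zero,
      map_zero]
  · intro i j a b c d hij
    rw [← map_mul]
    convert map_zero e.symm
    funext k
    by_cases hk : k = i
    · subst hk
      simp [Pi.single_eq_of_ne hij]
    · simp [Pi.single_eq_of_ne hk]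
  · simp_rw [← map_sum]
    convert map_one e.symm
    funext k
    rw [Finset.sum_apply, Finset.sum_eq_single k]
    · simp only [Finset.sum_apply, Pi.single_eq_same, Pi.one_apply]
      ext a b
      simp [Matrix.sum_apply, Matrix.single_apply, Matrix.one_apply, ite_and]
    · intro j _ hj
      simp [Finset.sum_apply, Pi.single_eq_of_ne hj.symm]
    · simp
  · rw [eq_top_iff]
    rintro t -
    obtain ⟨v, rfl⟩ := e.symm.surjective t
    have hv : v = ∑ i, ∑ a, ∑ b, (hscal i (v i a b)).choose •
        (Pi.single i (Matrix.single a b 1) :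
          Π i, Matrix (Fin (d i)) (Fin (d i)) (Module.End S (I i))ᵐᵒᵖ) := by
      funext k
      rw [Finset.sum_apply, Finset.sum_eq_single k]
      · simp only [Finset.sum_apply, Pi.smul_apply, Pi.single_eq_same]
        rw [Matrix.matrix_eq_sum_single (v k)]
        refine Finset.sum_congr rfl fun a _ => Finset.sum_congr rfl fun b _ => ?_
        rw [Matrix.smul_single, ← Matrix.matrix_eq_sum_single (v k),
          ← (hscal k (v k a b)).choose_spec]
      · intro j _ hj
        simp [Finset.sum_apply, Pi.single_eq_of_ne hj.symm]
      · simp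
    rw [hv]
    simp_rw [map_sum, map_smul]
    refine sum_mem fun i _ => sum_mem fun a _ => sum_mem fun b _ => Submodule.smul_mem _ _ ?_
    exact Submodule.subset_span ⟨i, a, b, rfl⟩
  · intro i h0
    rw [EmbeddingLike.map_eq_zero_iff, Pi.single_eq_zero_iff] at h0
    have := congrFun (congrFun h0 0) 0
    rw [Matrix.single_apply_same] at this
    exact one_ne_zero this

namespace MatUnits

variable {F S : Type u} [Field F] [Ring S] [Algebra F S] (U : MatUnits F S)

/-- A primitive idempotent in the block `i`. -/
def e (i : Fin U.n) : S := U.E i 0 0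

/-- The identity element of the block `i`. -/
def c (i : Fin U.n) : S := ∑ a, U.E i a a

@[elab_as_elim]
theorem induction {P : S → Prop} (t : S) (h0 : P 0) (hE : ∀ i a b, P (U.E i a b))
    (hadd : ∀ s t, P s → P t → P (s + t)) (hsmul : ∀ (r : F) s, P s → P (r • s)) : P t := by
  have ht : t ∈ Submodule.span F {t | ∃ i a b, t = U.E i a b} := by
    rw [U.span_eq_top]; trivial
  induction ht using Submodule.span_induction with
  | mem x h => obtain ⟨i, a, b, rfl⟩ := h; exact hE i a b
  | zero => exact h0
  | add x y _ _ hx hy => exact hadd _ _ hx hy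
  | smul r x _ hx => exact hsmul r x hx

theorem linearMap_ext {V : Type*} [AddCommGroup V] [Module F V] {f g : S →ₗ[F] V}
    (h : ∀ i a b, f (U.E i a b) = g (U.E i a b)) : f = g :=
  LinearMap.ext fun t => U.induction t (by simp) h (fun s t hs ht => by rw [map_add, map_add, hs, ht])
    (fun r s hs => by rw [map_smul, map_smul, hs])

theorem e_mul_e (i : Fin U.n) : U.e i * U.e i = U.e i := U.mul_same i 0 0 0

theorem e_ne_zero (i : Fin U.n) : U.e i ≠ 0 := U.ne_zero i

/-- The only matrix unit that survives multiplication by `e i` on both sides is `e i` itself. -/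
theorem exists_corner (i : Fin U.n) (t : S) : ∃ r : F, U.e i * t * U.e i = r • U.e i := by
  refine U.induction t ⟨0, by simp⟩ ?_ ?_ ?_
  · intro j a b
    by_cases hij : i = j
    · subst hij
      by_cases ha : 0 = a
      · by_cases hb : b = 0
        · subst ha hb
          exact ⟨1, by rw [one_smul]; exact (congrArg (· * U.e i) (U.e_mul_e i)).trans (U.e_mul_e i)⟩
        · exact ⟨0, by rw [mul_assoc, e, U.mul_of_ne i _ _ _ _ hb, mul_zero, zero_smul]⟩
      · exact ⟨0, by rw [e, U.mul_of_ne i _ _ _ _ ha, zero_mul, zero_smul]⟩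
    · exact ⟨0, by rw [e, U.mul_of_block_ne _ _ _ _ _ _ hij, zero_mul, zero_smul]⟩
  · rintro s t ⟨r, hr⟩ ⟨r', hr'⟩
    exact ⟨r + r', by rw [mul_add, add_mul, hr, hr', add_smul]⟩
  · rintro c s ⟨r, hr⟩
    exact ⟨c * r, by rw [mul_smul_comm, smul_mul_assoc, hr, mul_smul]⟩

theorem e_mul_mul_e_of_ne {i j : Fin U.n} (h : i ≠ j) (t : S) : U.e i * t * U.e j = 0 := by
  refine U.induction t (by simp) ?_ ?_ ?_
  · intro k a b
    by_cases hik : i = k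
    · subst hik
      rw [mul_assoc, e, e, U.mul_of_block_ne _ _ _ _ _ _ h, mul_zero]
    · rw [e, U.mul_of_block_ne _ _ _ _ _ _ hik, zero_mul]
  · intro s t hs ht
    rw [mul_add, add_mul, hs, ht, add_zero]
  · intro r s hs
    rw [mul_smul_comm, smul_mul_assoc, hs, smul_zero]

theorem E_mul_c (i j : Fin U.n) (a b : Fin (U.d i)) :
    U.E i a b * U.c j = if i = j then U.E i a b else 0 := by
  rw [c, Finset.mul_sum]
  split_ifs with h
  · subst h
    rw [Finset.sum_eq_single b, U.mul_same]
    · intro x _ hx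
      exact U.mul_of_ne _ _ _ _ _ hx.symm
    · simp
  · exact Finset.sum_eq_zero fun x _ => U.mul_of_block_ne _ _ _ _ _ _ h

theorem c_mul_E (i j : Fin U.n) (a b : Fin (U.d i)) :
    U.c j * U.E i a b = if i = j then U.E i a b else 0 := by
  rw [c, Finset.sum_mul]
  split_ifs with h
  · subst h
    rw [Finset.sum_eq_single a, U.mul_same]
    · intro x _ hx
      exact U.mul_of_ne _ _ _ _ _ hx
    · simp
  · exact Finset.sum_eq_zero fun x _ => U.mul_of_block_ne _ _ _ _ _ _ (Ne.symm h)

theorem c_comm (j : Fin U.n) (t : S) : U.c j * t = t * U.c j := by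
  refine U.induction t (by simp) ?_ ?_ ?_
  · intro i a b
    rw [c_mul_E, E_mul_c]
  · intro s t hs ht
    rw [mul_add, add_mul, hs, ht]
  · intro r s hs
    rw [mul_smul_comm, smul_mul_assoc, hs]

theorem c_mem_center (i : Fin U.n) : U.c i ∈ Subalgebra.center F S :=
  Subalgebra.mem_center_iff.mpr fun t => (U.c_comm i t).symm

theorem sum_c : ∑ i, U.c i = 1 := U.sum_diag

theorem c_mul_e (i j : Fin U.n) : U.c j * U.e i = if i = j then U.e i else 0 := U.c_mul_E i j 0 0

theorem c_mul_c (i j : Fin U.n) : U.c i * U.c j = if i = j then U.c i else 0 := by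
  rw [c, Finset.sum_mul]
  simp_rw [E_mul_c]
  split_ifs <;> simp

/-- Factor the unit through the index `0` and exchange the factors. A trace form is thus known from
its values on the `e i`. -/
theorem traceForm_E {V : Type*} [AddCommGroup V] [Module F V] {g : S →ₗ[F] V}
    (hg : ∀ s t, g (s * t) = g (t * s)) (i : Fin U.n) (a b : Fin (U.d i)) :
    g (U.E i a b) = if a = b then g (U.e i) else 0 := by
  rw [← U.mul_same i a 0 b, hg]
  split_ifs with h
  · subst h
    rw [U.mul_same]; rfl
  · rw [U.mul_of_ne _ _ _ _ _ (Ne.symm h), map_zero]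

/-! ### Irreducible characters and the center in terms of matrix units. -/

section Chi

/-- The character of the simple module of the block `i`: the trace on `S (U.e i)`. -/
def chi (i : Fin U.n) : S →ₗ[F] F :=
  LinearMap.trace F S ∘ₗ LinearMap.mulRight F (LinearMap.mulRight F (U.e i)) ∘ₗ LinearMap.mul F S

theorem chi_apply (i : Fin U.n) (t : S) :
    U.chi i t = LinearMap.trace F S (LinearMap.mulLeft F t * LinearMap.mulRight F (U.e i)) := rfl

theorem chi_mul_comm (i : Fin U.n) (s t : S) : U.chi i (s * t) = U.chi i (t * s) := by
  have h : ∀ t : S, LinearMap.mulLeft F t * LinearMap.mulRight F (U.e i) =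
      LinearMap.mulRight F (U.e i) * LinearMap.mulLeft F t := fun t => by
    ext u; simp [mul_assoc]
  rw [chi_apply, chi_apply, LinearMap.mulLeft_mul, LinearMap.mulLeft_mul,
    ← Module.End.mul_eq_comp, ← Module.End.mul_eq_comp, mul_assoc, h t, ← mul_assoc,
    LinearMap.trace_mul_comm, ← mul_assoc]

variable [Module.Finite F S]

theorem chi_e_self (i : Fin U.n) : U.chi i (U.e i) = 1 := by
  -- The map `u ↦ e u e` projects onto the line spanned by `e`, by `exists_corner`; its trace is
  -- therefore `1`.
  have h : LinearMap.IsProj (F ∙ U.e i)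
      (LinearMap.mulLeft F (U.e i) * LinearMap.mulRight F (U.e i)) := by
    refine ⟨fun x => ?_, fun x hx => ?_⟩
    · obtain ⟨r, hr⟩ := U.exists_corner i x
      rw [Module.End.mul_apply, LinearMap.mulRight_apply, LinearMap.mulLeft_apply, ← mul_assoc, hr]
      exact Submodule.smul_mem _ _ (Submodule.mem_span_singleton_self _)
    · obtain ⟨r, rfl⟩ := Submodule.mem_span_singleton.mp hx
      rw [Module.End.mul_apply, LinearMap.mulRight_apply, LinearMap.mulLeft_apply, smul_mul_assoc,
        mul_smul_comm, e_mul_e, e_mul_e]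
  rw [chi_apply, h.trace, finrank_span_singleton (U.e_ne_zero i), Nat.cast_one]

theorem chi_e (i j : Fin U.n) : U.chi i (U.e j) = if i = j then 1 else 0 := by
  split_ifs with h
  · subst h; exact U.chi_e_self i
  · rw [chi_apply]
    convert map_zero (LinearMap.trace F S)
    ext u
    simp [← mul_assoc, U.e_mul_mul_e_of_ne (Ne.symm h)]

/-- Every trace form is a combination of the irreducible characters. -/
theorem traceForm_eq_sum {g : S →ₗ[F] F} (hg : ∀ s t, g (s * t) = g (t * s)) (t : S) :
    g t = ∑ i, g (U.e i) * U.chi i t := by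
  have h : g = ∑ i, g (U.e i) • U.chi i := by
    refine U.linearMap_ext fun j a b => ?_
    simp only [LinearMap.sum_apply, LinearMap.smul_apply]
    rw [U.traceForm_E hg]
    simp_rw [U.traceForm_E (U.chi_mul_comm _), U.chi_e]
    split_ifs <;> simp
  conv_lhs => rw [h]
  simp

theorem e_mul_mul_e (i : Fin U.n) (t : S) :
    U.e i * t * U.e i = U.chi i (t * U.e i) • U.e i := by
  obtain ⟨r, hr⟩ := U.exists_corner i t
  have h := congrArg (U.chi i) hr
  rw [mul_assoc, chi_mul_comm, mul_assoc, e_mul_e, map_smul, chi_e_self, smul_eq_mul, mul_one] at h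
  rw [hr, h]

/-- The scalar `U.chi i (z * U.e i)` is the value at `z` of the central character of the block `i`.
Central characters are written in this form throughout. -/
theorem mul_e_of_central {z : S} (hz : z ∈ Subalgebra.center F S) (i : Fin U.n) :
    z * U.e i = U.chi i (z * U.e i) • U.e i := by
  rw [← e_mul_mul_e, Subalgebra.mem_center_iff.mp hz, mul_assoc, e_mul_e]

theorem mul_c_of_central {z : S} (hz : z ∈ Subalgebra.center F S) (i : Fin U.n) :
    z * U.c i = U.chi i (z * U.e i) • U.c i := by
  have h : ∀ a, U.E i a a = U.E i a 0 * U.e i * U.E i 0 a := fun a => by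
    rw [e, U.mul_same, U.mul_same]
  rw [c, Finset.mul_sum, Finset.smul_sum]
  refine Finset.sum_congr rfl fun a _ => ?_
  have hr := U.mul_e_of_central hz i
  generalize U.chi i (z * U.e i) = r at hr
  rw [h, ← mul_assoc, ← mul_assoc, ← Subalgebra.mem_center_iff.mp hz, mul_assoc (U.E i a 0),
    hr, mul_smul_comm, smul_mul_assoc]

theorem central_eq_sum {z : S} (hz : z ∈ Subalgebra.center F S) :
    z = ∑ i, U.chi i (z * U.e i) • U.c i := by
  simp_rw [← U.mul_c_of_central hz, ← Finset.mul_sum, sum_c, mul_one]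

/-- The form `t ↦ χ_i (z t)` is a trace form vanishing at `e j` for `j ≠ i`, hence a multiple of
`χ_i`. -/
theorem chi_mul_central {z : S} (hz : z ∈ Subalgebra.center F S) (i : Fin U.n) (t : S) :
    U.chi i (z * t) = U.chi i (z * U.e i) * U.chi i t := by
  have hg : ∀ s t, (U.chi i ∘ₗ LinearMap.mulLeft F z) (s * t) =
      (U.chi i ∘ₗ LinearMap.mulLeft F z) (t * s) := fun s t => by
    simp only [LinearMap.comp_apply, LinearMap.mulLeft_apply]
    rw [← mul_assoc, chi_mul_comm, ← mul_assoc, Subalgebra.mem_center_iff.mp hz, mul_assoc]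
  have h := U.traceForm_eq_sum hg t
  simp only [LinearMap.comp_apply, LinearMap.mulLeft_apply] at h
  rw [h, Finset.sum_eq_single i]
  · intro j _ hj
    rw [U.mul_e_of_central hz, map_smul, chi_e, if_neg hj.symm, smul_zero, zero_mul]
  · simp

/-- The center of `S` is a product of copies of `F`, indexed by the blocks. -/
def centerEquiv : Subalgebra.center F S ≃ₐ[F] (Fin U.n → F) where
  toFun z i := U.chi i (z * U.e i)
  invFun v := ⟨∑ i, v i • U.c i, sum_mem fun i _ => Subalgebra.smul_mem _ (U.c_mem_center i) _⟩
  left_inv z := Subtype.ext (U.central_eq_sum z.2).symm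
  right_inv v := by
    funext i
    simp [Finset.sum_mul, c_mul_e, chi_e_self]
  map_mul' z w := by
    funext i
    change U.chi i (z * w * U.e i) = _
    rw [mul_assoc, U.chi_mul_central z.2]
    rfl
  map_add' z w := by
    funext i
    simp [add_mul]
  commutes' r := by
    funext i
    simp [Algebra.algebraMap_eq_smul_one, chi_e_self]

/-- The block idempotent as an element of the center. -/
def cCenter (i : Fin U.n) : Subalgebra.center F S := ⟨U.c i, U.c_mem_center i⟩

theorem centerEquiv_cCenter (i : Fin U.n) : U.centerEquiv (U.cCenter i) = Pi.single i 1 := by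
  funext j
  change U.chi j (U.c i * U.e j) = _
  rw [c_mul_e, Pi.single_apply]
  split_ifs with h
  · exact U.chi_e_self j
  · exact map_zero _

/-- Orthogonal central summands of `c i` are multiples of `c i` by their central characters at `i`,
and the product of these two scalars is zero. -/
theorem isPrimitiveCentralIdempotent_c (i : Fin U.n) : IsPrimitiveCentralIdempotent (U.c i) where
  mem_center := U.c_mem_center i
  idem := by rw [c_mul_c, if_pos rfl]
  ne_zero h := by
    have := U.c_mul_e i i
    rw [h, zero_mul, if_pos rfl] at this
    exact U.e_ne_zero i this.symm
  primitive := by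
    intro f hf g hg hff hgg hfg hsum
    have hf' : f ∈ Subalgebra.center F S := hf
    have hg' : g ∈ Subalgebra.center F S := hg
    have hgf : g * f = 0 := by rw [Subring.mem_center_iff.mp hf g, hfg]
    have h1 : U.chi i (f * U.e i) * U.chi i (g * U.e i) = 0 := by
      rw [← U.chi_mul_central hf', ← mul_assoc, hfg, zero_mul, map_zero]
    have h2 : f = U.chi i (f * U.e i) • U.c i := by
      rw [← U.mul_c_of_central hf', hsum, mul_add, hff, hfg, add_zero]
    have h3 : g = U.chi i (g * U.e i) • U.c i := by
      rw [← U.mul_c_of_central hg', hsum, mul_add, hgg, hgf, zero_add]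
    rcases mul_eq_zero.mp h1 with h | h
    · left; rw [h2, h, zero_smul]
    · right; rw [h3, h, zero_smul]

end Chi

end MatUnits

/-! ### Characters -/

/-- Every element is a difference of two classes, so additive identities need only be checked on
actual modules. -/
theorem SplitK0.induction {S : Type u} [Ring S] {P : SplitK0 S → Prop} (hcls : ∀ X, P (cls X))
    (hsub : ∀ M N, P M → P N → P (M - N)) (M : SplitK0 S) : P M := by
  induction M using AddLocalization.ind with | _ y
  obtain ⟨a, b⟩ := y
  obtain ⟨X, rfl⟩ := Quotient.exists_rep a
  obtain ⟨⟨Y⟩, hb⟩ := b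
  convert hsub _ _ (hcls X) (hcls Y) using 1
  rw [eq_sub_iff_add_eq]
  change AddLocalization.mk _ _ + AddLocalization.mk _ _ = AddLocalization.mk _ _
  rw [AddLocalization.mk_add, AddLocalization.mk_eq_mk_iff, AddLocalization.r_iff_exists]
  exact ⟨0, by simp only [zero_add, add_zero, ZeroMemClass.coe_zero]; exact add_comm (IsoClass.mk X) (IsoClass.mk Y)⟩

theorem SplitK0.exists_eq_sub {S : Type u} [Ring S] (M : SplitK0 S) :
    ∃ X Y : FGMod S, M = cls X - cls Y := by
  induction M using SplitK0.induction with
  | hcls X => exact ⟨X, FGMod.zero S, by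
      have h := cls_sum X (FGMod.zero S)
      rw [cls_congr (X := X.sum (FGMod.zero S)) (Y := X)
        (LinearEquiv.prodUnique (M₂ := PUnit.{u + 1}))] at h
      rw [left_eq_add.mp h, sub_zero]⟩
  | hsub M N hM hN =>
    obtain ⟨X, Y, rfl⟩ := hM
    obtain ⟨X', Y', rfl⟩ := hN
    exact ⟨X.sum Y', Y.sum X', by rw [cls_sum, cls_sum]; abel⟩

/-- Used mostly to pass between module structures carried by the same underlying set, where the
equivalence is the identity on elements. -/
theorem LinearMap.trace_eq_of_equiv {R V W : Type*} [CommRing R] [AddCommGroup V] [Module R V]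
    [AddCommGroup W] [Module R W] (e : V ≃ₗ[R] W) {f : V →ₗ[R] V} {g : W →ₗ[R] W}
    (h : ∀ v, e (f v) = g (e v)) : LinearMap.trace R V f = LinearMap.trace R W g := by
  rw [← LinearMap.trace_conj' f e]
  congr 1
  ext w
  simp [LinearEquiv.conj_apply, h]

section Character

variable (F : Type u) {S : Type u} [Field F] [Ring S] [Algebra F S]

/-- The underlying `R`-module of the module given by a representation. -/
def FGMod.ofRepEquiv {R S V : Type u} [CommRing R] [Ring S] [Algebra R S] [AddCommGroup V]
    [Module R V] [Module.Finite R V] (ρ : S →ₐ[R] Module.End R V) :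
    FGMod.ofRep ρ ≃ₗ[R] V where
  toFun v := v
  invFun v := v
  map_add' _ _ := rfl
  map_smul' r v := LinearMap.congr_fun ((ρ.commutes r).trans (Algebra.algebraMap_eq_smul_one r)) v
  left_inv _ := rfl
  right_inv _ := rfl

/-- The character of a module. -/
def FGMod.chr (X : FGMod S) : S →ₗ[F] F := LinearMap.trace F X ∘ₗ (X.rep F).toLinearMap

theorem FGMod.chr_apply (X : FGMod S) (s : S) :
    X.chr F s = LinearMap.trace F X (X.rep F s) := rfl

theorem FGMod.chr_mul_comm (X : FGMod S) (s t : S) : X.chr F (s * t) = X.chr F (t * s) := by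
  rw [chr_apply, chr_apply, map_mul (X.rep F), map_mul (X.rep F), LinearMap.trace_mul_comm]

theorem FGMod.chr_ofRep {V : Type u} [AddCommGroup V] [Module F V] [Module.Finite F V]
    (ρ : S →ₐ[F] Module.End F V) (s : S) :
    (FGMod.ofRep ρ).chr F s = LinearMap.trace F V (ρ s) :=
  LinearMap.trace_eq_of_equiv (FGMod.ofRepEquiv ρ) fun _ => rfl

theorem FGMod.chr_congr {X Y : FGMod S} (e : X ≃ₗ[S] Y) : X.chr F = Y.chr F :=
  LinearMap.ext fun s => LinearMap.trace_eq_of_equiv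
    { toFun := e, invFun := e.symm, map_add' := e.map_add, left_inv := e.left_inv,
      right_inv := e.right_inv, map_smul' := (FGMod.baseHom F e.toLinearMap).map_smul }
    (e.map_smul s)

variable [Module.Finite F S]

theorem FGMod.chr_sum (X Y : FGMod S) : (X.sum Y).chr F = X.chr F + Y.chr F := by
  have := FGMod.finite_base (R := F) X
  have := FGMod.finite_base (R := F) Y
  ext s
  rw [LinearMap.add_apply, chr_apply, chr_apply, chr_apply, ← LinearMap.trace_prodMap']
  exact LinearMap.trace_eq_of_equiv (W := X × Y)
    { toFun := id, invFun := id, map_add' := fun _ _ => rfl, left_inv := fun _ => rfl,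
      right_inv := fun _ => rfl, map_smul' := fun _ _ => rfl } fun _ => rfl

/-- The character of a virtual module. -/
def K0chr : SplitK0 S →+ (S →ₗ[F] F) :=
  SplitK0.lift (FGMod.chr F) (fun _ _ ⟨e⟩ => FGMod.chr_congr F e) (FGMod.chr_sum F)

@[simp]
theorem K0chr_cls (X : FGMod S) : K0chr F (cls X) = X.chr F := SplitK0.lift_cls ..

theorem K0chr_mul_comm (M : SplitK0 S) (s t : S) : K0chr F M (s * t) = K0chr F M (t * s) := by
  induction M using SplitK0.induction with
  | hcls X => rw [K0chr_cls, FGMod.chr_mul_comm]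
  | hsub M N hM hN => rw [map_sub, LinearMap.sub_apply, LinearMap.sub_apply, hM, hN]

theorem trace_eq_finrank_range {V : Type*} [AddCommGroup V] [Module F V] [Module.Finite F V]
    {f : V →ₗ[F] V} (hf : f * f = f) :
    LinearMap.trace F V f = Module.finrank F (LinearMap.range f) := by
  have hp : LinearMap.IsProj (LinearMap.range f) f :=
    ⟨fun x => ⟨x, rfl⟩, by rintro _ ⟨x, rfl⟩; exact LinearMap.congr_fun hf x⟩
  exact hp.trace

theorem FGMod.chr_idempotent (X : FGMod S) {s : S} (hs : s * s = s) :
    X.chr F s = Module.finrank F (LinearMap.range (X.rep F s)) := by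
  have := FGMod.finite_base (R := F) X
  exact trace_eq_finrank_range F ((map_mul (X.rep F) s s).symm.trans (congrArg (X.rep F) hs))

/-- The trace of an idempotent is the dimension of its image, and differences of dimensions are
integers. This gives both the integrality of the multiplicity matrix and the invariance of its
entries under field automorphisms. -/
theorem exists_int_K0chr (M : SplitK0 S) {s : S} (hs : s * s = s) : ∃ m : ℤ, K0chr F M s = m := by
  induction M using SplitK0.induction with
  | hcls X => exact ⟨_, by rw [K0chr_cls, FGMod.chr_idempotent F X hs, Int.cast_natCast]⟩
  | hsub M N hM hN =>
    obtain ⟨m, hm⟩ := hM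
    obtain ⟨n, hn⟩ := hN
    exact ⟨m - n, by rw [map_sub, LinearMap.sub_apply, hm, hn, Int.cast_sub]⟩

variable {F}

namespace MatUnits

variable (U : MatUnits F S)

/-- A module is recovered from the spaces `e i X`, being the sum of their translates under the units
`E i a 0`. In characteristic zero the traces give the dimensions of these spaces, and linear
isomorphisms between them extend to the whole modules. -/
theorem nonempty_linearEquiv_of_chr_eq [CharZero F] {X Y : FGMod S}
    (h : ∀ i, X.chr F (U.e i) = Y.chr F (U.e i)) : Nonempty (X ≃ₗ[S] Y) := by
  have := FGMod.finite_base (R := F) X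
  have := FGMod.finite_base (R := F) Y
  have hex : ∀ i, Nonempty (LinearMap.range (X.rep F (U.e i)) ≃ₗ[F]
      LinearMap.range (Y.rep F (U.e i))) := fun i => by
    have hi := h i
    rw [FGMod.chr_idempotent F X (U.e_mul_e i), FGMod.chr_idempotent F Y (U.e_mul_e i),
      Nat.cast_inj] at hi
    exact FiniteDimensional.nonempty_linearEquiv_of_finrank_eq hi
  let g i := (hex i).some
  -- Linear maps `g i` between the corners extend to the `S`-linear map `x ↦ ∑ E i a 0 (g i (E i 0 a
  -- x))`. This is stated for arbitrary modules so as to serve for the isomorphism and its inverse.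
  have key : ∀ (X Y : FGMod S) (g : ∀ i, LinearMap.range (X.rep F (U.e i)) →ₗ[F]
      LinearMap.range (Y.rep F (U.e i))), ∃ G : X →ₗ[S] Y, ∀ i x,
        U.e i • G x = g i ⟨U.e i • x, x, rfl⟩ := by
    intro X Y g
    have hmem : ∀ i (b : Fin (U.d i)) (x : X), U.E i 0 b • x ∈ LinearMap.range (X.rep F (U.e i)) :=
      fun i b x => ⟨U.E i 0 b • x, by
        change U.e i • U.E i 0 b • x = _
        rw [← mul_smul, e, U.mul_same]⟩
    let G : X →ₗ[F] Y := ∑ i, ∑ a, Y.rep F (U.E i a 0) ∘ₗ (LinearMap.range _).subtype ∘ₗ g i ∘ₗ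
      (X.rep F (U.E i 0 a)).codRestrict _ (hmem i a)
    have hG : ∀ x, G x = ∑ i, ∑ a, U.E i a 0 • (g i ⟨U.E i 0 a • x, hmem i a x⟩ : Y) := by
      intro x
      simp only [G, LinearMap.sum_apply]
      rfl
    have hE : ∀ j b c x, U.E j b c • G x = U.E j b 0 • (g j ⟨U.E j 0 c • x, hmem j c x⟩ : Y) := by
      intro j b c x
      rw [hG, Finset.smul_sum, Finset.sum_eq_single j]
      · rw [Finset.smul_sum, Finset.sum_eq_single c]
        · rw [← mul_smul, U.mul_same]
        · intro a _ ha
          rw [← mul_smul, U.mul_of_ne _ _ _ _ _ ha.symm, zero_smul]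
        · simp
      · intro i _ hi
        rw [Finset.smul_sum]
        exact Finset.sum_eq_zero fun a _ => by
          rw [← mul_smul, U.mul_of_block_ne _ _ _ _ _ _ hi.symm, zero_smul]
      · simp
    have hE' : ∀ j b c x, G (U.E j b c • x) = U.E j b 0 • (g j ⟨U.E j 0 c • x, hmem j c x⟩ : Y) := by
      intro j b c x
      have h0 : ∀ i a (hm), U.E i 0 a * U.E j b c = 0 →
          U.E i a 0 • (g i ⟨U.E i 0 a • U.E j b c • x, hm⟩ : Y) = 0 := by
        intro i a hm h
        have : (⟨U.E i 0 a • U.E j b c • x, hm⟩ : LinearMap.range (X.rep F (U.e i))) = 0 :=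
          Subtype.ext (by change U.E i 0 a • U.E j b c • x = 0; rw [← mul_smul, h, zero_smul])
        rw [this, map_zero]
        exact smul_zero _
      rw [hG, Finset.sum_eq_single j]
      · rw [Finset.sum_eq_single b]
        · congr 3
          apply Subtype.ext
          change U.E j 0 b • U.E j b c • x = U.E j 0 c • x
          rw [← mul_smul, U.mul_same]
        · intro a _ ha
          exact h0 _ _ _ (U.mul_of_ne _ _ _ _ _ ha)
        · simp
      · intro i _ hi
        exact Finset.sum_eq_zero fun a _ => h0 _ _ _ (U.mul_of_block_ne _ _ _ _ _ _ hi)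
      · simp
    refine ⟨{ toFun := G, map_add' := G.map_add, map_smul' := fun s x => ?_ }, fun i x => ?_⟩
    · change G (s • x) = s • G x
      refine U.induction s (by rw [zero_smul, zero_smul, map_zero]) ?_ ?_ ?_
      · intro j b c
        rw [hE, hE']
      · intro s t hs ht
        rw [add_smul, add_smul, map_add, hs, ht]
      · intro r s hs
        rw [smul_assoc, smul_assoc, map_smul, hs]
    · change U.E i 0 0 • G x = _
      rw [hE]
      obtain ⟨y, hy⟩ := (g i ⟨U.E i 0 0 • x, hmem i 0 x⟩).2
      change U.e i • y = _ at hy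
      change U.e i • ((g i ⟨U.E i 0 0 • x, hmem i 0 x⟩ : _) : Y) = (g i ⟨U.E i 0 0 • x, hmem i 0 x⟩ : _)
      rw [← hy, ← mul_smul, e_mul_e]
  -- Since `1` is the sum of the `E i a 0 * e i * E i 0 a`, an element is determined by the
  -- components `e i s x`.
  have ext : ∀ (X : FGMod S) (x y : X), (∀ i (s : S), U.e i • s • x = U.e i • s • y) → x = y := by
    intro X x y hxy
    rw [← one_smul S x, ← one_smul S y, ← U.sum_diag]
    simp_rw [Finset.sum_smul]
    refine Finset.sum_congr rfl fun i _ => Finset.sum_congr rfl fun a _ => ?_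
    rw [← U.mul_same i a 0 a, ← U.mul_same i a 0 0, mul_assoc, mul_smul, mul_smul,
      mul_smul (U.E i a 0), mul_smul (U.E i 0 0)]
    exact congrArg _ (hxy i _)
  obtain ⟨G, hG⟩ := key X Y fun i => (g i).toLinearMap
  obtain ⟨G', hG'⟩ := key Y X fun i => (g i).symm.toLinearMap
  refine ⟨LinearEquiv.ofLinearMap G G' (LinearMap.ext fun y => ext _ _ _ fun i s => ?_)
    (LinearMap.ext fun x => ext _ _ _ fun i s => ?_)⟩
  · rw [LinearMap.comp_apply, LinearMap.id_apply, ← map_smul _ s, ← map_smul _ s, hG]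
    have : (⟨U.e i • G' (s • y), G' (s • y), rfl⟩ : LinearMap.range (X.rep F (U.e i))) =
      (g i).symm ⟨U.e i • s • y, s • y, rfl⟩ := Subtype.ext (hG' i (s • y))
    rw [this]
    simp
  · rw [LinearMap.comp_apply, LinearMap.id_apply, ← map_smul _ s, ← map_smul _ s, hG']
    have : (⟨U.e i • G (s • x), G (s • x), rfl⟩ : LinearMap.range (Y.rep F (U.e i))) =
      (g i) ⟨U.e i • s • x, s • x, rfl⟩ := Subtype.ext (hG i (s • x))
    rw [this]
    simp

/-- A virtual module is determined by the values of its character at the primitive idempotents. -/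
theorem K0_ext [CharZero F] {M N : SplitK0 S}
    (h : ∀ i, K0chr F M (U.e i) = K0chr F N (U.e i)) : M = N := by
  obtain ⟨X, Y, rfl⟩ := M.exists_eq_sub
  obtain ⟨X', Y', rfl⟩ := N.exists_eq_sub
  rw [sub_eq_sub_iff_add_eq_add, ← cls_sum, ← cls_sum]
  obtain ⟨e⟩ := U.nonempty_linearEquiv_of_chr_eq (X := X.sum Y') (Y := X'.sum Y) fun i => by
    have := h i
    simp only [map_sub, K0chr_cls, LinearMap.sub_apply] at this
    rw [FGMod.chr_sum, FGMod.chr_sum, LinearMap.add_apply, LinearMap.add_apply]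
    exact sub_eq_sub_iff_add_eq_add.mp this
  exact cls_congr e

end MatUnits

end Character

/-! ### Simple modules -/

namespace MatUnits

variable {F S : Type u} [Field F] [Ring S] [Algebra F S] (U : MatUnits F S)

/-- The simple module of the block `i`, as a left ideal. -/
def simple (i : Fin U.n) : FGMod S :=
  { carrier := (Submodule.span S {U.e i} : Submodule S S) }

theorem exists_E_mul_ne_zero {X : Type*} [AddCommGroup X] [Module S X] {x : X} (hx : x ≠ 0) :
    ∃ i a, U.E i 0 a • x ≠ 0 := by
  by_contra! h
  apply hx
  rw [← one_smul S x, ← U.sum_diag, Finset.sum_smul]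
  refine Finset.sum_eq_zero fun i _ => ?_
  rw [Finset.sum_smul]
  refine Finset.sum_eq_zero fun a _ => ?_
  rw [← U.mul_same i a 0 a, mul_smul, h, smul_zero]

/-- Some `E i 0 a` carries a given nonzero element of the left ideal to a nonzero multiple of `e i`,
which generates. -/
theorem isSimpleModule_simple (i : Fin U.n) : IsSimpleModule S (U.simple i) := by
  rw [isSimpleModule_iff_toSpanSingleton_surjective]
  refine ⟨⟨⟨⟨U.e i, Submodule.mem_span_singleton_self _⟩, 0, fun h =>
    U.e_ne_zero i (congrArg Subtype.val h)⟩⟩, ?_⟩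
  rintro ⟨x, hx⟩ hx0
  obtain ⟨s, rfl⟩ := Submodule.mem_span_singleton.mp hx
  have hx0' : s * U.e i ≠ 0 := fun h => hx0 (Subtype.ext h)
  obtain ⟨j, a, hja⟩ := U.exists_E_mul_ne_zero hx0'
  -- The nonvanishing product lies in `e j S e i`, which is zero for different blocks.
  have hj : i = j := by
    by_contra h
    apply hja
    rw [← U.mul_same j 0 0 a, smul_eq_mul, ← mul_assoc, mul_assoc (U.E j 0 0)]
    exact U.e_mul_mul_e_of_ne (Ne.symm h) _
  subst hj
  obtain ⟨r, hr⟩ := U.exists_corner i (U.E i 0 a * s)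
  have hr' : U.E i 0 a * (s * U.e i) = r • U.e i := by
    rw [← hr, e, ← mul_assoc, ← mul_assoc, U.mul_same]
  have hr0 : r ≠ 0 := by
    rintro rfl
    rw [zero_smul] at hr'
    exact hja hr'
  rintro ⟨y, hy⟩
  obtain ⟨t, rfl⟩ := Submodule.mem_span_singleton.mp hy
  refine ⟨t * (r⁻¹ • U.E i 0 a), Subtype.ext ?_⟩
  change t * (r⁻¹ • U.E i 0 a) * (s * U.e i) = t * U.e i
  rw [mul_assoc, smul_mul_assoc, hr', smul_smul, inv_mul_cancel₀ hr0, one_smul]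

/-- Pick `x` with `E i 0 a x ≠ 0`. Acting on this vector is a map from the left ideal of the block
`i` which is nonzero at `e i`, and Schur's lemma applies. -/
theorem exists_simple_equiv (X : FGMod S) [IsSimpleModule S X] :
    ∃ i, Nonempty (U.simple i ≃ₗ[S] X) := by
  have := IsSimpleModule.nontrivial S X
  obtain ⟨x, hx⟩ := exists_ne (0 : X)
  obtain ⟨i, a, hia⟩ := U.exists_E_mul_ne_zero hx
  have := U.isSimpleModule_simple i
  let f : U.simple i →ₗ[S] X := (LinearMap.toSpanSingleton S X (U.E i 0 a • x)) ∘ₗ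
    (Submodule.span S {U.e i}).subtype
  refine ⟨i, ⟨LinearEquiv.ofBijective f ?_⟩⟩
  refine (LinearMap.bijective_or_eq_zero f).resolve_right fun h => hia ?_
  have h1 := LinearMap.congr_fun h ⟨U.e i, Submodule.mem_span_singleton_self _⟩
  change U.e i • U.E i 0 a • x = 0 at h1
  rwa [← mul_smul, e, U.mul_same] at h1

variable [Module.Finite F S]

theorem chr_simple_e (i j : Fin U.n) : (U.simple i).chr F (U.e j) = if i = j then 1 else 0 := by
  have := FGMod.finite_base (R := F) (U.simple i)
  split_ifs with h
  · subst h
    let x₀ : U.simple i := ⟨U.e i, Submodule.mem_span_singleton_self _⟩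
    have hx₀ : x₀ ≠ 0 := fun h => U.e_ne_zero i (congrArg Subtype.val h)
    have hx₀' : U.e i • x₀ = x₀ := Subtype.ext (U.e_mul_e i)
    have hp : LinearMap.IsProj (F ∙ x₀) ((U.simple i).rep F (U.e i)) := by
      refine ⟨?_, fun x hx => ?_⟩
      · rintro ⟨x, hx⟩
        obtain ⟨s, rfl⟩ := Submodule.mem_span_singleton.mp hx
        obtain ⟨r, hr⟩ := U.exists_corner i s
        refine Submodule.mem_span_singleton.mpr ⟨r, Subtype.ext ?_⟩
        change algebraMap F S r * U.e i = U.e i * (s * U.e i)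
        rw [← Algebra.smul_def, ← hr, mul_assoc]
      · obtain ⟨r, rfl⟩ := Submodule.mem_span_singleton.mp hx
        rw [map_smul]
        exact congrArg _ hx₀'
    rw [FGMod.chr_apply, hp.trace, finrank_span_singleton hx₀, Nat.cast_one]
  · rw [FGMod.chr_apply]
    convert map_zero (LinearMap.trace F (U.simple i))
    refine LinearMap.ext ?_
    rintro ⟨x, hx⟩
    obtain ⟨s, rfl⟩ := Submodule.mem_span_singleton.mp hx
    refine Subtype.ext ?_
    change U.e j * (s * U.e i) = 0
    rw [← mul_assoc, U.e_mul_mul_e_of_ne (Ne.symm h)]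

/-- The simple modules correspond to the blocks. -/
def irrEquiv : Fin U.n ≃ Irr S :=
  Equiv.ofBijective (fun i => ⟨cls (U.simple i), U.simple i, U.isSimpleModule_simple i, rfl⟩) <| by
    constructor
    · intro i j h
      have h' := congrArg (fun χ : Irr S => K0chr F (χ : SplitK0 S) (U.e j)) h
      simp only [K0chr_cls, chr_simple_e, if_true] at h'
      by_contra hij
      rw [if_neg hij] at h'
      exact zero_ne_one h'
    · rintro ⟨_, X, hX, rfl⟩
      obtain ⟨i, ⟨f⟩⟩ := U.exists_simple_equiv X
      exact ⟨i, Subtype.ext (cls_congr f)⟩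

theorem K0chr_irrEquiv_e (i j : Fin U.n) :
    K0chr F (U.irrEquiv i : SplitK0 S) (U.e j) = if i = j then 1 else 0 := by
  change K0chr F (cls (U.simple i)) (U.e j) = _
  rw [K0chr_cls, chr_simple_e]

/-- The idempotent attached to a class is defined through a chosen representative. By uniqueness it
suffices that `c i` does not annihilate that representative; otherwise `e i = c i * e i` would have
trace `0` on it instead of `1`. -/
theorem centralIdempotent_irrEquiv [IsSemisimpleRing S] (i : Fin U.n) :
    centralIdempotent F (U.irrEquiv i) = U.cCenter i := by
  have hX := (U.irrEquiv i).2.choose_spec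
  have := hX.1
  apply Subtype.ext
  refine ((existsUnique_centralIdempotent (S := S) (U.irrEquiv i).2.choose).unique
    (existsUnique_centralIdempotent (S := S) (U.irrEquiv i).2.choose).choose_spec.1
    ⟨U.isPrimitiveCentralIdempotent_c i, ?_⟩)
  by_contra! h
  have h1 := U.K0chr_irrEquiv_e i i
  rw [← hX.2, K0chr_cls, if_pos rfl, FGMod.chr_apply] at h1
  apply zero_ne_one (α := F)
  rw [← h1]
  convert (map_zero (LinearMap.trace F (U.irrEquiv i).2.choose)).symm
  refine LinearMap.ext fun x => ?_
  change U.e i • x = 0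
  have h2 := U.c_mul_e i i
  rw [if_pos rfl] at h2
  rw [← h2, mul_smul]
  exact h _

/-- If the classes differed, evaluating both sides at the primitive idempotent of the first would
give a sign equal to zero. -/
theorem irr_eq_of_smul_eq (U : MatUnits F S) [CharZero F] {χ χ' : Irr S} {ε ε' : ℤˣ}
    (h : (ε : ℤ) • (χ : SplitK0 S) = (ε' : ℤ) • (χ' : SplitK0 S)) : χ = χ' := by
  obtain ⟨i, rfl⟩ := U.irrEquiv.surjective χ
  obtain ⟨j, rfl⟩ := U.irrEquiv.surjective χ'
  have h' := congrArg (fun M => K0chr F M (U.e i)) h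
  simp only [map_zsmul, LinearMap.smul_apply, K0chr_irrEquiv_e, if_true] at h'
  by_contra hij
  rw [if_neg (fun h => hij (congrArg _ h.symm)), smul_zero, zsmul_eq_mul, mul_one,
    Int.cast_eq_zero] at h'
  exact ε.ne_zero h'

end MatUnits

/-! ### Traces on tensor products over a split semisimple algebra -/

namespace MatUnits

section Balanced

variable {F T : Type u} [Field F] [Ring T] [Algebra F T] (U : MatUnits F T)
  {X Y W : Type*} [AddCommGroup X] [Module F X] [AddCommGroup Y] [Module F Y]
  [AddCommGroup W] [Module F W]
  (ρ : Tᵐᵒᵖ →ₐ[F] Module.End F X) (τ : T →ₐ[F] Module.End F Y)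

/-- The projection of `X ⊗[F] Y` onto a copy of the tensor product over `T`. -/
def balProj : X ⊗[F] Y →ₗ[F] X ⊗[F] Y :=
  ∑ i, ∑ a, TensorProduct.map (ρ (op (U.E i a 0))) (τ (U.E i 0 a))

theorem balProj_tmul (x : X) (y : Y) : U.balProj ρ τ (x ⊗ₜ y) =
    ∑ i, ∑ a, ρ (op (U.E i a 0)) x ⊗ₜ[F] τ (U.E i 0 a) y := by
  simp [balProj]

/-- On the matrix unit `E j b c` both sides equal `x E j b 0 ⊗ E j 0 c y`. -/
theorem balProj_balanced (t : T) (x : X) (y : Y) :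
    U.balProj ρ τ (ρ (op t) x ⊗ₜ y) = U.balProj ρ τ (x ⊗ₜ τ t y) := by
  refine U.induction t (by simp) ?_ ?_ ?_
  · intro j b c
    have h1 : ∀ (s t : T) (x : X), ρ (op s) (ρ (op t) x) = ρ (op (t * s)) x := fun s t x => by
      rw [op_mul, map_mul, Module.End.mul_apply]
    have h2 : ∀ (s t : T) (y : Y), τ s (τ t y) = τ (s * t) y := fun s t x => by
      rw [map_mul, Module.End.mul_apply]
    rw [balProj_tmul, balProj_tmul, Finset.sum_eq_single j, Finset.sum_eq_single j,
      Finset.sum_eq_single c, Finset.sum_eq_single b, h1, h2, U.mul_same, U.mul_same]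
    · intro a _ ha
      rw [h2, U.mul_of_ne _ _ _ _ _ ha, map_zero, LinearMap.zero_apply, TensorProduct.tmul_zero]
    · simp
    · intro a _ ha
      rw [h1, U.mul_of_ne _ _ _ _ _ ha.symm, op_zero, map_zero, LinearMap.zero_apply,
        TensorProduct.zero_tmul]
    · simp
    · intro i _ hi
      refine Finset.sum_eq_zero fun a _ => ?_
      rw [h2, U.mul_of_block_ne _ _ _ _ _ _ hi, map_zero, LinearMap.zero_apply,
        TensorProduct.tmul_zero]
    · simp
    · intro i _ hi
      refine Finset.sum_eq_zero fun a _ => ?_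
      rw [h1, U.mul_of_block_ne _ _ _ _ _ _ hi.symm, op_zero, map_zero, LinearMap.zero_apply,
        TensorProduct.zero_tmul]
    · simp
  · intro s t hs ht
    rw [op_add, map_add, map_add, LinearMap.add_apply, LinearMap.add_apply,
      TensorProduct.add_tmul, TensorProduct.tmul_add, map_add, map_add, hs, ht]
  · intro r s hs
    rw [op_smul, map_smul, map_smul, LinearMap.smul_apply, LinearMap.smul_apply,
      TensorProduct.smul_tmul, TensorProduct.tmul_smul, TensorProduct.tmul_smul, map_smul,
      map_smul, hs]

/-- A balanced map lets the factors `E i a 0` cross the tensor sign, where they recombine to `∑ E i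
a 0 * E i 0 a = 1`. -/
theorem map_balProj_tmul {q : X ⊗[F] Y →ₗ[F] W}
    (hq : ∀ t x y, q (ρ (op t) x ⊗ₜ y) = q (x ⊗ₜ τ t y)) (x : X) (y : Y) :
    q (U.balProj ρ τ (x ⊗ₜ y)) = q (x ⊗ₜ y) := by
  rw [balProj_tmul]
  simp_rw [map_sum, hq, ← Module.End.mul_apply, ← map_mul, U.mul_same, ← map_sum,
    ← TensorProduct.tmul_sum, ← LinearMap.sum_apply, ← map_sum, U.sum_diag, map_one]
  rfl

/-- The space `W` plays the part of `X ⊗_T Y`, given as a retract of `X ⊗[F] Y` cut out by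
`balProj`. By cyclicity, the trace of `h` is that of `(f ⊗ g) ∘ balProj`, a sum of products of
traces. The abstract form covers both the tensor product over `T` and the scalar extension of one
over the base ring. -/
theorem trace_balanced [Module.Finite F X] [Module.Finite F Y] {q : X ⊗[F] Y →ₗ[F] W}
    {s : W →ₗ[F] X ⊗[F] Y} (hqs : q ∘ₗ s = LinearMap.id) (hsq : s ∘ₗ q = U.balProj ρ τ)
    {f : X →ₗ[F] X} {g : Y →ₗ[F] Y} {h : W →ₗ[F] W}
    (hh : h ∘ₗ q = q ∘ₗ TensorProduct.map f g) (hf : ∀ t, f * ρ t = ρ t * f) :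
    LinearMap.trace F W h =
      ∑ i, LinearMap.trace F X (f * ρ (op (U.e i))) * LinearMap.trace F Y (g * τ (U.e i)) := by
  have _ : Module.Finite F W := Module.Finite.of_surjective q fun w =>
    ⟨s w, LinearMap.congr_fun hqs w⟩
  have h1 : h = q ∘ₗ (TensorProduct.map f g ∘ₗ s) := by
    rw [← LinearMap.comp_assoc, ← hh, LinearMap.comp_assoc, hqs, LinearMap.comp_id]
  rw [h1, LinearMap.trace_comp_comm', LinearMap.comp_assoc, hsq, balProj,
    ← Module.End.mul_eq_comp, Finset.mul_sum, map_sum]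
  refine Finset.sum_congr rfl fun i _ => ?_
  rw [Finset.mul_sum, map_sum, Finset.sum_eq_single 0]
  · rw [Module.End.mul_eq_comp, ← TensorProduct.map_comp, LinearMap.trace_tensorProduct']
    rfl
  · intro a _ ha
    rw [Module.End.mul_eq_comp, ← TensorProduct.map_comp, LinearMap.trace_tensorProduct']
    -- Write `E i a 0 = E i a a * E i a 0` and move `E i a a` cyclically past `f`; the product in
    -- the other order is zero because `a ≠ 0`.
    have h0 : LinearMap.trace F X (f ∘ₗ ρ (op (U.E i a 0))) = 0 := by
      rw [← U.mul_same i a a 0, op_mul, map_mul, ← Module.End.mul_eq_comp, ← mul_assoc,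
        LinearMap.trace_mul_comm, ← mul_assoc, ← hf, mul_assoc, ← map_mul, ← op_mul,
        U.mul_of_ne _ _ _ _ _ ha.symm, op_zero, map_zero, mul_zero, map_zero]
    rw [h0, zero_mul]
  · simp

end Balanced

end MatUnits

section TensorCharacter

variable {F : Type u} [Field F]

theorem FGMod.chr_tmul {S T : Type u} [Ring S] [Algebra F S] [Ring T] [Algebra F T]
    (X : FGMod (S ⊗[F] Tᵐᵒᵖ)) (s : S) (t : Tᵐᵒᵖ) :
    X.chr F (s ⊗ₜ t) = LinearMap.trace F X (leftAct X s * rightAct X t) := by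
  rw [FGMod.chr_apply, leftAct, rightAct, AlgHom.comp_apply, AlgHom.comp_apply,
    ← map_mul (X.rep F), Algebra.TensorProduct.includeLeft_apply,
    Algebra.TensorProduct.includeRight_apply, Algebra.TensorProduct.tmul_mul_tmul, mul_one, one_mul]

theorem chr_bimodOfActs {S T V : Type u} [Ring S] [Algebra F S] [Ring T] [Algebra F T]
    [AddCommGroup V] [Module F V] [Module.Finite F V] (l : S →ₐ[F] Module.End F V)
    (r : Tᵐᵒᵖ →ₐ[F] Module.End F V) (h : ∀ a b, Commute (l a) (r b)) (s : S) (t : Tᵐᵒᵖ) :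
    (bimodOfActs l r h).chr F (s ⊗ₜ t) = LinearMap.trace F V (l s * r t) := by
  rw [bimodOfActs, FGMod.chr_ofRep, Algebra.TensorProduct.lift_tmul]

theorem chr_tensorMod {S T : Type u} [Ring S] [Algebra F S] [Module.Finite F S] [Ring T]
    [Algebra F T] [Module.Finite F T] (U : MatUnits F T) (X : FGMod (S ⊗[F] Tᵐᵒᵖ)) (V : FGMod T)
    (s : S) :
    (tensorMod X V).chr F s = ∑ i, X.chr F (s ⊗ₜ op (U.e i)) * V.chr F (U.e i) := by
  have := FGMod.finite_base (R := F) X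
  have := FGMod.finite_base (R := F) V
  rw [tensorMod, FGMod.chr_ofRep]
  simp_rw [FGMod.chr_tmul]
  refine (U.trace_balanced (rightAct X) (V.rep F) (f := leftAct X s) (g := LinearMap.id)
    (q := (balancedRel (rightAct X) (V.rep F)).mkQ)
    (s := (balancedRel (rightAct X) (V.rep F)).liftQ (U.balProj (rightAct X) (V.rep F)) ?_)
    ?_ ?_ ?_ ?_).trans ?_
  · refine Submodule.span_le.mpr ?_
    rintro _ ⟨x, b, y, rfl⟩
    rw [SetLike.mem_coe, LinearMap.mem_ker, map_sub, U.balProj_balanced, sub_self]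
  · refine BalTensor.hom_ext fun x y => ?_
    change Submodule.mkQ _ (U.balProj _ _ (x ⊗ₜ y)) = Submodule.mkQ _ (x ⊗ₜ y)
    refine U.map_balProj_tmul _ _ (fun t x y => ?_) x y
    rw [← sub_eq_zero, ← map_sub]
    exact (Submodule.Quotient.mk_eq_zero _).mpr (Submodule.subset_span ⟨x, t, y, rfl⟩)
  · exact Submodule.liftQ_mkQ _ _ _
  · exact TensorProduct.ext' fun x y => rfl
  · exact fun t => (commute_leftAct_rightAct X s t).eq
  · refine Finset.sum_congr rfl fun i _ => ?_
    congr 1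

/-- At primitive idempotents `s` this is the product of the multiplicity matrix of `M` with the
multiplicity vector of `χ`. -/
theorem K0chr_virtualAct {S T : Type u} [Ring S] [Algebra F S] [Module.Finite F S] [Ring T]
    [Algebra F T] [Module.Finite F T] (U : MatUnits F T) (M : SplitK0 (S ⊗[F] Tᵐᵒᵖ))
    (χ : SplitK0 T) (s : S) :
    K0chr F (virtualAct M χ) s = ∑ i, K0chr F M (s ⊗ₜ op (U.e i)) * K0chr F χ (U.e i) := by
  unfold virtualAct
  induction M using SplitK0.induction with
  | hcls X =>
    induction χ using SplitK0.induction with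
    | hcls V =>
      rw [FGBifunctor.K0map₂_cls]
      simp only [K0chr_cls]
      exact chr_tensorMod U X V s
    | hsub M N hM hN =>
      simp only [map_sub, LinearMap.sub_apply, hM, hN, mul_sub, Finset.sum_sub_distrib]
  | hsub M N hM hN =>
    simp only [map_sub, AddMonoidHom.sub_apply, LinearMap.sub_apply, hM, hN, sub_mul,
      Finset.sum_sub_distrib]

end TensorCharacter

/-! ### Characters of extended bimodules -/

section BaseChangeCharacter

theorem leftAct_bimodOfActs {R A B V : Type u} [CommRing R] [Ring A] [Ring B] [Algebra R A]
    [Algebra R B] [AddCommGroup V] [Module R V] [Module.Finite R V] (l : A →ₐ[R] Module.End R V)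
    (r : Bᵐᵒᵖ →ₐ[R] Module.End R V) (h : ∀ a b, Commute (l a) (r b)) (a : A) (v : V) :
    leftAct (bimodOfActs l r h) a ((FGMod.ofRepEquiv _).symm v) =
      (FGMod.ofRepEquiv (Algebra.TensorProduct.lift l r h)).symm (l a v) := by
  change Algebra.TensorProduct.lift l r h (a ⊗ₜ 1) v = l a v
  rw [Algebra.TensorProduct.lift_tmul, map_one, mul_one]

theorem rightAct_bimodOfActs {R A B V : Type u} [CommRing R] [Ring A] [Ring B] [Algebra R A]
    [Algebra R B] [AddCommGroup V] [Module R V] [Module.Finite R V] (l : A →ₐ[R] Module.End R V)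
    (r : Bᵐᵒᵖ →ₐ[R] Module.End R V) (h : ∀ a b, Commute (l a) (r b)) (b : Bᵐᵒᵖ) (v : V) :
    rightAct (bimodOfActs l r h) b ((FGMod.ofRepEquiv _).symm v) =
      (FGMod.ofRepEquiv (Algebra.TensorProduct.lift l r h)).symm (r b v) := by
  change Algebra.TensorProduct.lift l r h (1 ⊗ₜ b) v = r b v
  rw [Algebra.TensorProduct.lift_tmul, map_one, one_mul]

variable {R : Type u} [CommRing R] {F : Type u} [Field F] [Algebra R F]
  {A B C : Type u} [Ring A] [Ring B] [Ring C] [Algebra R A] [Algebra R B] [Algebra R C]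
  [Module.Finite R A] [Module.Finite R B] [Module.Finite R C]

theorem chr_baseChangeBimod (X : FGMod (A ⊗[R] Bᵐᵒᵖ)) (s : F ⊗[R] A) (t : (F ⊗[R] B)ᵐᵒᵖ) :
    (baseChangeBimod F X).chr F (s ⊗ₜ t) =
      LinearMap.trace F (F ⊗[R] X) (baseChangeLeftAct F X s * baseChangeRightAct F X t) := by
  have := FGMod.finite_base (R := R) X
  exact chr_bimodOfActs (V := F ⊗[R] X) _ _ _ s t

theorem chr_baseChangeBimod_tmul (X : FGMod (A ⊗[R] Bᵐᵒᵖ)) (c d : F) (a : A) (b : B) :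
    (baseChangeBimod F X).chr F ((c ⊗ₜ a) ⊗ₜ op (d ⊗ₜ b)) =
      c * d * LinearMap.trace F (F ⊗[R] X)
        ((leftAct X a * rightAct X (op b)).baseChange F) := by
  rw [chr_baseChangeBimod]
  refine Eq.trans (congrArg _ ?_) (LinearMap.map_smul _ (c * d) _)
  refine TensorProduct.AlgebraTensorModule.ext fun z x => ?_
  rw [Module.End.mul_apply, baseChangeRightAct_tmul, baseChangeLeftAct_tmul, LinearMap.smul_apply,
    LinearMap.baseChange_tmul, TensorProduct.smul_tmul', smul_eq_mul, mul_assoc]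
  rfl

/-- The balanced map `X × Y → X ⊗_B Y`, as an `R`-linear map on `X ⊗[R] Y`. -/
def tensorBimodMk (X : FGMod (A ⊗[R] Bᵐᵒᵖ)) (Y : FGMod (B ⊗[R] Cᵐᵒᵖ)) :
    X ⊗[R] Y →ₗ[R] tensorBimod X Y :=
  haveI := FGMod.finite_base (R := R) X
  haveI := FGMod.finite_base (R := R) Y
  (FGMod.ofRepEquiv (V := BalTensor (rightAct X) (leftAct Y)) _).symm.toLinearMap ∘ₗ
    (balancedRel (rightAct X) (leftAct Y)).mkQ

/-- The homomorphism out of `X ⊗_B Y` induced by a balanced map. -/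
def tensorBimodLift (X : FGMod (A ⊗[R] Bᵐᵒᵖ)) (Y : FGMod (B ⊗[R] Cᵐᵒᵖ)) {Z : Type*}
    [AddCommGroup Z] [Module R Z] (f : X ⊗[R] Y →ₗ[R] Z)
    (hf : ∀ x b y, f (rightAct X (op b) x ⊗ₜ y) = f (x ⊗ₜ leftAct Y b y)) :
    tensorBimod X Y →ₗ[R] Z :=
  haveI := FGMod.finite_base (R := R) X
  haveI := FGMod.finite_base (R := R) Y
  (balancedRel (rightAct X) (leftAct Y)).liftQ f (Submodule.span_le.mpr (by
    rintro _ ⟨x, b, y, rfl⟩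
    rw [SetLike.mem_coe, LinearMap.mem_ker, map_sub, hf, sub_self])) ∘ₗ
    (FGMod.ofRepEquiv (V := BalTensor (rightAct X) (leftAct Y)) _).toLinearMap

theorem tensorBimodMk_balanced (X : FGMod (A ⊗[R] Bᵐᵒᵖ)) (Y : FGMod (B ⊗[R] Cᵐᵒᵖ)) (x : X) (b : B)
    (y : Y) :
    tensorBimodMk X Y (rightAct X (op b) x ⊗ₜ y) = tensorBimodMk X Y (x ⊗ₜ leftAct Y b y) := by
  rw [← sub_eq_zero, ← map_sub]
  exact (Submodule.Quotient.mk_eq_zero _).mpr (Submodule.subset_span ⟨x, b, y, rfl⟩)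

theorem tensorBimodMk_surjective (X : FGMod (A ⊗[R] Bᵐᵒᵖ)) (Y : FGMod (B ⊗[R] Cᵐᵒᵖ)) :
    Function.Surjective (tensorBimodMk X Y) := Submodule.mkQ_surjective _

theorem leftAct_tensorBimodMk (X : FGMod (A ⊗[R] Bᵐᵒᵖ)) (Y : FGMod (B ⊗[R] Cᵐᵒᵖ)) (a : A) (x : X)
    (y : Y) : leftAct (tensorBimod X Y) a (tensorBimodMk X Y (x ⊗ₜ y)) =
      tensorBimodMk X Y (leftAct X a x ⊗ₜ y) := by
  have := FGMod.finite_base (R := R) X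
  have := FGMod.finite_base (R := R) Y
  exact leftAct_bimodOfActs (V := BalTensor (rightAct X) (leftAct Y)) _ _ _ a
    (Submodule.Quotient.mk (x ⊗ₜ[R] y))

theorem rightAct_tensorBimodMk (X : FGMod (A ⊗[R] Bᵐᵒᵖ)) (Y : FGMod (B ⊗[R] Cᵐᵒᵖ)) (c : Cᵐᵒᵖ)
    (x : X) (y : Y) : rightAct (tensorBimod X Y) c (tensorBimodMk X Y (x ⊗ₜ y)) =
      tensorBimodMk X Y (x ⊗ₜ rightAct Y c y) := by
  have := FGMod.finite_base (R := R) X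
  have := FGMod.finite_base (R := R) Y
  exact rightAct_bimodOfActs (V := BalTensor (rightAct X) (leftAct Y)) _ _ _ c
    (Submodule.Quotient.mk (x ⊗ₜ[R] y))

/-- The scalar extension of `X ⊗_B Y` is exhibited directly as a retract of `(F ⊗ X) ⊗[F] (F ⊗ Y)`,
so `trace_balanced` applies without first comparing it with the tensor product over `F ⊗ B`. -/
theorem chr_baseChange_tensorBimod (U : MatUnits F (F ⊗[R] B)) (X : FGMod (A ⊗[R] Bᵐᵒᵖ))
    (Y : FGMod (B ⊗[R] Cᵐᵒᵖ)) (s : F ⊗[R] A) (t : (F ⊗[R] C)ᵐᵒᵖ) :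
    (baseChangeBimod F (tensorBimod X Y)).chr F (s ⊗ₜ t) =
      ∑ i, (baseChangeBimod F X).chr F (s ⊗ₜ op (U.e i)) *
        (baseChangeBimod F Y).chr F (U.e i ⊗ₜ t) := by
  have := FGMod.finite_base (R := R) X
  have := FGMod.finite_base (R := R) Y
  simp_rw [chr_baseChangeBimod]
  let δ := TensorProduct.AlgebraTensorModule.distribBaseChange R F X Y
  have hδ : ∀ c x y, δ (c ⊗ₜ (x ⊗ₜ y)) = (c ⊗ₜ x) ⊗ₜ[F] ((1 : F) ⊗ₜ y) := fun _ _ _ => rfl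
  have hδ' : ∀ c d x y, δ.symm ((c ⊗ₜ x) ⊗ₜ[F] (d ⊗ₜ y)) = (c * d) ⊗ₜ (x ⊗ₜ y) := by
    intro c d x y
    rw [LinearEquiv.symm_apply_eq, hδ, mul_comm, ← smul_eq_mul, ← TensorProduct.smul_tmul',
      TensorProduct.smul_tmul, TensorProduct.smul_tmul', smul_eq_mul, mul_one]
  -- The projection of the retract: multiply the two scalars and pass to the balanced quotient.
  let q : (F ⊗[R] X) ⊗[F] (F ⊗[R] Y) →ₗ[F] F ⊗[R] tensorBimod X Y :=
    (tensorBimodMk X Y).baseChange F ∘ₗ δ.symm.toLinearMap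
  have hq : ∀ c d x y, q ((c ⊗ₜ x) ⊗ₜ[F] (d ⊗ₜ y)) = (c * d) ⊗ₜ tensorBimodMk X Y (x ⊗ₜ y) := by
    intro c d x y
    simp only [q, LinearMap.comp_apply, LinearEquiv.coe_coe]
    rw [hδ', LinearMap.baseChange_tmul]
  let P := U.balProj (baseChangeRightAct F X) (baseChangeLeftAct F Y)
  let f : X ⊗[R] Y →ₗ[R] (F ⊗[R] X) ⊗[F] (F ⊗[R] Y) :=
    (P ∘ₗ δ.toLinearMap).restrictScalars R ∘ₗ TensorProduct.mk R F (X ⊗[R] Y) 1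
  have hf : ∀ x y, f (x ⊗ₜ y) = P (((1 : F) ⊗ₜ x) ⊗ₜ ((1 : F) ⊗ₜ y)) := fun _ _ => rfl
  have hbal : ∀ x b y, f (rightAct X (op b) x ⊗ₜ y) = f (x ⊗ₜ leftAct Y b y) := by
    intro x b y
    have h := U.balProj_balanced (baseChangeRightAct F X) (baseChangeLeftAct F Y)
      ((1 : F) ⊗ₜ b) ((1 : F) ⊗ₜ x) ((1 : F) ⊗ₜ y)
    rwa [baseChangeRightAct_tmul, baseChangeLeftAct_tmul, mul_one] at h
  -- The section of the retract: `balProj` on vectors of the form `1 ⊗ x` and `1 ⊗ y` is balanced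
  -- over `B`, hence descends to `X ⊗_B Y` and extends linearly to `F`.
  let σ : F ⊗[R] tensorBimod X Y →ₗ[F] (F ⊗[R] X) ⊗[F] (F ⊗[R] Y) :=
    LinearMap.liftBaseChange F (tensorBimodLift X Y (Z := (F ⊗[R] X) ⊗[F] (F ⊗[R] Y)) f hbal)
  have hσ : ∀ c t, σ (c ⊗ₜ tensorBimodMk X Y t) = c • f t := fun _ _ =>
    LinearMap.liftBaseChange_tmul ..
  have hqbal : ∀ (t : F ⊗[R] B) v w, q (baseChangeRightAct F X (op t) v ⊗ₜ w) =
      q (v ⊗ₜ baseChangeLeftAct F Y t w) := by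
    intro t v w
    induction t using TensorProduct.induction_on with
    | zero => simp
    | add t t' h h' => simp only [op_add, map_add, LinearMap.add_apply, TensorProduct.add_tmul,
        TensorProduct.tmul_add, h, h']
    | tmul c b =>
      induction v using TensorProduct.induction_on with
      | zero => simp
      | add t t' h h' => simp only [map_add, TensorProduct.add_tmul, h, h']
      | tmul d x =>
        induction w using TensorProduct.induction_on with
        | zero => simp
        | add t t' h h' => simp only [map_add, TensorProduct.tmul_add, h, h']
        | tmul d' y =>
          rw [baseChangeRightAct_tmul, baseChangeLeftAct_tmul, hq, hq, tensorBimodMk_balanced]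
          congr 1
          ring
  have hσq : σ ∘ₗ q = P := by
    refine TensorProduct.ext' fun v w => ?_
    rw [LinearMap.comp_apply]
    induction v using TensorProduct.induction_on with
    | zero => simp
    | add t t' h h' => simp only [map_add, TensorProduct.add_tmul, h, h']
    | tmul d x =>
      induction w using TensorProduct.induction_on with
      | zero => simp
      | add t t' h h' => simp only [map_add, TensorProduct.tmul_add, h, h']
      | tmul d' y =>
        rw [hq, hσ, hf, ← map_smul, mul_smul, ← TensorProduct.tmul_smul, TensorProduct.smul_tmul',
          TensorProduct.smul_tmul', TensorProduct.smul_tmul']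
        simp
  have hqσ : q ∘ₗ σ = LinearMap.id := by
    refine TensorProduct.AlgebraTensorModule.ext fun c w => ?_
    obtain ⟨t, rfl⟩ := tensorBimodMk_surjective X Y w
    rw [LinearMap.comp_apply, hσ, LinearMap.id_apply, map_smul]
    induction t using TensorProduct.induction_on with
    | zero => simp
    | add t t' h h' => simp only [map_add, smul_add, TensorProduct.tmul_add, h, h']
    | tmul x y =>
      rw [hf, U.map_balProj_tmul _ _ hqbal, hq, TensorProduct.smul_tmul']
      simp
  refine U.trace_balanced (baseChangeRightAct F X) (baseChangeLeftAct F Y)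
    (f := baseChangeLeftAct F X s) (g := baseChangeRightAct F Y t) hqσ hσq ?_ ?_ |>.trans ?_
  · refine TensorProduct.ext' fun v w => ?_
    obtain ⟨t, rfl⟩ := MulOpposite.op_surjective t
    simp only [LinearMap.comp_apply, TensorProduct.map_tmul, Module.End.mul_apply]
    induction s using TensorProduct.induction_on with
    | zero => simp
    | add t t' h h' => simp only [map_add, LinearMap.add_apply, TensorProduct.add_tmul, h, h']
    | tmul a₁ a =>
      induction t using TensorProduct.induction_on with
      | zero => simp
      | add t t' h h' => simp only [op_add, map_add, LinearMap.add_apply, TensorProduct.tmul_add,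
          h, h']
      | tmul c₁ c =>
        induction v using TensorProduct.induction_on with
        | zero => simp
        | add t t' h h' => simp only [map_add, TensorProduct.add_tmul, h, h']
        | tmul d x =>
          induction w using TensorProduct.induction_on with
          | zero => simp
          | add t t' h h' => simp only [map_add, TensorProduct.tmul_add, h, h']
          | tmul d' y =>
            rw [hq, baseChangeRightAct_tmul, baseChangeLeftAct_tmul, baseChangeLeftAct_tmul,
              baseChangeRightAct_tmul, hq, rightAct_tensorBimodMk, leftAct_tensorBimodMk]
            congr 1
            ring
  · exact fun b => (commute_baseChangeActs F X s b).eq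
  · refine Finset.sum_congr rfl fun i _ => ?_
    rw [(commute_baseChangeActs F Y (U.e i) t).eq]

end BaseChangeCharacter

/-! ### Extended characters of virtual products, regular bimodules and duals. -/

section BaseChangeVirtual

variable {R : Type u} [CommRing R] {F : Type u} [Field F] [Algebra R F]
  {A B C : Type u} [Ring A] [Ring B] [Ring C] [Algebra R A] [Algebra R B] [Algebra R C]
  [Module.Finite R A] [Module.Finite R B] [Module.Finite R C]

theorem K0chr_virtualBaseChange_cls (X : FGMod (A ⊗[R] Bᵐᵒᵖ)) :
    K0chr F (virtualBaseChange F (cls X)) = (baseChangeBimod F X).chr F := by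
  rw [virtualBaseChange, FGFunctor.K0map_cls, K0chr_cls]
  rfl

theorem virtualBaseChange_sub (M N : SplitK0 (A ⊗[R] Bᵐᵒᵖ)) :
    virtualBaseChange F (M - N) = virtualBaseChange F M - virtualBaseChange F N := map_sub _ _ _

/-- At primitive idempotents this is multiplication of multiplicity matrices. -/
theorem K0chr_virtualBaseChange_virtualTensor (U : MatUnits F (F ⊗[R] B))
    (M : SplitK0 (A ⊗[R] Bᵐᵒᵖ)) (N : SplitK0 (B ⊗[R] Cᵐᵒᵖ)) (s : F ⊗[R] A)
    (t : (F ⊗[R] C)ᵐᵒᵖ) :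
    K0chr F (virtualBaseChange F (virtualTensor M N)) (s ⊗ₜ t) =
      ∑ i, K0chr F (virtualBaseChange F M) (s ⊗ₜ op (U.e i)) *
        K0chr F (virtualBaseChange F N) (U.e i ⊗ₜ t) := by
  unfold virtualTensor
  induction M using SplitK0.induction with
  | hcls X =>
    induction N using SplitK0.induction with
    | hcls Y =>
      rw [FGBifunctor.K0map₂_cls]
      simp only [K0chr_virtualBaseChange_cls]
      exact chr_baseChange_tensorBimod U X Y s t
    | hsub M N hM hN =>
      simp only [map_sub, virtualBaseChange_sub, LinearMap.sub_apply, hM, hN, mul_sub,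
        Finset.sum_sub_distrib]
  | hsub M N hM hN =>
    simp only [map_sub, virtualBaseChange_sub, AddMonoidHom.sub_apply, LinearMap.sub_apply, hM, hN,
      sub_mul, Finset.sum_sub_distrib]

theorem chr_baseChange_regularBimod (s t : F ⊗[R] A) :
    (baseChangeBimod F (regularBimod R A)).chr F (s ⊗ₜ op t) =
      LinearMap.trace F (F ⊗[R] A) (LinearMap.mulLeft F s * LinearMap.mulRight F t) := by
  rw [chr_baseChangeBimod]
  let ε : regularBimod R A ≃ₗ[R] A := FGMod.ofRepEquiv (AlgHom.mulLeftRight R A)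
  refine LinearMap.trace_eq_of_equiv (LinearEquiv.baseChange R F _ _ ε) fun v => ?_
  simp only [Module.End.mul_apply, LinearMap.mulLeft_apply, LinearMap.mulRight_apply]
  induction s using TensorProduct.induction_on with
  | zero => simp
  | add t t' h h' => simp only [map_add, LinearMap.add_apply, add_mul, h, h']
  | tmul a₁ a =>
    induction t using TensorProduct.induction_on with
    | zero => simp
    | add t t' h h' => simp only [op_add, map_add, LinearMap.add_apply, mul_add, h, h']
    | tmul c₁ c =>
      induction v using TensorProduct.induction_on with
      | zero => simp
      | add t t' h h' => simp only [map_add, add_mul, mul_add, h, h']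
      | tmul d x =>
        rw [baseChangeRightAct_tmul, baseChangeLeftAct_tmul, LinearEquiv.baseChange_tmul,
          LinearEquiv.baseChange_tmul, Algebra.TensorProduct.tmul_mul_tmul,
          Algebra.TensorProduct.tmul_mul_tmul, mul_comm c₁]
        congr 1
        change AlgHom.mulLeftRight R A (a ⊗ₜ 1) (AlgHom.mulLeftRight R A (1 ⊗ₜ op c) (ε x)) =
          a * (ε x * c)
        rw [AlgHom.mulLeftRight_apply, AlgHom.mulLeftRight_apply]
        simp

/-- Projective over `A`, which is free over `R`, implies projective over `R`, hence free over a
principal ideal domain. Freeness is what makes traces compatible with scalar extension and with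
duality. -/
theorem FGMod.free_of_isBiprojective [IsDomain R] [IsPrincipalIdealRing R] [Module.Free R A]
    {X : FGMod (A ⊗[R] Bᵐᵒᵖ)} (hX : IsBiprojective X) : Module.Free R X := by
  have := FGMod.finite_base (R := R) X
  let _ : Module A X := leftModule X
  have _ := hX.projective_left
  have _ : IsScalarTower R A X := ⟨fun r a x => by
    change ((r • a) ⊗ₜ[R] (1 : Bᵐᵒᵖ)) • x = r • ((a ⊗ₜ[R] (1 : Bᵐᵒᵖ)) • x)
    rw [← TensorProduct.smul_tmul', smul_assoc]⟩
  have _ := hX.finite_left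
  obtain ⟨n, p, hp⟩ := Module.Finite.exists_fin' A X
  obtain ⟨i, hi⟩ := Module.projective_lifting_property p LinearMap.id hp
  have : Module.Projective R X := Module.Projective.of_split (i.restrictScalars R)
    (p.restrictScalars R) (LinearMap.ext fun x => LinearMap.congr_fun hi x)
  infer_instance

theorem chr_baseChangeBimod_tmul_of_free (X : FGMod (A ⊗[R] Bᵐᵒᵖ)) [Module.Free R X] (c d : F)
    (a : A) (b : B) :
    (baseChangeBimod F X).chr F ((c ⊗ₜ a) ⊗ₜ op (d ⊗ₜ b)) =
      c * d * algebraMap R F (LinearMap.trace R X (leftAct X a * rightAct X (op b))) := by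
  have := FGMod.finite_base (R := R) X
  rw [chr_baseChangeBimod_tmul, LinearMap.trace_baseChange]

/-- The actions on the dual are the transposes of those on `X`, and transposition preserves the
trace. It suffices to compare pure tensors, where both traces come from the base ring. -/
theorem chr_baseChange_dualBimod [IsNoetherianRing R] (X : FGMod (A ⊗[R] Bᵐᵒᵖ)) [Module.Free R X]
    (s : F ⊗[R] A) (t : F ⊗[R] B) :
    (baseChangeBimod F (dualBimod X)).chr F (t ⊗ₜ op s) =
      (baseChangeBimod F X).chr F (s ⊗ₜ op t) := by
  have := FGMod.finite_base (R := R) X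
  let ε : dualBimod X ≃ₗ[R] Module.Dual R X := FGMod.ofRepEquiv _
  have : Module.Free R (dualBimod X) := Module.Free.of_equiv ε.symm
  induction s using TensorProduct.induction_on with
  | zero => simp
  | add s s' h h' =>
    simp only [op_add, TensorProduct.add_tmul, TensorProduct.tmul_add, map_add, h, h']
  | tmul c a =>
    induction t using TensorProduct.induction_on with
    | zero => simp
    | add s s' h h' =>
      simp only [op_add, TensorProduct.add_tmul, TensorProduct.tmul_add, map_add, h, h']
    | tmul d b =>
      rw [chr_baseChangeBimod_tmul_of_free, chr_baseChangeBimod_tmul_of_free, mul_comm d c]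
      congr 2
      rw [← LinearMap.trace_transpose' (leftAct X a * rightAct X (op b))]
      refine LinearMap.trace_eq_of_equiv ε fun φ => ?_
      have h1 := leftAct_bimodOfActs (dualLeftAct X) (dualRightAct X) (commute_dualActs X) b
      have h2 := rightAct_bimodOfActs (dualLeftAct X) (dualRightAct X) (commute_dualActs X) (op a)
      exact (congrArg ε (congrArg (leftAct (dualBimod X) b) (h2 (ε φ)))).trans
        (congrArg ε (h1 _))

variable (F) in
/-- The dual of a virtual bimodule has the same character, with the two sides exchanged. -/
theorem K0chr_virtualBaseChange_virtualDual [IsDomain R] [IsPrincipalIdealRing R] [Module.Free R A]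
    (hA : IsSelfDualAlgebra R A) (hB : IsSelfDualAlgebra R B) (M : biprojectiveSubgroup R A B)
    (s : F ⊗[R] A) (t : F ⊗[R] B) :
    K0chr F (virtualBaseChange F (virtualDual hA hB M : SplitK0 (B ⊗[R] Aᵐᵒᵖ))) (t ⊗ₜ op s) =
      K0chr F (virtualBaseChange F (M : SplitK0 (A ⊗[R] Bᵐᵒᵖ))) (s ⊗ₜ op t) := by
  obtain ⟨M, hM⟩ := M
  change K0chr F (virtualBaseChange F ((dualFunctor R A B).K0map M)) _ = _
  unfold virtualBaseChange
  induction hM using AddSubgroup.closure_induction with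
  | mem x hx =>
    obtain ⟨X, hX, rfl⟩ := hx
    have := FGMod.free_of_isBiprojective hX
    rw [FGCofunctor.K0map_cls, ← virtualBaseChange, ← virtualBaseChange,
      K0chr_virtualBaseChange_cls, K0chr_virtualBaseChange_cls]
    exact chr_baseChange_dualBimod X s t
  | zero => simp
  | add x y _ _ hx hy => simp only [map_add, LinearMap.add_apply, hx, hy]
  | neg x _ hx => simp only [map_neg, LinearMap.neg_apply, hx]

variable (F) in
/-- The character of a biprojective virtual bimodule is defined over the base ring. -/
theorem exists_K0chr_virtualBaseChange_tmul [IsDomain R] [IsPrincipalIdealRing R]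
    [Module.Free R A] (M : biprojectiveSubgroup R A B) (a : A) (b : B) :
    ∃ r : R, ∀ c d : F, K0chr F (virtualBaseChange F (M : SplitK0 (A ⊗[R] Bᵐᵒᵖ)))
      ((c ⊗ₜ a) ⊗ₜ op (d ⊗ₜ b)) = c * d * algebraMap R F r := by
  obtain ⟨M, hM⟩ := M
  unfold virtualBaseChange
  induction hM using AddSubgroup.closure_induction with
  | mem x hx =>
    obtain ⟨X, hX, rfl⟩ := hx
    have := FGMod.free_of_isBiprojective hX
    refine ⟨LinearMap.trace R X (leftAct X a * rightAct X (op b)), fun c d => ?_⟩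
    rw [← virtualBaseChange, K0chr_virtualBaseChange_cls, chr_baseChangeBimod_tmul_of_free]
  | zero => exact ⟨0, by simp⟩
  | add x y _ _ hx hy =>
    obtain ⟨r, hr⟩ := hx
    obtain ⟨r', hr'⟩ := hy
    exact ⟨r + r', fun c d => by simp only [map_add, LinearMap.add_apply, hr, hr', mul_add]⟩
  | neg x _ hx =>
    obtain ⟨r, hr⟩ := hx
    exact ⟨-r, fun c d => by simp only [map_neg, LinearMap.neg_apply, hr, mul_neg]⟩

/-- The trace of `u ↦ e i * u * e j` is `χ_j (e i)`, so the regular bimodule has the identity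
matrix. -/
theorem K0chr_virtualBaseChange_regular (U : MatUnits F (F ⊗[R] A)) (i j : Fin U.n) :
    K0chr F (virtualBaseChange F (cls (regularBimod R A))) (U.e i ⊗ₜ op (U.e j)) =
      if i = j then 1 else 0 := by
  rw [K0chr_virtualBaseChange_cls, chr_baseChange_regularBimod, ← MatUnits.chi_apply,
    MatUnits.chi_e]
  simp only [eq_comm]

end BaseChangeVirtual

/-! ### Signed permutation matrices -/

theorem exists_isUnit_of_sum_mul_self_eq_one {ι : Type*} [Fintype ι] [DecidableEq ι] {f : ι → ℤ}
    (h : ∑ k, f k * f k = 1) : ∃ k, IsUnit (f k) ∧ ∀ k', k' ≠ k → f k' = 0 := by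
  obtain ⟨k, hk⟩ : ∃ k, f k ≠ 0 := by
    by_contra! h0
    simp [h0] at h
  rw [← Finset.add_sum_erase _ _ (Finset.mem_univ k)] at h
  have h1 : 1 ≤ f k * f k := Int.add_one_le_iff.mpr (mul_self_pos.mpr hk)
  have h2 : 0 ≤ ∑ x ∈ Finset.univ.erase k, f x * f x :=
    Finset.sum_nonneg fun _ _ => mul_self_nonneg _
  refine ⟨k, IsUnit.of_mul_eq_one (f k) (by linarith), fun k' hk' => ?_⟩
  have h3 : ∑ x ∈ Finset.univ.erase k, f x * f x = 0 := by linarith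
  rw [Finset.sum_eq_zero_iff_of_nonneg fun _ _ => mul_self_nonneg _] at h3
  exact mul_self_eq_zero.mp (h3 k' (Finset.mem_erase.mpr ⟨hk', Finset.mem_univ _⟩))

/-- An orthogonal integer matrix is a signed permutation matrix. -/
theorem exists_equiv_of_orthogonal {ι κ : Type*} [Fintype ι] [DecidableEq ι] [Fintype κ]
    [DecidableEq κ] {m : κ → ι → ℤ} (h₁ : ∀ j, ∑ i, m j i * m j i = 1)
    (h₂ : ∀ i, ∑ j, m j i * m j i = 1) :
    ∃ (π : ι ≃ κ) (ε : ι → ℤˣ), ∀ j i, m j i = if j = π i then (ε i : ℤ) else 0 := by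
  choose π hπ hπ0 using fun i => exists_isUnit_of_sum_mul_self_eq_one (h₂ i)
  choose ρ hρ hρ0 using fun j => exists_isUnit_of_sum_mul_self_eq_one (h₁ j)
  -- A nonzero entry is the unique one both in its row and in its column, so the two choice
  -- functions are inverse to each other.
  have h : ∀ i j, m j i ≠ 0 → π i = j ∧ ρ j = i := fun i j hij =>
    ⟨by by_contra h; exact hij (hπ0 i j (Ne.symm h)),
      by by_contra h; exact hij (hρ0 j i (Ne.symm h))⟩
  refine ⟨⟨π, ρ, fun i => (h i (π i) (hπ i).ne_zero).2, fun j => (h (ρ j) j (hρ j).ne_zero).1⟩,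
    fun i => (hπ i).unit, fun j i => ?_⟩
  split_ifs with hj
  · subst hj; rfl
  · exact hπ0 i j hj

/-! ### Symmetrizing forms -/

/-- A dual basis of the right module underlying a biprojective bimodule. -/
theorem IsBiprojective.exists_dualBasis {R A B : Type u} [CommRing R]
    [Ring A] [Ring B] [Algebra R A] [Algebra R B] {X : FGMod (B ⊗[R] Aᵐᵒᵖ)} (hX : IsBiprojective X) :
    ∃ (n : ℕ) (l : Fin n → A →ₗ[R] X) (π : Fin n → X →ₗ[R] A), (∑ k, l k ∘ₗ π k = LinearMap.id) ∧
      (∀ k x a, π k (rightAct X (op a) x) = π k x * a) ∧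
      ∀ k u a, l k (u * a) = rightAct X (op a) (l k u) := by
  let _ : Module Aᵐᵒᵖ X := rightModule X
  have _ := hX.finite_right
  have _ := hX.projective_right
  have _ : IsScalarTower R Aᵐᵒᵖ X := ⟨fun r b x => by
    change ((1 : B) ⊗ₜ[R] (r • b)) • x = r • (((1 : B) ⊗ₜ[R] b) • x)
    rw [TensorProduct.tmul_smul, smul_assoc]⟩
  obtain ⟨n, p, hp⟩ := Module.Finite.exists_fin' Aᵐᵒᵖ X
  obtain ⟨i, hi⟩ := Module.projective_lifting_property p LinearMap.id hp
  refine ⟨n, fun k => (p.restrictScalars R) ∘ₗ (LinearMap.single R (fun _ : Fin n => Aᵐᵒᵖ) k) ∘ₗ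
      (MulOpposite.opLinearEquiv R).toLinearMap,
    fun k => (MulOpposite.opLinearEquiv R).symm.toLinearMap ∘ₗ LinearMap.proj k ∘ₗ
      i.restrictScalars R, ?_, fun k x a => ?_, fun k u a => ?_⟩
  · ext x
    rw [LinearMap.sum_apply]
    change ∑ k, p (Pi.single k (i x k)) = x
    rw [← map_sum, Finset.univ_sum_single]
    exact LinearMap.congr_fun hi x
  · change unop (i (op a • x) k) = unop (i x k) * a
    rw [map_smul]
    rfl
  · change p (Pi.single k (op (u * a))) = op a • p (Pi.single k (op u))
    rw [← map_smul, ← Pi.single_smul]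
    rfl

section Symmetric

variable {R : Type u} [CommRing R] {F : Type u} [Field F] [Algebra R F]
  {A B : Type u} [Ring A] [Ring B] [Algebra R A] [Algebra R B]
  [Module.Finite R A] [Module.Finite R B]

variable (R F A) in
/-- A symmetrizing form on `A`, extended to `F ⊗[R] A`. -/
structure SymmForm where
  toFun : A →ₗ[R] R
  ext : F ⊗[R] A →ₗ[F] F
  ext_tmul : ∀ c a, ext (c ⊗ₜ a) = c * algebraMap R F (toFun a)
  mul_comm : ∀ x y, ext (x * y) = ext (y * x)
  nondeg : ∀ x, (∀ y, ext (x * y) = 0) → x = 0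
  integral : ∀ x, (∀ a : A, ∃ r : R, ext (x * 1 ⊗ₜ a) = algebraMap R F r) → ∃ a : A, x = 1 ⊗ₜ a

/-- The form is `e 1`; bimodule compatibility makes it symmetric. Preimages of the coordinate
functions form a dual basis `b'`, and the expansion `x = ∑ s (x b' j) b j` gives nondegeneracy as
well as the self-duality of the lattice `A` in `F ⊗ A`. -/
theorem IsSelfDualAlgebra.nonempty_symmForm [Module.Free R A] (h : IsSelfDualAlgebra R A) :
    Nonempty (SymmForm R F A) := by
  obtain ⟨e, he⟩ := h
  have h1 : ∀ a y, e a y = e 1 (y * a) := fun a y => by simpa using he a 1 1 y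
  have h2 : ∀ a y, e a y = e 1 (a * y) := fun a y => by simpa using he 1 1 a y
  let s : F ⊗[R] A →ₗ[F] F := LinearMap.liftBaseChange F (Algebra.linearMap R F ∘ₗ e 1)
  have hs : ∀ c a, s (c ⊗ₜ a) = c * algebraMap R F (e 1 a) := fun c a =>
    LinearMap.liftBaseChange_tmul ..
  let b := Module.Free.chooseBasis R A
  let b' j := e.symm (b.coord j)
  have hb' : ∀ j y, e 1 (y * b' j) = b.coord j y := fun j y => by
    rw [← h1, LinearEquiv.apply_symm_apply]
  have hx : ∀ x : F ⊗[R] A, x = ∑ j, s (x * 1 ⊗ₜ b' j) ⊗ₜ b j := by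
    intro x
    induction x using TensorProduct.induction_on with
    | zero => simp
    | add x y hx hy =>
      simp only [add_mul, map_add, TensorProduct.add_tmul, Finset.sum_add_distrib]
      rw [← hx, ← hy]
    | tmul c a =>
      simp_rw [Algebra.TensorProduct.tmul_mul_tmul, hs, hb', mul_one]
      conv_lhs => rw [← b.sum_repr a, TensorProduct.tmul_sum]
      refine Finset.sum_congr rfl fun j _ => ?_
      rw [TensorProduct.tmul_smul, TensorProduct.smul_tmul', Algebra.smul_def, _root_.mul_comm]
      rfl
  refine ⟨⟨e 1, s, hs, fun x y => ?_, fun x h => ?_, fun x h => ?_⟩⟩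
  · induction x using TensorProduct.induction_on with
    | zero => simp
    | add x x' hx hx' => simp only [add_mul, mul_add, map_add, hx, hx']
    | tmul c a =>
      induction y using TensorProduct.induction_on with
      | zero => simp
      | add x x' hx hx' => simp only [add_mul, mul_add, map_add, hx, hx']
      | tmul d b =>
        rw [Algebra.TensorProduct.tmul_mul_tmul, Algebra.TensorProduct.tmul_mul_tmul, hs, hs,
          ← h1, ← h2, mul_comm c]
  · rw [hx x]
    exact Finset.sum_eq_zero fun j _ => by rw [h, TensorProduct.zero_tmul]
  · choose r hr using fun j => h (b' j)
    refine ⟨∑ j, r j • b j, ?_⟩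
    rw [hx x, TensorProduct.tmul_sum]
    refine Finset.sum_congr rfl fun j _ => ?_
    rw [hr, TensorProduct.tmul_smul, TensorProduct.smul_tmul', Algebra.algebraMap_eq_smul_one]

/-- The value on `e i * y` is that on `e i * y * e i`, a multiple of the value on `e i`. If the
latter vanished, nondegeneracy would give `e i = 0`. -/
theorem SymmForm.ext_e_ne_zero (s : SymmForm R F A) (U : MatUnits F (F ⊗[R] A)) (i : Fin U.n) :
    s.ext (U.e i) ≠ 0 := by
  intro h
  refine U.e_ne_zero i (s.nondeg _ fun y => ?_)
  have h1 : s.ext (U.e i * y) = s.ext (U.e i * y * U.e i) := by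
    rw [s.mul_comm, s.mul_comm (U.e i * y), ← mul_assoc, U.e_mul_e, s.mul_comm]
  rw [h1, U.e_mul_mul_e, map_smul, h, smul_zero]

/-- Since `z` is central, `x ↦ y x z` is an endomorphism of the projective right `A`-module `X`. Its
Hattori-Stallings trace is an element of `A` modulo commutators; the symmetrizing form takes it into
`R`, and expanding the form in irreducible characters gives the left side. -/
theorem exists_sum_chr_eq_algebraMap (s : SymmForm R F A) (U : MatUnits F (F ⊗[R] A))
    {X : FGMod (B ⊗[R] Aᵐᵒᵖ)} (hX : IsBiprojective X) (y : B) {z : A}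
    (hz : z ∈ Subalgebra.center R A) :
    ∃ r : R, ∑ i, s.ext (U.e i) *
      (baseChangeBimod F X).chr F ((1 ⊗ₜ y) ⊗ₜ op ((1 ⊗ₜ z) * U.e i)) = algebraMap R F r := by
  have := FGMod.finite_base (R := R) X
  obtain ⟨n, l, π, hlπ, hπ, hl⟩ := hX.exists_dualBasis
  let g : X →ₗ[R] X := leftAct X y * rightAct X (op z)
  have hg : ∀ a x, g (rightAct X (op a) x) = rightAct X (op a) (g x) := by
    intro a x
    have h1 := LinearMap.congr_fun (commute_leftAct_rightAct X y (op a)).eq (rightAct X (op z) x)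
    change leftAct X y (rightAct X (op z) (rightAct X (op a) x)) = _
    rw [← Module.End.mul_apply (rightAct X (op z)), ← map_mul, ← op_mul,
      Subalgebra.mem_center_iff.mp hz, op_mul, map_mul]
    exact h1
  -- The elements `π k (g (l k 1))` are the diagonal entries of `g` in the dual basis.
  refine ⟨∑ k, s.toFun (π k (g (l k 1))), ?_⟩
  -- Left multiplication by the diagonal entry is `π k ∘ g ∘ l k`. Rotating `π k` to the end of the
  -- trace moves the computation from `A` to `X`; summation over `k` then uses `∑ l k ∘ π k = 1`.
  have hchi : ∀ i k, U.chi i (1 ⊗ₜ π k (g (l k 1))) =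
      LinearMap.trace F (F ⊗[R] X) (((l k ∘ₗ π k).baseChange F ∘ₗ
        baseChangeRightAct F X (op (U.e i))) ∘ₗ g.baseChange F) := by
    intro i k
    have hcomm : LinearMap.mulRight F (U.e i) ∘ₗ (π k).baseChange F =
        (π k).baseChange F ∘ₗ baseChangeRightAct F X (op (U.e i)) := by
      refine TensorProduct.AlgebraTensorModule.ext fun c x => ?_
      rw [LinearMap.comp_apply, LinearMap.comp_apply, LinearMap.mulRight_apply,
        LinearMap.baseChange_tmul]
      generalize U.e i = t
      induction t using TensorProduct.induction_on with
      | zero => simp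
      | add t t' h h' => simp only [op_add, map_add, LinearMap.add_apply, mul_add, h, h']
      | tmul d a =>
        rw [baseChangeRightAct_tmul, Algebra.TensorProduct.tmul_mul_tmul,
          LinearMap.baseChange_tmul, hπ, mul_comm d]
    have hleft : LinearMap.mulLeft F ((1 : F) ⊗ₜ[R] π k (g (l k 1))) =
        (π k).baseChange F ∘ₗ g.baseChange F ∘ₗ (l k).baseChange F := by
      refine TensorProduct.AlgebraTensorModule.ext fun c a => ?_
      rw [LinearMap.comp_apply, LinearMap.comp_apply, LinearMap.mulLeft_apply,
        LinearMap.baseChange_tmul, LinearMap.baseChange_tmul, LinearMap.baseChange_tmul,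
        Algebra.TensorProduct.tmul_mul_tmul, one_mul, ← hπ, ← hg, ← hl, one_mul]
    rw [U.chi_apply, LinearMap.trace_mul_comm, hleft, Module.End.mul_eq_comp,
      ← LinearMap.comp_assoc, hcomm, ← LinearMap.comp_assoc, LinearMap.trace_comp_comm',
      LinearMap.baseChange_comp]
    rfl
  have hsum : ∀ i, ∑ k, U.chi i (1 ⊗ₜ π k (g (l k 1))) =
      (baseChangeBimod F X).chr F ((1 ⊗ₜ y) ⊗ₜ op ((1 ⊗ₜ z) * U.e i)) := by
    intro i
    simp_rw [hchi, ← Module.End.mul_eq_comp]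
    rw [← map_sum, ← Finset.sum_mul, ← Finset.sum_mul]
    have h1 : ∑ k, (l k ∘ₗ π k).baseChange F = 1 := by
      refine TensorProduct.AlgebraTensorModule.ext fun c x => ?_
      simp_rw [LinearMap.sum_apply, LinearMap.baseChange_tmul]
      rw [← TensorProduct.tmul_sum, ← LinearMap.sum_apply, hlπ]
      rfl
    rw [h1, one_mul, chr_baseChangeBimod, op_mul,
      map_mul (baseChangeRightAct F X), ← mul_assoc,
      (commute_baseChangeActs F X _ _).eq, mul_assoc]
    congr 2
    refine TensorProduct.AlgebraTensorModule.ext fun c x => ?_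
    rw [LinearMap.baseChange_tmul, Module.End.mul_apply, Module.End.mul_apply,
      baseChangeRightAct_tmul, baseChangeLeftAct_tmul, one_mul, one_mul]
  rw [map_sum]
  have h2 : ∀ k, algebraMap R F (s.toFun (π k (g (l k 1)))) =
      ∑ i, s.ext (U.e i) * U.chi i (1 ⊗ₜ π k (g (l k 1))) := fun k => by
    rw [← U.traceForm_eq_sum s.mul_comm, s.ext_tmul, one_mul]
  simp_rw [h2]
  rw [Finset.sum_comm]
  simp_rw [← Finset.mul_sum, hsum]

theorem exists_sum_K0chr_eq_algebraMap (s : SymmForm R F A) (U : MatUnits F (F ⊗[R] A))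
    (M : biprojectiveSubgroup R B A) (y : B) {z : A} (hz : z ∈ Subalgebra.center R A) :
    ∃ r : R, ∑ i, s.ext (U.e i) * K0chr F (virtualBaseChange F (M : SplitK0 (B ⊗[R] Aᵐᵒᵖ)))
      ((1 ⊗ₜ y) ⊗ₜ op ((1 ⊗ₜ z) * U.e i)) = algebraMap R F r := by
  obtain ⟨M, hM⟩ := M
  unfold virtualBaseChange
  induction hM using AddSubgroup.closure_induction with
  | mem x hx =>
    obtain ⟨X, hX, rfl⟩ := hx
    rw [← virtualBaseChange, K0chr_virtualBaseChange_cls]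
    exact exists_sum_chr_eq_algebraMap s U hX y hz
  | zero => exact ⟨0, by simp⟩
  | add x y _ _ hx hy =>
    obtain ⟨r, hr⟩ := hx
    obtain ⟨r', hr'⟩ := hy
    exact ⟨r + r', by simp only [map_add, LinearMap.add_apply, mul_add, Finset.sum_add_distrib,
      hr, hr']⟩
  | neg x _ hx =>
    obtain ⟨r, hr⟩ := hx
    exact ⟨-r, by simp only [map_neg, LinearMap.neg_apply, mul_neg, Finset.sum_neg_distrib, hr]⟩

end Symmetric

/-! ### Centers -/

namespace MatUnits

variable {F S T : Type u} [Field F] [Ring S] [Algebra F S] [Module.Finite F S] [Ring T]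
  [Algebra F T] [Module.Finite F T] (U : MatUnits F S) (V : MatUnits F T) (π : Fin U.n ≃ Fin V.n)

/-- The isomorphism between centers induced by a bijection between blocks. -/
def permCenter : Subalgebra.center F S ≃ₐ[F] Subalgebra.center F T :=
  (U.centerEquiv.trans (AlgEquiv.piCongrLeft' F (fun _ => F) π)).trans V.centerEquiv.symm

theorem permCenter_cCenter (i : Fin U.n) :
    U.permCenter V π (U.cCenter i) = V.cCenter (π i) := by
  change V.centerEquiv.symm (AlgEquiv.piCongrLeft' F (fun _ => F) π (U.centerEquiv (U.cCenter i))) =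
    _
  rw [AlgEquiv.symm_apply_eq, centerEquiv_cCenter, centerEquiv_cCenter]
  funext j
  change (Pi.single i 1 : Fin U.n → F) (π.symm j) = _
  simp [Pi.single_apply, Equiv.symm_apply_eq]

theorem coe_permCenter (z : Subalgebra.center F S) :
    (U.permCenter V π z : T) = ∑ i, U.chi i (z * U.e i) • V.c (π i) := by
  change ∑ j, U.chi (π.symm j) (z * U.e (π.symm j)) • V.c j = _
  rw [← Equiv.sum_comp π]
  simp

theorem algEquiv_center_ext {T : Type u} [Ring T] [Algebra F T]
    {f g : Subalgebra.center F S ≃ₐ[F] Subalgebra.center F T}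
    (h : ∀ i, f (U.cCenter i) = g (U.cCenter i)) : f = g := by
  refine AlgEquiv.ext fun z => ?_
  have hz : z = ∑ i, U.chi i (z * U.e i) • U.cCenter i := by
    conv_lhs => rw [← U.centerEquiv.symm_apply_apply z]
    apply Subtype.ext
    rw [AddSubmonoidClass.coe_finsetSum]
    rfl
  rw [hz, map_sum, map_sum]
  simp_rw [map_smul, h]

theorem permCenter_symm : (U.permCenter V π).symm = V.permCenter U π.symm := by
  refine V.algEquiv_center_ext fun j => ?_
  rw [AlgEquiv.symm_apply_eq, permCenter_cCenter, permCenter_cCenter, Equiv.apply_symm_apply]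

/-- Multiplication by `c i` isolates the term of the block `i` in the expansion of a trace form. -/
theorem traceForm_c_mul {g : S →ₗ[F] F} (hg : ∀ s t, g (s * t) = g (t * s)) (i : Fin U.n) (t : S) :
    g (U.c i * t) = g (U.e i) * U.chi i t := by
  rw [U.traceForm_eq_sum hg, Finset.sum_eq_single i]
  · rw [U.chi_mul_central (U.c_mem_center i), c_mul_e, if_pos rfl, chi_e_self, one_mul]
  · intro j _ hj
    rw [U.chi_mul_central (U.c_mem_center i), c_mul_e, if_neg hj, map_zero, zero_mul, mul_zero]
  · simp

end MatUnits

/-- An isomorphism which identifies the images of two subalgebras restricts to them. -/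
theorem exists_algEquiv_of_forall_exists {R F : Type*} [CommRing R]
    [CommRing F] [Algebra R F] {Z Z' W W' : Type*} [Ring Z] [Algebra R Z] [Ring Z']
    [Algebra R Z'] [Ring W] [Algebra R W] [Algebra F W] [Ring W'] [Algebra R W'] [Algebra F W']
    [IsScalarTower R F W] [IsScalarTower R F W'] {f : Z →ₐ[R] W} {f' : Z' →ₐ[R] W'}
    (hf : Function.Injective f) (hf' : Function.Injective f') (φ : W ≃ₐ[F] W')
    (h : ∀ z, ∃ z', φ (f z) = f' z') (h' : ∀ z', ∃ z, φ.symm (f' z') = f z) :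
    ∃ ψ : Z ≃ₐ[R] Z', ∀ z, φ (f z) = f' (ψ z) := by
  choose g hg using h
  let G : Z →ₐ[R] Z' := AlgHom.ofLinearMap
    { toFun := g
      map_add' := fun x y => hf' (by rw [map_add, ← hg, ← hg, ← hg, map_add, map_add])
      map_smul' := fun r x => hf' (by
        rw [RingHom.id_apply, map_smul, ← hg, ← hg, map_smul, ← algebraMap_smul F, map_smul,
          algebraMap_smul]) }
    (hf' (by change f' (g 1) = _; rw [← hg, map_one, map_one, map_one]))
    (fun x y => hf' (by
      change f' (g (x * y)) = f' (g x * g y)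
      rw [map_mul, ← hg, ← hg, ← hg, map_mul, map_mul]))
  refine ⟨AlgEquiv.ofBijective G ⟨fun x y hxy => ?_, fun w => ?_⟩, hg⟩
  · apply hf
    apply φ.injective
    rw [hg, hg]
    exact congrArg f' hxy
  · obtain ⟨z, hz⟩ := h' w
    refine ⟨z, hf' ?_⟩
    change f' (g z) = _
    rw [← hg, ← hz, AlgEquiv.apply_symm_apply]

/-! ### Transfer between integral centers. -/

section Transfer

variable {R : Type u} [CommRing R] {F : Type u} [Field F] [Algebra R F] [FaithfulSMul R F]
  {A B : Type u} [Ring A] [Ring B] [Algebra R A] [Algebra R B]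
  [Module.Free R B]

variable (R F B) in
theorem centerMap_injective : Function.Injective (centerMap R F B) := by
  intro z w h
  have h1 := congrArg Subtype.val h
  exact Subtype.ext (Algebra.TensorProduct.includeRight_injective
    (FaithfulSMul.algebraMap_injective R F) h1)

theorem mem_center_of_tmul_mem_center {w : B}
    (h : (1 : F) ⊗ₜ[R] w ∈ Subalgebra.center F (F ⊗[R] B)) : w ∈ Subalgebra.center R B := by
  rw [Subalgebra.mem_center_iff]
  intro b
  have h1 := Subalgebra.mem_center_iff.mp h (1 ⊗ₜ b)
  rw [Algebra.TensorProduct.tmul_mul_tmul, Algebra.TensorProduct.tmul_mul_tmul, one_mul] at h1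
  exact Algebra.TensorProduct.includeRight_injective (FaithfulSMul.algebraMap_injective R F) h1

/-- The coefficients are those for which pairing with `y ∈ B` under `sB` gives the integral sum of
`exists_sum_K0chr_eq_algebraMap`. The self-duality of `B` then puts the central element in `B`. The
resulting map of centers is linear but carries the extra factors `ε i * sA (e i) / sB (e (π i))`. -/
theorem exists_center_transfer [Module.Finite R A] [Module.Finite R B] {sA : SymmForm R F A} {sB : SymmForm R F B}
    {U : MatUnits F (F ⊗[R] A)} {V : MatUnits F (F ⊗[R] B)} {π : Fin U.n ≃ Fin V.n}
    {ε : Fin U.n → F} {M : biprojectiveSubgroup R B A}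
    (hM : ∀ j i, K0chr F (virtualBaseChange F (M : SplitK0 (B ⊗[R] Aᵐᵒᵖ))) (V.e j ⊗ₜ op (U.e i)) =
      if j = π i then ε i else 0)
    (z : Subalgebra.center R A) :
    ∃ w : Subalgebra.center R B, (centerMap R F B w : F ⊗[R] B) =
      ∑ i, (ε i * sA.ext (U.e i) / sB.ext (V.e (π i)) *
        U.chi i (centerMap R F A z * U.e i)) • V.c (π i) := by
  -- For fixed `i` the character is a trace form in `t`; its coefficients are the column `i` of the
  -- signed permutation matrix, so a single irreducible character survives.
  have hθ : ∀ t i, K0chr F (virtualBaseChange F (M : SplitK0 (B ⊗[R] Aᵐᵒᵖ))) (t ⊗ₜ op (U.e i)) =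
      ε i * V.chi (π i) t := by
    intro t i
    let g : F ⊗[R] B →ₗ[F] F := K0chr F (virtualBaseChange F (M : SplitK0 (B ⊗[R] Aᵐᵒᵖ))) ∘ₗ
      (TensorProduct.mk F (F ⊗[R] B) (F ⊗[R] A)ᵐᵒᵖ).flip (op (U.e i))
    have hg : ∀ s t, g (s * t) = g (t * s) := by
      intro s t
      have h := K0chr_mul_comm F (virtualBaseChange F (M : SplitK0 (B ⊗[R] Aᵐᵒᵖ)))
        (s ⊗ₜ op (U.e i)) (t ⊗ₜ op (U.e i))
      rwa [Algebra.TensorProduct.tmul_mul_tmul, Algebra.TensorProduct.tmul_mul_tmul, ← op_mul,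
        U.e_mul_e] at h
    refine (V.traceForm_eq_sum hg t).trans ?_
    have hg' : ∀ j, g (V.e j) = if j = π i then ε i else 0 := fun j => hM j i
    simp [hg']
  set w' : F ⊗[R] B := ∑ i, (ε i * sA.ext (U.e i) / sB.ext (V.e (π i)) *
    U.chi i (centerMap R F A z * U.e i)) • V.c (π i) with hw'
  obtain ⟨w, hw⟩ := sB.integral w' fun y => by
    obtain ⟨r, hr⟩ := exists_sum_K0chr_eq_algebraMap sA U M y z.2
    refine ⟨r, ?_⟩
    rw [← hr, hw', Finset.sum_mul, map_sum]
    refine Finset.sum_congr rfl fun i _ => ?_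
    have hz := U.mul_e_of_central (centerMap R F A z).2 i
    change (1 ⊗ₜ z.1) * U.e i = _ at hz
    rw [smul_mul_assoc, map_smul, V.traceForm_c_mul sB.mul_comm, hz, op_smul,
      TensorProduct.tmul_smul, map_smul, hθ, smul_eq_mul, smul_eq_mul]
    have := sB.ext_e_ne_zero V (π i)
    change _ = sA.ext (U.e i) * (U.chi i (centerMap R F A z * U.e i) * _)
    field_simp
  have hc : w' ∈ Subalgebra.center F (F ⊗[R] B) :=
    sum_mem fun i _ => Subalgebra.smul_mem _ (V.c_mem_center _) _
  exact ⟨⟨w, mem_center_of_tmul_mem_center (hw ▸ hc)⟩, hw.symm⟩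

/-- Transferring `1` backwards gives an integral central `u` whose central characters are `ε i * sB
(e (π i)) / sA (e i)`. These cancel the extra factors of the forward transfer because `ε i * ε i =
1`, so the transfer of `u * z` is exactly the permuted `z`. -/
theorem exists_permCenter_eq_centerMap [Module.Finite R A] [Module.Finite R B]
    [Module.Free R A] {sA : SymmForm R F A} {sB : SymmForm R F B}
    {U : MatUnits F (F ⊗[R] A)} {V : MatUnits F (F ⊗[R] B)} {π : Fin U.n ≃ Fin V.n}
    {ε : Fin U.n → F} {M : biprojectiveSubgroup R B A} {N : biprojectiveSubgroup R A B}
    (hε : ∀ i, ε i * ε i = 1)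
    (hM : ∀ j i, K0chr F (virtualBaseChange F (M : SplitK0 (B ⊗[R] Aᵐᵒᵖ))) (V.e j ⊗ₜ op (U.e i)) =
      if j = π i then ε i else 0)
    (hN : ∀ i j, K0chr F (virtualBaseChange F (N : SplitK0 (A ⊗[R] Bᵐᵒᵖ))) (U.e i ⊗ₜ op (V.e j)) =
      if i = π.symm j then ε (π.symm j) else 0)
    (z : Subalgebra.center R A) :
    ∃ w : Subalgebra.center R B, U.permCenter V π (centerMap R F A z) = centerMap R F B w := by
  obtain ⟨u, hu⟩ := exists_center_transfer (sA := sB) (sB := sA) (π := π.symm)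
    (ε := fun j => ε (π.symm j)) hN 1
  obtain ⟨w, hw⟩ := exists_center_transfer (sA := sA) (sB := sB) hM (u * z)
  refine ⟨w, Subtype.ext ?_⟩
  rw [hw, MatUnits.coe_permCenter]
  refine Finset.sum_congr rfl fun i _ => congrArg (· • V.c (π i)) ?_
  have h1 : U.chi i (centerMap R F A u * U.e i) =
      ε i * sB.ext (V.e (π i)) / sA.ext (U.e i) := by
    rw [hu, Finset.sum_mul, map_sum, Finset.sum_eq_single (π i)]
    · simp [MatUnits.c_mul_e, MatUnits.chi_e_self]
    · intro j _ hj
      rw [smul_mul_assoc, MatUnits.c_mul_e, if_neg, smul_zero, map_zero]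
      rintro rfl
      simp at hj
    · simp
  have h2 : (centerMap R F A (u * z) : F ⊗[R] A) = centerMap R F A u * centerMap R F A z := by
    rw [map_mul]; rfl
  rw [h2, mul_assoc, U.chi_mul_central (centerMap R F A u).2, h1]
  have hA := sA.ext_e_ne_zero U i
  have hB := sB.ext_e_ne_zero V (π i)
  have hε' := hε i
  field_simp
  rw [pow_two, hε', mul_one]

end Transfer

/-! ### Galois twists -/

theorem tmul_op_idempotent {F S T : Type*} [CommRing F] [Ring S] [Algebra F S] [Ring T]
    [Algebra F T] {s : S} {t : T} (hs : s * s = s) (ht : t * t = t) :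
    (s ⊗ₜ[F] op t) * (s ⊗ₜ[F] op t) = s ⊗ₜ[F] op t := by
  rw [Algebra.TensorProduct.tmul_mul_tmul, hs, ← op_mul, ht]

/-- The image of a system of matrix units under a semilinear ring automorphism. -/
def MatUnits.map {F S : Type u} [Field F] [Ring S] [Algebra F S] (U : MatUnits F S) (θ : S ≃+* S)
    (τ : F → F) (hθ : ∀ c s, θ (c • s) = τ c • θ s) : MatUnits F S where
  n := U.n
  d := U.d
  E i a b := θ (U.E i a b)
  mul_same i a b c := by rw [← map_mul, U.mul_same]
  mul_of_ne i a b b' c h := by rw [← map_mul, U.mul_of_ne _ _ _ _ _ h, map_zero]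
  mul_of_block_ne i j a b c d h := by
    rw [← map_mul, U.mul_of_block_ne _ _ _ _ _ _ h, map_zero]
  sum_diag := by
    simp_rw [← map_sum]
    rw [U.sum_diag, map_one]
  span_eq_top := by
    rw [eq_top_iff]
    rintro t -
    obtain ⟨t, rfl⟩ := θ.surjective t
    refine U.induction t ?_ ?_ ?_ ?_
    · rw [map_zero]; exact zero_mem _
    · exact fun i a b => Submodule.subset_span ⟨i, a, b, rfl⟩
    · exact fun s t hs ht => by rw [map_add]; exact add_mem hs ht
    · exact fun r s hs => by rw [hθ]; exact Submodule.smul_mem _ _ hs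
  ne_zero i := by
    rw [Ne, EmbeddingLike.map_eq_zero_iff]
    exact U.ne_zero i

/-- At an idempotent the character is a dimension, which does not change when scalars are relabelled
by `τ`. This is why `τ` is absent from the right side. -/
theorem K0chr_restrict {F S : Type u} [Field F] [Ring S] [Algebra F S] [Module.Finite F S]
    (θ : S ≃+* S) (τ : F ≃ F) (hθ : ∀ c, θ (algebraMap F S c) = algebraMap F S (τ c))
    (χ : SplitK0 S) {s : S} (hs : s * s = s) :
    K0chr F ((restrictFunctor θ).K0map χ) s = K0chr F χ (θ s) := by
  induction χ using SplitK0.induction with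
  | hcls X =>
    rw [FGFunctor.K0map_cls, K0chr_cls, K0chr_cls, FGMod.chr_idempotent F _ hs,
      FGMod.chr_idempotent F X (by rw [← map_mul, hs])]
    congr 1
    let X' := (restrictFunctor θ).obj X
    let j : LinearMap.range (X'.rep F s) ≃+ LinearMap.range (X.rep F (θ s)) :=
      { toFun := fun x => ⟨x.1, x.2⟩
        invFun := fun x => ⟨x.1, x.2⟩
        left_inv := fun _ => rfl
        right_inv := fun _ => rfl
        map_add' := fun _ _ => rfl }
    refine congrArg Cardinal.toNat (rank_eq_of_equiv_equiv τ j τ.bijective fun c x => ?_)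
    refine Subtype.ext ?_
    have h : ∀ y : X, θ (algebraMap F S c) • y = algebraMap F S (τ c) • y := fun y => by rw [hθ]
    exact h x.1
  | hsub M N hM hN => simp only [map_sub, LinearMap.sub_apply, hM, hN]

section Twist

variable {R K F : Type u} [CommRing R] [Field K] [Algebra R K] [Field F] [Algebra R F]
  [Algebra K F] [IsScalarTower R K F] {A B : Type u} [Ring A] [Algebra R A] [Ring B] [Algebra R B]

theorem twistEquiv_symm_tmul (σ : F ≃ₐ[K] F) (c : F) (a : A) :
    (twistEquiv R A σ).symm (c ⊗ₜ a) = σ c ⊗ₜ a := rfl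

theorem twistEquiv_symm_smul (σ : F ≃ₐ[K] F) (c : F) (s : F ⊗[R] A) :
    (twistEquiv R A σ).symm (c • s) = σ c • (twistEquiv R A σ).symm s := by
  induction s using TensorProduct.induction_on with
  | zero => simp
  | add s t hs ht => simp only [smul_add, map_add, hs, ht]
  | tmul d a =>
    rw [TensorProduct.smul_tmul', twistEquiv_symm_tmul, twistEquiv_symm_tmul,
      TensorProduct.smul_tmul', smul_eq_mul, smul_eq_mul, map_mul]

variable [Module.Finite R A] [Module.Finite R B] [IsDomain R] [IsPrincipalIdealRing R]
  [Module.Free R B]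

/-- On pure tensors the value is `c * d` times an element coming from `R`, and `σ` fixes the latter
because the map from `R` factors through `K`. -/
theorem K0chr_virtualBaseChange_twist (σ : F ≃ₐ[K] F) (M : biprojectiveSubgroup R B A)
    (t : F ⊗[R] B) (s : F ⊗[R] A) :
    K0chr F (virtualBaseChange F (M : SplitK0 (B ⊗[R] Aᵐᵒᵖ)))
      ((twistEquiv R B σ).symm t ⊗ₜ op ((twistEquiv R A σ).symm s)) =
      σ (K0chr F (virtualBaseChange F (M : SplitK0 (B ⊗[R] Aᵐᵒᵖ))) (t ⊗ₜ op s)) := by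
  induction t using TensorProduct.induction_on with
  | zero => simp
  | add s t hs ht => simp only [TensorProduct.add_tmul, map_add, hs, ht]
  | tmul c b =>
    induction s using TensorProduct.induction_on with
    | zero => simp
    | add s t hs ht => simp only [TensorProduct.tmul_add, op_add, map_add, hs, ht]
    | tmul d a =>
      obtain ⟨r, hr⟩ := exists_K0chr_virtualBaseChange_tmul F M b a
      rw [twistEquiv_symm_tmul, twistEquiv_symm_tmul, hr, hr, map_mul, map_mul,
        IsScalarTower.algebraMap_apply R K F, AlgEquiv.commutes]

/-- Test the equality at the matrix units moved by the inverse twists. Twisting the modules undoes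
this motion, and for `M` it changes the matrix entries only by `σ`, which fixes integers. -/
theorem virtualAct_twist [CharZero F] (U : MatUnits F (F ⊗[R] A)) (V : MatUnits F (F ⊗[R] B))
    (σ : F ≃ₐ[K] F) (M : biprojectiveSubgroup R B A) (χ : SplitK0 (F ⊗[R] A)) :
    virtualAct (virtualBaseChange F (M : SplitK0 (B ⊗[R] Aᵐᵒᵖ)))
        ((restrictFunctor (twistEquiv R A σ)).K0map χ) =
      (restrictFunctor (twistEquiv R B σ)).K0map
        (virtualAct (virtualBaseChange F (M : SplitK0 (B ⊗[R] Aᵐᵒᵖ))) χ) := by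
  have hAσ : ∀ c, twistEquiv R A σ (algebraMap F _ c) =
      algebraMap F (F ⊗[R] A) (σ.symm.toEquiv c) := fun _ => rfl
  have hBσ : ∀ c, twistEquiv R B σ (algebraMap F _ c) =
      algebraMap F (F ⊗[R] B) (σ.symm.toEquiv c) := fun _ => rfl
  let U' := U.map (twistEquiv R A σ).symm σ (twistEquiv_symm_smul σ)
  let V' := V.map (twistEquiv R B σ).symm σ (twistEquiv_symm_smul σ)
  refine V'.K0_ext fun j => ?_
  rw [K0chr_restrict _ _ hBσ _ (V'.e_mul_e j), K0chr_virtualAct U', K0chr_virtualAct U]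
  refine Finset.sum_congr rfl fun i _ => ?_
  rw [K0chr_restrict _ _ hAσ _ (U'.e_mul_e i)]
  have hU : U'.e i = (twistEquiv R A σ).symm (U.e i) := rfl
  have hV : V'.e j = (twistEquiv R B σ).symm (V.e j) := rfl
  rw [hU, hV, RingEquiv.apply_symm_apply, RingEquiv.apply_symm_apply,
    K0chr_virtualBaseChange_twist]
  obtain ⟨m, hm⟩ := exists_int_K0chr F (virtualBaseChange F (M : SplitK0 (B ⊗[R] Aᵐᵒᵖ)))
    (tmul_op_idempotent (V.e_mul_e j) (U.e_mul_e i))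
  rw [hm, map_intCast]

end Twist

/-- A virtual bimodule which, together with its dual, induces a virtual Morita equivalence has a
signed permutation matrix as matrix of multiplicities. -/
theorem IsVirtualMorita.exists_equiv {R F A B : Type u} [CommRing R] [IsDomain R]
    [IsPrincipalIdealRing R] [Field F] [CharZero F] [Algebra R F] [Ring A] [Ring B] [Algebra R A]
    [Algebra R B] [Module.Finite R A] [Module.Finite R B] [Module.Free R B]
    {hA : IsSelfDualAlgebra R A} {hB : IsSelfDualAlgebra R B} {M : biprojectiveSubgroup R B A}
    (hM : IsVirtualMorita M (virtualDual hB hA M)) (U : MatUnits F (F ⊗[R] A))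
    (V : MatUnits F (F ⊗[R] B)) :
    ∃ (π : Fin U.n ≃ Fin V.n) (ε : Fin U.n → ℤˣ), ∀ j i,
      K0chr F (virtualBaseChange F (M : SplitK0 (B ⊗[R] Aᵐᵒᵖ))) (V.e j ⊗ₜ op (U.e i)) =
        if j = π i then ((ε i : ℤ) : F) else 0 := by
  choose m hm using fun j i => exists_int_K0chr F
    (virtualBaseChange F (M : SplitK0 (B ⊗[R] Aᵐᵒᵖ)))
    (tmul_op_idempotent (F := F) (V.e_mul_e j) (U.e_mul_e i))
  have hleft := hM.left
  have hright := hM.right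
  -- Only diagonal entries of the two product identities are needed; since the dual has the
  -- transposed matrix, they say that rows and columns have sum of squares `1`.
  obtain ⟨π, ε, h⟩ := exists_equiv_of_orthogonal (m := m) (fun j => by
      have h := K0chr_virtualBaseChange_virtualTensor U (M : SplitK0 (B ⊗[R] Aᵐᵒᵖ))
        (virtualDual hB hA M : SplitK0 (A ⊗[R] Bᵐᵒᵖ)) (V.e j) (op (V.e j))
      simp_rw [K0chr_virtualBaseChange_virtualDual] at h
      rw [hleft, K0chr_virtualBaseChange_regular, if_pos rfl] at h
      simp_rw [hm] at h
      exact_mod_cast h.symm) (fun i => by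
      have h := K0chr_virtualBaseChange_virtualTensor V
        (virtualDual hB hA M : SplitK0 (A ⊗[R] Bᵐᵒᵖ)) (M : SplitK0 (B ⊗[R] Aᵐᵒᵖ))
        (U.e i) (op (U.e i))
      simp_rw [K0chr_virtualBaseChange_virtualDual] at h
      rw [hright, K0chr_virtualBaseChange_regular, if_pos rfl] at h
      simp_rw [hm] at h
      exact_mod_cast h.symm)
  exact ⟨π, ε, fun j i => by rw [hm, h]; split_ifs <;> simp⟩

end

/-! ### Assembly of the main theorem. -/

theorem theorem1p3 (p : ℕ) [Fact p.Prime]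
    (O K : Type u) [CommRing O] [IsDomain O] [IsDiscreteValuationRing O]
    [IsAdicComplete (IsLocalRing.maximalIdeal O) O]
    [Field K] [Algebra O K] [IsFractionRing O K] [CharZero K]
    [CharP (IsLocalRing.ResidueField O) p]
    (A B : Type u) [Ring A] [Algebra O A] [Module.Finite O A] [Module.Free O A]
    [Ring B] [Algebra O B] [Module.Finite O B] [Module.Free O B]
    (hA : IsSelfDualAlgebra O A) (hB : IsSelfDualAlgebra O B)
    (K' : Type u) [Field K'] [Algebra O K'] [Algebra K K'] [IsScalarTower O K K']
    [IsSemisimpleRing (K' ⊗[O] A)] [IsSemisimpleRing (K' ⊗[O] B)]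
    (hA' : IsSplitAlgebra K' (K' ⊗[O] A)) (hB' : IsSplitAlgebra K' (K' ⊗[O] B))
    (M : biprojectiveSubgroup O B A)
    (hM : IsVirtualMorita M (virtualDual hB hA M)) :
    ∃ (I : Irr (K' ⊗[O] A) ≃ Irr (K' ⊗[O] B)) (ε : Irr (K' ⊗[O] A) → ℤˣ),
      (∀ χ : Irr (K' ⊗[O] A),
        (ε χ : ℤ) • (I χ : SplitK0 (K' ⊗[O] B)) =
          virtualAct (virtualBaseChange K' (M : SplitK0 (B ⊗[O] Aᵐᵒᵖ)))
            (χ : SplitK0 (K' ⊗[O] A))) ∧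
      (∃ φ : Subalgebra.center K' (K' ⊗[O] A) ≃ₐ[K'] Subalgebra.center K' (K' ⊗[O] B),
        (∀ χ, φ (centralIdempotent K' χ) = centralIdempotent K' (I χ)) ∧
        (∀ φ' : Subalgebra.center K' (K' ⊗[O] A) ≃ₐ[K'] Subalgebra.center K' (K' ⊗[O] B),
          (∀ χ, φ' (centralIdempotent K' χ) = centralIdempotent K' (I χ)) → φ' = φ) ∧
        ∃ ψ : Subalgebra.center O A ≃ₐ[O] Subalgebra.center O B,
          ∀ z, φ (centerMap O K' A z) = centerMap O K' B (ψ z)) ∧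
      (∀ (σ : K' ≃ₐ[K] K') (χ : Irr (K' ⊗[O] A)),
        I (galoisTwist O A σ χ) = galoisTwist O B σ (I χ)) := by
  have _ : CharZero K' := charZero_of_injective_algebraMap (algebraMap K K').injective
  have _ : FaithfulSMul O K' := by
    rw [faithfulSMul_iff_algebraMap_injective, IsScalarTower.algebraMap_eq O K K']
    exact (algebraMap K K').injective.comp (IsFractionRing.injective O K)
  obtain ⟨U⟩ := hA'.nonempty_matUnits
  obtain ⟨V⟩ := hB'.nonempty_matUnits
  obtain ⟨π, ε, hπ⟩ := hM.exists_equiv U V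
  let I : Irr (K' ⊗[O] A) ≃ Irr (K' ⊗[O] B) := (U.irrEquiv.symm.trans π).trans V.irrEquiv
  have hI : ∀ i, I (U.irrEquiv i) = V.irrEquiv (π i) := fun i => by simp [I]
  have hact : ∀ χ : Irr (K' ⊗[O] A), (ε (U.irrEquiv.symm χ) : ℤ) • (I χ : SplitK0 (K' ⊗[O] B)) =
      virtualAct (virtualBaseChange K' (M : SplitK0 (B ⊗[O] Aᵐᵒᵖ)))
        (χ : SplitK0 (K' ⊗[O] A)) := by
    intro χ
    obtain ⟨i, rfl⟩ := U.irrEquiv.surjective χ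
    -- Both sides have the multiplicity `ε i` at `j = π i` and `0` elsewhere.
    refine V.K0_ext fun j => ?_
    rw [hI, Equiv.symm_apply_apply, K0chr_virtualAct U, map_zsmul, LinearMap.smul_apply,
      V.K0chr_irrEquiv_e]
    simp_rw [hπ, U.K0chr_irrEquiv_e]
    by_cases hj : j = π i
    · simp [hj]
    · simp [hj, Ne.symm hj]
  refine ⟨I, fun χ => ε (U.irrEquiv.symm χ), hact, ⟨U.permCenter V π, ?_, ?_, ?_⟩, ?_⟩
  · intro χ
    obtain ⟨i, rfl⟩ := U.irrEquiv.surjective χ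
    rw [hI, U.centralIdempotent_irrEquiv, V.centralIdempotent_irrEquiv, U.permCenter_cCenter]
  · intro φ' hφ'
    refine U.algEquiv_center_ext fun i => ?_
    rw [U.permCenter_cCenter, ← U.centralIdempotent_irrEquiv, hφ', hI,
      V.centralIdempotent_irrEquiv]
  · obtain ⟨sA⟩ := hA.nonempty_symmForm (F := K')
    obtain ⟨sB⟩ := hB.nonempty_symmForm (F := K')
    have hε : ∀ i, ((ε i : ℤ) : K') * ((ε i : ℤ) : K') = 1 := fun i => by
      rw [← Int.cast_mul, Int.units_coe_mul_self, Int.cast_one]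
    -- The dual of `M` has the transposed matrix, hence the inverse permutation with the same signs.
    have hπ' : ∀ i j, K0chr K' (virtualBaseChange K'
        (virtualDual hB hA M : SplitK0 (A ⊗[O] Bᵐᵒᵖ))) (U.e i ⊗ₜ op (V.e j)) =
          if i = π.symm j then ((ε (π.symm j) : ℤ) : K') else 0 := by
      intro i j
      rw [K0chr_virtualBaseChange_virtualDual, hπ]
      by_cases h : j = π i
      · simp [h]
      · rw [if_neg h, if_neg fun h' => h (by rw [h', Equiv.apply_symm_apply])]
    refine exists_algEquiv_of_forall_exists (centerMap_injective O K' A)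
      (centerMap_injective O K' B) (U.permCenter V π)
      (exists_permCenter_eq_centerMap (sA := sA) (sB := sB) hε hπ hπ') ?_
    -- The inverse preserves integrality by the same lemma, with `M` and its dual exchanged.
    rw [U.permCenter_symm]
    exact exists_permCenter_eq_centerMap (sA := sB) (sB := sA) (fun j => hε (π.symm j)) hπ'
      (by simpa using hπ)
  · intro σ χ
    -- The signs at `χ` and at its twist need not be compared in advance, since simple classes that
    -- agree up to signs are equal.
    apply V.irr_eq_of_smul_eq (ε := ε (U.irrEquiv.symm (galoisTwist O A σ χ)))
      (ε' := ε (U.irrEquiv.symm χ))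
    rw [hact]
    change virtualAct _ ((restrictFunctor (twistEquiv O A σ)).K0map χ) =
      _ • (restrictFunctor (twistEquiv O B σ)).K0map (I χ)
    rw [virtualAct_twist U V, ← hact, map_zsmul]
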